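/- Let $d\in\mathbb N$, $T>0$, $M_0>0$. Let $\mathcal P_1(X)$ be the Borel probability measures on $X$ with finite first moment, with the Wasserstein distance $d_1$. **Data.** Let $L_0:\mathbb R^d\times\mathbb R^d\times\mathcal P_1(\mathbb R^d)\to\mathbb R$ be continuous, with $(x,v)\mapsto L_0(x,v,m)$ of class $C^1$ and $D_vL_0$ differentiable in $v$ for every $m$, and such that for all $x,v,m$ $$D_v^2L_0(x,v,m)\ge \tfrac1{M_0}\mathrm{Id},\qquad |D_xL_0(x,v,m)|\le M_0(1+|v|^2),\qquad |D_vL_0(x,v,m)|\le M_0(1+|v|),$$ and $|L_0(x,v,m_1)-L_0(x,v,m_2)|\le\theta(|x|)\,\omega_0(d_1(m_1,m_2))$ for all $x,v,m_1,m_2$, with some nondecreasing $\theta:[0,\infty)\to[0,\infty)$ and some modulus of continuity $\omega_0$ (nonnegative, nondecreasing, with limit $\omega_0(0)=0$ at $0$). Let $g:\mathbb R^d\times\mathcal P_1(\mathbb R^d)\to\mathbb R$ be such that for every $m$ the function $g(\cdot,m)$ is bounded and $C^1$ with $M_0\ge\max\{\frac12,\frac12\|Dg(\cdot,m)\|_\infty\}$,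 and for every $x$ the function $g(x,\cdot)$ is uniformly continuous for $d_1$. Let $\mu_0$ be a probability measure on $\mathbb R^{2d}$ that is absolutely continuous with respect to the Lebesgue measure and has compact support. **Mean field games with control of acceleration.** For every $\varepsilon>0$ let $u^\varepsilon:[0,T]\times\mathbb R^{2d}\to\mathbb R$ be locally Lipschitz and $\mu^\varepsilon\in C([0,T];\mathcal P_1(\mathbb R^{2d}))$, and let $m^\varepsilon_t$ be the marginal of $\mu^\varepsilon_t$ in the space variable $x$. Suppose that $(u^\varepsilon,\mu^\varepsilon)$ is a solution of the system in the following sense: for all $(t,x,v)\in[0,T]\times\mathbb R^{2d}$ $$u^\varepsilon(t,x,v)=\inf\Big\{\int_t^T\Big(\frac\varepsilon2|\ddot\gamma(s)|^2+L_0(\gamma(s),\dot\gamma(s),m^\varepsilon_s)\Big)ds+g(\gamma(T),m^\varepsilon_T)\Big\},$$ the infimum being over the curves $\gamma\in H^2(0,T;\mathbb R^d)$ with $\gamma(t)=x$, $\dot\gamma(t)=v$; and, for every $t\in[0,T]$, $\mu^\varepsilon_t$ is the image of $\mu_0$ under a flow, defined for $\mu_0$-a.e. initial point at time $0$, of solutions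 on $[0,T]$ of $$\dot\gamma(t)=v(t),\qquad \dot v(t)=-\tfrac1\varepsilon D_vu^\varepsilon(t,\gamma(t),v(t))$$ (in the Carathéodory sense: the derivative $D_vu^\varepsilon$ exists along the solution at almost every time, is integrable in time, and the equations hold in integral form). **Limit problem.** For $m^0\in C([0,T];\mathcal P_1(\mathbb R^d))$ let $$u^0(t,x)=\inf\Big\{\int_t^TL_0(\gamma(s),\dot\gamma(s),m^0_s)\,ds+g(\gamma(T),m^0_T)\ :\ \gamma\in C^1([0,T];\mathbb R^d),\ \gamma(t)=x\Big\}.$$ **Theorem 4.8.** 1. Every sequence of positive numbers tending to $0$ has a subsequence $(\varepsilon_k)$ for which there is $m^0\in C([0,T];\mathcal P_1(\mathbb R^d))$ with $m^{\varepsilon_k}\to m^0$ in $C([0,T];\mathcal P_1(\mathbb R^d))$, the infimum $u^0(t,x)$ is finite for all $(t,x)\in[0,T]\times\mathbb R^d$, and $u^{\varepsilon_k}(t,x,v)\to u^0(t,x)$ locally uniformly in $(t,x,v)\in[0,T]\times\mathbb R^{2d}$. 2. For every sequence of positive numbers $\varepsilon_k\to0$ and every $m^0\in C([0,T];\mathcal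 P_1(\mathbb R^d))$ with $m^{\varepsilon_k}\to m^0$ in $C([0,T];\mathcal P_1(\mathbb R^d))$, the infimum $u^0$ is finite on $[0,T]\times\mathbb R^d$ and $u^{\varepsilon_k}(t,x,v)\to u^0(t,x)$ locally uniformly in $(t,x,v)\in[0,T]\times\mathbb R^{2d}$. -/

import Mathlib

open Set Filter Topology MeasureTheory

open scoped ENNReal Gradient

noncomputable section

namespace AccelMFG

/-- The Euclidean space `ℝ^d`. The phase space `ℝ^{2d}` is `E d × E d`; its product metric is
equivalent to the Euclidean one, so first moments, the topology of the Wasserstein distance and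
local Lipschitz continuity are the same for both. -/
abbrev E (d : ℕ) : Type := EuclideanSpace ℝ (Fin d)

section Wasserstein

/-- Borel probability measures with finite first moment. -/
structure P1 (X : Type) [MetricSpace X] [MeasurableSpace X] where
  toMeasure : Measure X
  isProbabilityMeasure : IsProbabilityMeasure toMeasure
  finite_moment : ∃ x₀ : X, ∫⁻ x, edist x₀ x ∂toMeasure < ⊤

/-- Transport plans between `m` and `m'`: measures on `X × X` with marginals `m` and `m'`. -/
def couplings {X : Type} [MetricSpace X] [MeasurableSpace X] (m m' : P1 X) :
    Set (Measure (X × X)) :=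
  {π | π.map Prod.fst = m.toMeasure ∧ π.map Prod.snd = m'.toMeasure}

/-- The Wasserstein distance of order one. -/
def d1 {X : Type} [MetricSpace X] [MeasurableSpace X] (m m' : P1 X) : ℝ :=
  (⨅ π ∈ couplings m m', ∫⁻ p, edist p.1 p.2 ∂π).toReal

/-- `m ∈ C([0,T]; P_1(X))`; only the values `m t` with `t ∈ [0,T]` matter. -/
def IsContinuousFlow {X : Type} [MetricSpace X] [MeasurableSpace X] (T : ℝ) (m : ℝ → P1 X) :
    Prop :=
  ∀ t ∈ Icc 0 T, Tendsto (fun s => d1 (m s) (m t)) (𝓝[Icc 0 T] t) (𝓝 0)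

/-- `m_k → m` in `C([0,T]; P_1(X))`, i.e. `sup_{t ∈ [0,T]} d_1(m_k(t), m(t)) → 0`. -/
def FlowTendsto {X : Type} [MetricSpace X] [MeasurableSpace X] (T : ℝ) (mk : ℕ → ℝ → P1 X)
    (m : ℝ → P1 X) : Prop :=
  ∀ η > 0, ∀ᶠ k in atTop, ∀ t ∈ Icc 0 T, d1 (mk k t) (m t) < η

/-- The space marginal `π_1 ♯ μ` of a measure on phase space. -/
def P1.spaceMarginal {d : ℕ} (μ : P1 (E d × E d)) : P1 (E d) where
  toMeasure := μ.toMeasure.map Prod.fst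
  isProbabilityMeasure := by
    have := μ.isProbabilityMeasure
    exact Measure.isProbabilityMeasure_map measurable_fst.aemeasurable
  finite_moment := by
    obtain ⟨z, hz⟩ := μ.finite_moment
    refine ⟨z.1, lt_of_le_of_lt ?_ hz⟩
    rw [lintegral_map (by fun_prop) measurable_fst]
    exact lintegral_mono fun p => by rw [Prod.edist_eq]; exact le_max_left _ _

end Wasserstein

section Assumptions

/-- A modulus of continuity on `ℝ_+`. -/
structure IsModulus (ω : ℝ → ℝ) : Prop where
  nonneg : ∀ r, 0 ≤ r → 0 ≤ ω r
  mono : MonotoneOn ω (Ici 0)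
  tendsto : Tendsto ω (𝓝[≥] 0) (𝓝 0)

/-- The assumptions on the Lagrangian `L₀(x, v, m)`. -/
structure LagrangianAssumptions (d : ℕ) (M₀ : ℝ) (L₀ : E d → E d → P1 (E d) → ℝ) : Prop where
  /-- `L₀` is jointly continuous on `ℝ^d × ℝ^d × P_1(ℝ^d)`. -/
  continuous : ∀ x v m, ∀ η > 0, ∃ δ > 0, ∀ x' v' m',
    dist x' x < δ → dist v' v < δ → d1 m' m < δ → |L₀ x' v' m' - L₀ x v m| < η
  contDiff : ∀ m, ContDiff ℝ 1 fun p : E d × E d => L₀ p.1 p.2 m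
  /-- `D_v L₀` is differentiable in `v`, so that the Hessian `D²_v L₀` exists. -/
  differentiable_grad : ∀ x m, Differentiable ℝ fun v => fderiv ℝ (fun w => L₀ x w m) v
  /-- `D²_v L₀ ≥ (1 / M₀) Id`. -/
  hessian_ge : ∀ x v m, ∀ h : E d,
    1 / M₀ * ‖h‖ ^ 2 ≤ fderiv ℝ (fun v' => fderiv ℝ (fun w => L₀ x w m) v') v h h
  grad_x_le : ∀ x v m, ‖fderiv ℝ (fun y => L₀ y v m) x‖ ≤ M₀ * (1 + ‖v‖ ^ 2)
  grad_v_le : ∀ x v m, ‖fderiv ℝ (fun w => L₀ x w m) v‖ ≤ M₀ * (1 + ‖v‖)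
  /-- Continuity in the measure, with a factor `θ(|x|)` that is bounded on bounded sets. -/
  measure_modulus : ∃ θ ω₀ : ℝ → ℝ, (∀ r, 0 ≤ r → 0 ≤ θ r) ∧ MonotoneOn θ (Ici 0) ∧
    IsModulus ω₀ ∧
    ∀ x v m₁ m₂, |L₀ x v m₁ - L₀ x v m₂| ≤ θ ‖x‖ * ω₀ (d1 m₁ m₂)

/-- The assumptions on the terminal cost `g(x, m)`, with the same constant `M₀`. -/
structure TerminalAssumptions (d : ℕ) (M₀ : ℝ) (g : E d → P1 (E d) → ℝ) : Prop where
  contDiff : ∀ m, ContDiff ℝ 1 fun x => g x m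
  bounded : ∀ m, ∃ C, ∀ x, |g x m| ≤ C
  half_le : 1 / 2 ≤ M₀
  grad_le : ∀ x m, 1 / 2 * ‖fderiv ℝ (fun y => g y m) x‖ ≤ M₀
  uniformContinuous : ∀ x, ∀ η > 0, ∃ δ > 0, ∀ m₁ m₂, d1 m₁ m₂ < δ → |g x m₁ - g x m₂| < η

/-- The assumptions on the initial distribution on phase space. -/
structure InitialAssumptions (d : ℕ) (μ₀ : Measure (E d × E d)) : Prop where
  isProbabilityMeasure : IsProbabilityMeasure μ₀
  absolutelyContinuous : μ₀ ≪ volume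
  compactSupport : ∃ K : Set (E d × E d), IsCompact K ∧ μ₀ Kᶜ = 0

end Assumptions

section ControlOfAcceleration

/-- The velocity of a `C¹` curve on `[0,T]`. -/
def velocity {d : ℕ} (T : ℝ) (γ : ℝ → E d) (s : ℝ) : E d := derivWithin γ (Icc 0 T) s

/-- The `C¹` curve `γ` on `[0,T]` belongs to `H²(0,T)` with second derivative `a ∈ L²(0,T)`:
its velocity is the primitive of `a`. Such an `a` is unique almost everywhere. -/
structure HasAcceleration {d : ℕ} (T : ℝ) (γ a : ℝ → E d) : Prop where
  memLp : MemLp a 2 (volume.restrict (Icc 0 T))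
  velocity_eq : ∀ s ∈ Icc 0 T, velocity T γ s = velocity T γ 0 + ∫ r in (0 : ℝ)..s, a r

/-- The finite values of `J^ε_{t,T}` on the `C¹` curves with `γ(t) = x`, `γ'(t) = v`. The cost is
`+∞` on the curves that are not in `H²(0,T)`, and these do not affect the infimum. -/
def accelerationCosts {d : ℕ} (T : ℝ) (L₀ : E d → E d → P1 (E d) → ℝ) (g : E d → P1 (E d) → ℝ)
    (ε : ℝ) (m : ℝ → P1 (E d)) (t : ℝ) (x v : E d) : Set ℝ :=
  {J | ∃ γ a : ℝ → E d, ContDiffOn ℝ 1 γ (Icc 0 T) ∧ HasAcceleration T γ a ∧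
    γ t = x ∧ velocity T γ t = v ∧
    J = (∫ s in t..T, (ε / 2 * ‖a s‖ ^ 2 + L₀ (γ s) (velocity T γ s) (m s))) + g (γ T) (m T)}

/-- `(γ, v)` solves `γ' = v`, `v' = -(1/ε) D_v u(t, γ, v)` on `[0,T]` in the Carathéodory sense:
`D_v u` has to exist along the solution for almost every time only. -/
structure IsCharacteristic {d : ℕ} (T ε : ℝ) (u : ℝ → E d → E d → ℝ) (γ v : ℝ → E d) :
    Prop where
  continuousOn_pos : ContinuousOn γ (Icc 0 T)
  continuousOn_vel : ContinuousOn v (Icc 0 T)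
  differentiable : ∀ᵐ s ∂volume.restrict (Icc 0 T), DifferentiableAt ℝ (fun w => u s (γ s) w) (v s)
  integrable : IntervalIntegrable (fun s => ∇ (fun w => u s (γ s) w) (v s)) volume 0 T
  pos_eq : ∀ t ∈ Icc 0 T, γ t = γ 0 + ∫ s in (0 : ℝ)..t, v s
  vel_eq : ∀ t ∈ Icc 0 T,
    v t = v 0 - (1 / ε) • ∫ s in (0 : ℝ)..t, ∇ (fun w => u s (γ s) w) (v s)

/-- `μ_t` is the image of `μ₀` under the flow `γ' = v`, `v' = -(1/ε) D_v u(t, γ, v)`, the flow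
being defined for `μ₀`-almost every initial condition. -/
def IsImageUnderFlow {d : ℕ} (T ε : ℝ) (u : ℝ → E d → E d → ℝ) (μ₀ : Measure (E d × E d))
    (μ : ℝ → P1 (E d × E d)) : Prop :=
  ∃ Φ : ℝ → E d × E d → E d × E d,
    (∀ᵐ z ∂μ₀, Φ 0 z = z ∧ IsCharacteristic T ε u (fun t => (Φ t z).1) (fun t => (Φ t z).2)) ∧
    ∀ t ∈ Icc 0 T, AEMeasurable (Φ t) μ₀ ∧ (μ t).toMeasure = μ₀.map (Φ t)

/-- `(u, μ)` is a solution of the mean field game system with control of acceleration, with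
acceleration cost `ε/2 |γ''|²`: `u` is the value function of the control problem driven by the
space marginals `m_t` of `μ_t`, and `μ_t` is the image of `μ₀` under the optimal feedback flow.
(So the Hamilton-Jacobi equation holds in the viscosity sense, the continuity equation in the
sense of distributions, `μ_0 = μ₀` and `u(T,x,v) = g(x,m_T)`.) -/
structure IsSolution (d : ℕ) (T : ℝ) (L₀ : E d → E d → P1 (E d) → ℝ) (g : E d → P1 (E d) → ℝ)
    (μ₀ : Measure (E d × E d)) (ε : ℝ) (u : ℝ → E d → E d → ℝ) (μ : ℝ → P1 (E d × E d)) :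
    Prop where
  /-- `u ∈ W^{1,∞}_loc([0,T] × ℝ^{2d})`. -/
  locallyLipschitz : LocallyLipschitzOn (Icc (0 : ℝ) T ×ˢ (univ : Set (E d × E d)))
    fun p : ℝ × E d × E d => u p.1 p.2.1 p.2.2
  /-- `μ ∈ C([0,T]; P_1(ℝ^{2d}))`. -/
  continuousFlow : IsContinuousFlow T μ
  value : ∀ t ∈ Icc 0 T, ∀ x v,
    IsGLB (accelerationCosts T L₀ g ε (fun s => (μ s).spaceMarginal) t x v) (u t x v)
  flow : IsImageUnderFlow T ε u μ₀ μ

end ControlOfAcceleration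

section LimitProblem

/-- The values of the classical cost `∫_t^T L₀(γ, γ', m_s) ds + g(γ(T), m_T)` on the `C¹` curves
with `γ(t) = x`. -/
def limitCosts {d : ℕ} (T : ℝ) (L₀ : E d → E d → P1 (E d) → ℝ) (g : E d → P1 (E d) → ℝ)
    (m : ℝ → P1 (E d)) (t : ℝ) (x : E d) : Set ℝ :=
  {J | ∃ γ : ℝ → E d, ContDiffOn ℝ 1 γ (Icc 0 T) ∧ γ t = x ∧
    J = (∫ s in t..T, L₀ (γ s) (velocity T γ s) (m s)) + g (γ T) (m T)}

/-- `u⁰` is the value function of the classical problem of calculus of variations. -/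
def IsLimitValue {d : ℕ} (T : ℝ) (L₀ : E d → E d → P1 (E d) → ℝ) (g : E d → P1 (E d) → ℝ)
    (m : ℝ → P1 (E d)) (u₀ : ℝ → E d → ℝ) : Prop :=
  ∀ t ∈ Icc 0 T, ∀ x, IsGLB (limitCosts T L₀ g m t x) (u₀ t x)

/-- The functions `u_k(t,x,v)` converge to `u⁰(t,x)` locally uniformly on `[0,T] × ℝ^{2d}`. -/
def ValuesTendsto {d : ℕ} (T : ℝ) (uk : ℕ → ℝ → E d → E d → ℝ) (u₀ : ℝ → E d → ℝ) : Prop :=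
  TendstoLocallyUniformlyOn (fun k (p : ℝ × E d × E d) => uk k p.1 p.2.1 p.2.2)
    (fun p => u₀ p.1 p.2.1) atTop (Icc (0 : ℝ) T ×ˢ (univ : Set (E d × E d)))

end LimitProblem

end AccelMFG

end

/-!
The proof is by direct methods in the calculus of variations; no compactness of minimizers and no
maximum principle is used.

Convexity in the velocity and the gradient bounds give a coercivity inequality (`energy_le`): the
cost of a curve controls its energy `∫ |γ'|²`, up to the cost of resting at its initial point.
Resting, or moving uniformly, costs the same for both problems up to constants, so near optimal
curves have an energy bounded by a constant that depends neither on `ε` nor on the flow of measures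
(`near_optimal_energy`).

*Convergence of the values* (`values_tendsto`). For the lower bound the acceleration term is
dropped; the energy bound keeps near optimal curves in a fixed bounded set, where the costs for
`m^ε` and `m⁰` are uniformly close (`limit_le_value`). For the upper bound a near optimal curve of
the limit problem is taken with a smooth velocity, and is joined to nearby initial positions and
arbitrary initial velocities by braking, resting, and accelerating in a short time. The acceleration
of this competitor is large but bounded independently of `ε`, so its acceleration cost vanishes in the limit
(`value_le_limit`).

*Compactness of the marginals* (`exists_subseq_spaceMarginal`). Along a characteristic the value
function is Lipschitz in time. At almost every time, comparison with near optimal curves started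
from the current state shows that their mean acceleration over a short time is close to the feedback
`-(1/ε) D_v u` (`mean_acceleration_near_feedback`), so the value decreases at least at the rate `L₀`
(`value_decrease`). Integration shows that characteristics are optimal (`characteristic_cost_le`),
and the energy bound applies to them. The positions along the flow are therefore uniformly bounded
and `1/2`-Hölder on the compact support of `μ₀`. Their laws live on one compact set of paths, so a
subsequence converges weakly, and on a compact metric space weak convergence implies convergence
of transport costs (`exists_coupling_of_tendsto`). Evaluation at a time `t` is `1`-Lipschitz on path
space, which turns this into convergence of the marginals in `d1`, uniformly in `t`
(`exists_subseq_flowTendsto`).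
-/

noncomputable section

namespace AccelMFG

/-! ### Curves of class `C¹` -/

/-- `γ` is a `C¹` curve on `[0,T]` with velocity `w`. Keeping the velocity as a separate function,
which matters on `[0,T]` only, avoids computing with `derivWithin`. -/
structure IsC1Curve {d : ℕ} (T : ℝ) (γ w : ℝ → E d) : Prop where
  continuousOn_vel : ContinuousOn w (Icc 0 T)
  hasDeriv : ∀ s ∈ Icc 0 T, HasDerivWithinAt γ (w s) (Icc 0 T) s

namespace IsC1Curve

variable {d : ℕ} {T : ℝ} {γ w γ' w' : ℝ → E d}

theorem continuousOn (h : IsC1Curve T γ w) : ContinuousOn γ (Icc 0 T) :=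
  fun s hs => (h.hasDeriv s hs).continuousWithinAt

theorem velocity_eq (hT : 0 < T) (h : IsC1Curve T γ w) {s : ℝ} (hs : s ∈ Icc 0 T) :
    velocity T γ s = w s :=
  (h.hasDeriv s hs).derivWithin (uniqueDiffOn_Icc hT s hs)

theorem contDiffOn (hT : 0 < T) (h : IsC1Curve T γ w) : ContDiffOn ℝ 1 γ (Icc 0 T) := by
  rw [show (1 : WithTop ℕ∞) = 0 + 1 by simp, contDiffOn_succ_iff_derivWithin (uniqueDiffOn_Icc hT)]
  refine ⟨fun s hs => (h.hasDeriv s hs).differentiableWithinAt, by simp, ?_⟩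
  rw [contDiffOn_zero]
  exact h.continuousOn_vel.congr fun s hs => h.velocity_eq hT hs

theorem of_contDiffOn (hT : 0 < T) (h : ContDiffOn ℝ 1 γ (Icc 0 T)) :
    IsC1Curve T γ (velocity T γ) where
  continuousOn_vel := h.continuousOn_derivWithin (uniqueDiffOn_Icc hT) le_rfl
  hasDeriv s hs := (h.differentiableOn one_ne_zero s hs).hasDerivWithinAt

theorem sub_eq_integral (h : IsC1Curve T γ w) {s t : ℝ} (hs : s ∈ Icc 0 T) (ht : t ∈ Icc 0 T) :
    γ t - γ s = ∫ r in s..t, w r := by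
  have hsub : uIcc s t ⊆ Icc 0 T := uIcc_subset_Icc hs ht
  symm
  refine intervalIntegral.integral_eq_sub_of_hasDeriv_right (h.continuousOn.mono hsub)
    (fun r hr => ?_) (h.continuousOn_vel.mono hsub).intervalIntegrable
  have hr0 : 0 < r := lt_of_le_of_lt (le_min hs.1 ht.1) hr.1
  have hrT : r < T := lt_of_lt_of_le hr.2 (max_le hs.2 ht.2)
  exact ((h.hasDeriv r ⟨hr0.le, hrT.le⟩).hasDerivAt (Icc_mem_nhds hr0 hrT)).hasDerivWithinAt

theorem norm_sub_le (h : IsC1Curve T γ w) {s t : ℝ} (hs : s ∈ Icc 0 T) (ht : t ∈ Icc 0 T)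
    (hst : s ≤ t) : ‖γ t - γ s‖ ≤ ∫ r in s..t, ‖w r‖ := by
  rw [h.sub_eq_integral hs ht]
  exact intervalIntegral.norm_integral_le_integral_norm hst

theorem add (h : IsC1Curve T γ w) (h' : IsC1Curve T γ' w') :
    IsC1Curve T (fun s => γ s + γ' s) (fun s => w s + w' s) where
  continuousOn_vel := h.continuousOn_vel.add h'.continuousOn_vel
  hasDeriv s hs := (h.hasDeriv s hs).add (h'.hasDeriv s hs)

theorem add_const (h : IsC1Curve T γ w) (c : E d) : IsC1Curve T (fun s => γ s + c) w where
  continuousOn_vel := h.continuousOn_vel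
  hasDeriv s hs := (h.hasDeriv s hs).add_const c

theorem const (x : E d) : IsC1Curve T (fun _ => x) (fun _ => 0) where
  continuousOn_vel := continuousOn_const
  hasDeriv s _ := hasDerivWithinAt_const s _ x

theorem primitive (hw : Continuous w) (x : E d) (t : ℝ) :
    IsC1Curve T (fun s => x + ∫ r in t..s, w r) w where
  continuousOn_vel := hw.continuousOn
  hasDeriv s _ := ((hw.integral_hasStrictDerivAt t s).hasDerivAt.const_add x).hasDerivWithinAt

end IsC1Curve

/-- The Cauchy-Schwarz inequality, used to bound displacements by energies. -/
theorem integral_norm_sq_le {F : Type*} [NormedAddCommGroup F] {f : ℝ → F} {s t a b : ℝ}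
    (hf : IntervalIntegrable (fun r => ‖f r‖) volume a b)
    (hf2 : IntervalIntegrable (fun r => ‖f r‖ ^ 2) volume a b)
    (has : a ≤ s) (hst : s ≤ t) (htb : t ≤ b) :
    (∫ r in s..t, ‖f r‖) ^ 2 ≤ (t - s) * ∫ r in a..b, ‖f r‖ ^ 2 := by
  have hsub : uIcc s t ⊆ uIcc a b := by
    rw [uIcc_of_le hst, uIcc_of_le (has.trans (hst.trans htb))]; exact Icc_subset_Icc has htb
  have h1 : IntervalIntegrable (fun r => ‖f r‖) volume s t := hf.mono_set hsub
  have h2 : IntervalIntegrable (fun r => ‖f r‖ ^ 2) volume s t := hf2.mono_set hsub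
  have h3 : ∫ r in s..t, ‖f r‖ ^ 2 ≤ ∫ r in a..b, ‖f r‖ ^ 2 := by
    refine intervalIntegral.integral_mono_interval has hst htb
      (Eventually.of_forall fun r => by positivity) hf2
  set I := ∫ r in s..t, ‖f r‖ with hI
  have h4 : 0 ≤ ∫ r in s..t, ((t - s) * ‖f r‖ - I) ^ 2 :=
    intervalIntegral.integral_nonneg hst fun r _ => by positivity
  have h5 : ∫ r in s..t, ((t - s) * ‖f r‖ - I) ^ 2
      = (t - s) ^ 2 * (∫ r in s..t, ‖f r‖ ^ 2) - (t - s) * I ^ 2 := by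
    have : ∀ r, ((t - s) * ‖f r‖ - I) ^ 2
        = ((t - s) ^ 2 * ‖f r‖ ^ 2 - 2 * (t - s) * I * ‖f r‖) + I ^ 2 := fun r => by ring
    simp_rw [this]
    rw [intervalIntegral.integral_add ((h2.const_mul _).sub (h1.const_mul _)) (by simp),
      intervalIntegral.integral_sub (h2.const_mul _) (h1.const_mul _),
      intervalIntegral.integral_const_mul, intervalIntegral.integral_const_mul, ← hI,
      intervalIntegral.integral_const, smul_eq_mul]
    ring
  rcases hst.eq_or_lt with rfl | hlt
  · simp [hI]
  · have hts : 0 < t - s := sub_pos.2 hlt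
    have : I ^ 2 ≤ (t - s) * ∫ r in s..t, ‖f r‖ ^ 2 := by
      by_contra! hcon
      nlinarith
    exact this.trans (by gcongr)

/-! ### Bounds on the data -/

namespace LagrangianAssumptions

variable {d : ℕ} {T M₀ : ℝ} {L₀ : E d → E d → P1 (E d) → ℝ}

theorem differentiable_pos (hL : LagrangianAssumptions d M₀ L₀) (v : E d) (m : P1 (E d)) :
    Differentiable ℝ fun x => L₀ x v m := by
  have h := (hL.contDiff m).differentiable one_ne_zero
  exact h.comp (f := fun x : E d => (x, v)) (by fun_prop)

theorem differentiable_vel (hL : LagrangianAssumptions d M₀ L₀) (x : E d) (m : P1 (E d)) :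
    Differentiable ℝ fun v => L₀ x v m := by
  have h := (hL.contDiff m).differentiable one_ne_zero
  exact h.comp (f := fun v : E d => (x, v)) (by fun_prop)

theorem abs_sub_pos_le (hL : LagrangianAssumptions d M₀ L₀) (x y v : E d) (m : P1 (E d)) :
    |L₀ y v m - L₀ x v m| ≤ M₀ * (1 + ‖v‖ ^ 2) * ‖y - x‖ := by
  have := convex_univ.norm_image_sub_le_of_norm_fderiv_le (𝕜 := ℝ) (f := fun x => L₀ x v m)
    (fun z _ => hL.differentiable_pos v m z) (fun z _ => hL.grad_x_le z v m)
    (mem_univ x) (mem_univ y)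
  simpa using this

theorem abs_sub_vel_le (hM₀ : 0 < M₀) (hL : LagrangianAssumptions d M₀ L₀) (x v w : E d)
    (m : P1 (E d)) : |L₀ x w m - L₀ x v m| ≤ M₀ * (1 + ‖v‖ + ‖w‖) * ‖w - v‖ := by
  have := (convex_closedBall (0 : E d) (‖v‖ + ‖w‖)).norm_image_sub_le_of_norm_fderiv_le (𝕜 := ℝ)
    (f := fun v => L₀ x v m) (C := M₀ * (1 + ‖v‖ + ‖w‖)) (x := v) (y := w)
    (fun z _ => hL.differentiable_vel x m z) (fun z hz => (hL.grad_v_le x z m).trans ?_)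
    (by simp) (by simp)
  · simpa using this
  · rw [mem_closedBall_zero_iff] at hz
    have : 1 + ‖z‖ ≤ 1 + ‖v‖ + ‖w‖ := by linarith
    gcongr

theorem abs_sub_le (hM₀ : 0 < M₀) (hL : LagrangianAssumptions d M₀ L₀) (x y v w : E d)
    (m : P1 (E d)) : |L₀ y w m - L₀ x v m| ≤
      M₀ * (1 + ‖w‖ ^ 2) * ‖y - x‖ + M₀ * (1 + ‖v‖ + ‖w‖) * ‖w - v‖ := by
  calc |L₀ y w m - L₀ x v m| = |(L₀ y w m - L₀ x w m) + (L₀ x w m - L₀ x v m)| := by ring_nf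
    _ ≤ _ := (abs_add_le _ _).trans (add_le_add (hL.abs_sub_pos_le x y w m)
      (hL.abs_sub_vel_le hM₀ x v w m))

/-- Uniform convexity in the velocity: the second-order Taylor inequality at `v = 0`. -/
theorem taylor_vel (hL : LagrangianAssumptions d M₀ L₀) (x w : E d)
    (m : P1 (E d)) : L₀ x 0 m - M₀ * ‖w‖ + 1 / (2 * M₀) * ‖w‖ ^ 2 ≤ L₀ x w m := by
  set D : E d → (E d →L[ℝ] ℝ) := fun v => fderiv ℝ (fun w => L₀ x w m) v with hD
  -- `a` is half of the Hessian bound in the direction `w`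
  set a : ℝ := 1 / (2 * M₀) * ‖w‖ ^ 2 with ha
  have hline : ∀ τ : ℝ, HasDerivAt (fun τ : ℝ => τ • w) w τ := fun τ => by
    simpa using (hasDerivAt_id τ).smul_const w
  have hd1 : ∀ τ : ℝ, HasDerivAt (fun τ : ℝ => L₀ x (τ • w) m) (D (τ • w) w) τ := fun τ =>
    HasFDerivAt.comp_hasDerivAt (l := fun v => L₀ x v m) τ
      (hL.differentiable_vel x m (τ • w)).hasFDerivAt (hline τ)
  have hd2 : ∀ τ : ℝ, HasDerivAt (fun τ : ℝ => D (τ • w) w) (fderiv ℝ D (τ • w) w w) τ :=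
      fun τ => by
    have := ((hL.differentiable_grad x m (τ • w)).hasFDerivAt).comp_hasDerivAt τ (hline τ)
    exact this.clm_apply (hasDerivAt_const τ w) |>.congr_deriv (by simp [hD])
  -- the derivative of `L(x, τ w) - a τ²` is monotone in `τ`
  have hmono : Monotone fun τ : ℝ => D (τ • w) w - 2 * a * τ := by
    refine monotone_of_hasDerivAt_nonneg
      (f' := fun τ => fderiv ℝ D (τ • w) w w - 2 * a * 1) (fun τ => ?_) (fun τ => ?_)
    · exact (hd2 τ).sub ((hasDerivAt_id τ).const_mul (2 * a))
    · have := hL.hessian_ge x (τ • w) m w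
      have h2 : 2 * a = 1 / M₀ * ‖w‖ ^ 2 := by rw [ha]; ring
      simp only [Pi.zero_apply, hD] at *
      linarith
  have hmono2 : MonotoneOn (fun τ : ℝ => L₀ x (τ • w) m - D 0 w * τ - a * τ ^ 2) (Icc 0 1) := by
    refine monotoneOn_of_deriv_nonneg (convex_Icc 0 1) ?_ ?_ ?_
    · exact fun τ _ => (((hd1 τ).sub ((hasDerivAt_id τ).const_mul _)).sub
        (((hasDerivAt_id τ).pow 2).const_mul a)).continuousAt.continuousWithinAt
    · exact fun τ _ => (((hd1 τ).sub ((hasDerivAt_id τ).const_mul _)).sub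
        (((hasDerivAt_id τ).pow 2).const_mul a)).differentiableAt.differentiableWithinAt
    · intro τ hτ
      rw [interior_Icc] at hτ
      have h := ((hd1 τ).sub ((hasDerivAt_id τ).const_mul (D 0 w))).sub
        (((hasDerivAt_id τ).pow 2).const_mul a)
      have h' := hmono hτ.1.le
      simp only [zero_smul, mul_zero, sub_zero] at h'
      refine le_of_le_of_eq ?_ h.deriv.symm
      simp
      linarith
  have h01 := hmono2 (left_mem_Icc.2 zero_le_one) (right_mem_Icc.2 zero_le_one) zero_le_one
  simp only [zero_smul, one_smul] at h01
  have hg : |D 0 w| ≤ M₀ * ‖w‖ := by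
    refine ((D 0).le_opNorm w).trans ?_
    gcongr
    simpa using hL.grad_v_le x 0 m
  have := (abs_le.1 hg).1
  linarith

/-- Coercivity, in a form that compares values of the Lagrangian for the same measure only: no
bound on `L₀` that is uniform in the measure is available. -/
theorem lower_bound (hL : LagrangianAssumptions d M₀ L₀) (x y w : E d) (m : P1 (E d)) :
    L₀ x 0 m - M₀ * ‖y - x‖ - M₀ * ‖w‖ + 1 / (2 * M₀) * ‖w‖ ^ 2 ≤ L₀ y w m := by
  have h1 := hL.taylor_vel y w m
  have h2 := (abs_le.1 (hL.abs_sub_pos_le x y 0 m)).1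
  simp only [norm_zero] at h2
  linarith

theorem continuousOn_comp (hL : LagrangianAssumptions d M₀ L₀) {m : ℝ → P1 (E d)}
    (hm : IsContinuousFlow T m) {γ w : ℝ → E d} (hγ : ContinuousOn γ (Icc 0 T))
    (hw : ContinuousOn w (Icc 0 T)) :
    ContinuousOn (fun s => L₀ (γ s) (w s) (m s)) (Icc 0 T) := by
  intro s hs
  rw [ContinuousWithinAt, Metric.tendsto_nhds]
  intro η hη
  obtain ⟨δ, hδ, H⟩ := hL.continuous (γ s) (w s) (m s) η hη
  filter_upwards [Metric.tendsto_nhds.1 (hγ s hs) δ hδ, Metric.tendsto_nhds.1 (hw s hs) δ hδ,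
    (hm s hs).eventually_lt_const hδ] with r h1 h2 h3
  exact H _ _ _ h1 h2 h3

theorem intervalIntegrable_comp (hL : LagrangianAssumptions d M₀ L₀) {m : ℝ → P1 (E d)}
    (hm : IsContinuousFlow T m) {γ w : ℝ → E d} (hγ : ContinuousOn γ (Icc 0 T))
    (hw : ContinuousOn w (Icc 0 T)) {s t : ℝ} (hs : s ∈ Icc 0 T) (ht : t ∈ Icc 0 T) :
    IntervalIntegrable (fun s => L₀ (γ s) (w s) (m s)) volume s t :=
  ((hL.continuousOn_comp hm hγ hw).mono (uIcc_subset_Icc hs ht)).intervalIntegrable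

end LagrangianAssumptions

theorem TerminalAssumptions.abs_sub_le {d : ℕ} {M₀ : ℝ} {g : E d → P1 (E d) → ℝ}
    (hg : TerminalAssumptions d M₀ g) (x y : E d) (m : P1 (E d)) :
    |g y m - g x m| ≤ 2 * M₀ * ‖y - x‖ := by
  have := convex_univ.norm_image_sub_le_of_norm_fderiv_le (𝕜 := ℝ) (f := fun x => g x m)
    (C := 2 * M₀) (fun z _ => (hg.contDiff m).differentiable one_ne_zero z)
    (fun z _ => by linarith [hg.grad_le z m]) (mem_univ x) (mem_univ y)
  simpa using this

/-! ### Energy estimates -/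

section Energy

variable {d : ℕ} {T M₀ : ℝ} {L₀ : E d → E d → P1 (E d) → ℝ} {g : E d → P1 (E d) → ℝ}
  {m : ℝ → P1 (E d)} {γ w : ℝ → E d} {t : ℝ}

/-- The cost of a `C¹` curve on `[t,T]`, without the acceleration term. -/
def curveCost (T : ℝ) (L₀ : E d → E d → P1 (E d) → ℝ) (g : E d → P1 (E d) → ℝ)
    (m : ℝ → P1 (E d)) (t : ℝ) (γ w : ℝ → E d) : ℝ :=
  (∫ s in t..T, L₀ (γ s) (w s) (m s)) + g (γ T) (m T)

/-- The cost of a curve dominates its energy, up to the cost of resting at its initial point and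
a constant that depends on `T` and `M₀` only. -/
theorem energy_le (hM₀ : 0 < M₀) (hL : LagrangianAssumptions d M₀ L₀)
    (hg : TerminalAssumptions d M₀ g) (hm : IsContinuousFlow T m) (hγ : IsC1Curve T γ w)
    (ht : t ∈ Icc 0 T) :
    curveCost T L₀ g m t (fun _ => γ t) (fun _ => 0) + 1 / (4 * M₀) * ∫ s in t..T, ‖w s‖ ^ 2
      ≤ curveCost T L₀ g m t γ w + T * (M₀ ^ 3 * (T + 3) ^ 2) := by
  have hT0 : 0 ≤ T := ht.1.trans ht.2
  have hTm : T ∈ Icc 0 T := ⟨hT0, le_rfl⟩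
  have hsub : uIcc t T ⊆ Icc 0 T := uIcc_subset_Icc ht hTm
  have hi1 : IntervalIntegrable (fun r => ‖w r‖) volume t T :=
    (hγ.continuousOn_vel.norm.mono hsub).intervalIntegrable
  have hi2 : IntervalIntegrable (fun r => ‖w r‖ ^ 2) volume t T :=
    ((hγ.continuousOn_vel.norm.pow 2).mono hsub).intervalIntegrable
  have hiL := hL.intervalIntegrable_comp hm hγ.continuousOn hγ.continuousOn_vel ht hTm
  have hiL0 := hL.intervalIntegrable_comp hm (γ := fun _ => γ t) (w := fun _ => 0)
    continuousOn_const continuousOn_const ht hTm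
  set ρ := ∫ r in t..T, ‖w r‖ with hρ
  have hρ0 : 0 ≤ ρ := intervalIntegral.integral_nonneg ht.2 fun _ _ => norm_nonneg _
  have hdisp : ∀ s ∈ Icc t T, ‖γ s - γ t‖ ≤ ρ := fun s hs => by
    refine (hγ.norm_sub_le ht ⟨ht.1.trans hs.1, hs.2⟩ hs.1).trans ?_
    exact intervalIntegral.integral_mono_interval le_rfl hs.1 hs.2
      (Eventually.of_forall fun r => norm_nonneg _) hi1
  have hrun : (∫ s in t..T, (L₀ (γ t) 0 (m s) - M₀ * ρ - M₀ * ‖w s‖ + 1 / (2 * M₀) * ‖w s‖ ^ 2))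
      ≤ ∫ s in t..T, L₀ (γ s) (w s) (m s) := by
    refine intervalIntegral.integral_mono_on ht.2 (((hiL0.sub (by simp)).sub
      (hi1.const_mul _)).add (hi2.const_mul _)) hiL fun s hs => ?_
    have := hL.lower_bound (γ t) (γ s) (w s) (m s)
    have h2 : M₀ * ‖γ s - γ t‖ ≤ M₀ * ρ := by gcongr; exact hdisp s hs
    linarith
  rw [intervalIntegral.integral_add ((hiL0.sub (by simp)).sub (hi1.const_mul _))
      (hi2.const_mul _), intervalIntegral.integral_sub (hiL0.sub (by simp)) (hi1.const_mul _),
    intervalIntegral.integral_sub hiL0 (by simp), intervalIntegral.integral_const,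
    intervalIntegral.integral_const_mul M₀, intervalIntegral.integral_const_mul (1 / (2 * M₀)),
    ← hρ, smul_eq_mul] at hrun
  have hterm := (abs_le.1 (hg.abs_sub_le (γ t) (γ T) (m T))).1
  have hdT : M₀ * ‖γ T - γ t‖ ≤ M₀ * ρ := by gcongr; exact hdisp T ⟨ht.2, le_rfl⟩
  -- Young's inequality for the terms that are linear in the velocity
  have hyoung : M₀ * (T + 3) * ρ
      ≤ 1 / (4 * M₀) * (∫ s in t..T, ‖w s‖ ^ 2) + T * (M₀ ^ 3 * (T + 3) ^ 2) := by
    have h1 : (∫ s in t..T, M₀ * (T + 3) * ‖w s‖)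
        ≤ ∫ s in t..T, (1 / (4 * M₀) * ‖w s‖ ^ 2 + M₀ ^ 3 * (T + 3) ^ 2) := by
      refine intervalIntegral.integral_mono_on ht.2 (hi1.const_mul _)
        ((hi2.const_mul _).add (by simp)) fun s _ => ?_
      have : 1 / (4 * M₀) * ‖w s‖ ^ 2 + M₀ ^ 3 * (T + 3) ^ 2 - M₀ * (T + 3) * ‖w s‖
          = 1 / (4 * M₀) * (‖w s‖ - 2 * M₀ ^ 2 * (T + 3)) ^ 2 := by
        field_simp; ring
      have h0 : 0 ≤ 1 / (4 * M₀) * (‖w s‖ - 2 * M₀ ^ 2 * (T + 3)) ^ 2 := by positivity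
      linarith
    rw [intervalIntegral.integral_add (hi2.const_mul _) (by simp),
      intervalIntegral.integral_const_mul, intervalIntegral.integral_const_mul,
      intervalIntegral.integral_const, smul_eq_mul] at h1
    have h2 : (T - t) * (M₀ ^ 3 * (T + 3) ^ 2) ≤ T * (M₀ ^ 3 * (T + 3) ^ 2) := by
      gcongr; linarith [ht.1]
    linarith
  have h3 : (T - t) * (M₀ * ρ) ≤ T * (M₀ * ρ) := by gcongr; linarith [ht.1]
  have h4 : 1 / (2 * M₀) * (∫ s in t..T, ‖w s‖ ^ 2) = 1 / (4 * M₀) * (∫ s in t..T, ‖w s‖ ^ 2)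
      + 1 / (4 * M₀) * (∫ s in t..T, ‖w s‖ ^ 2) := by
    field_simp; ring
  simp only [curveCost]
  linarith

/-- Uniform motion as a competitor. -/
theorem line_cost_le (hM₀ : 0 < M₀) (hL : LagrangianAssumptions d M₀ L₀)
    (hg : TerminalAssumptions d M₀ g) (hm : IsContinuousFlow T m) (ht : t ∈ Icc 0 T) (x v : E d)
    {R : ℝ} (hv : ‖v‖ ≤ R) :
    curveCost T L₀ g m t (fun s => x + (s - t) • v) (fun _ => v)
      ≤ curveCost T L₀ g m t (fun _ => x) (fun _ => 0)
        + (T * (M₀ * (1 + R ^ 2) * (T * R) + M₀ * (1 + R) * R) + 2 * M₀ * (T * R)) := by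
  have hT0 : 0 ≤ T := ht.1.trans ht.2
  have hR : 0 ≤ R := (norm_nonneg v).trans hv
  have hTm : T ∈ Icc 0 T := ⟨hT0, le_rfl⟩
  have hiL := hL.intervalIntegrable_comp hm (γ := fun s => x + (s - t) • v) (w := fun _ => v)
    (by fun_prop) continuousOn_const ht hTm
  have hiL0 := hL.intervalIntegrable_comp hm (γ := fun _ => x) (w := fun _ => 0)
    continuousOn_const continuousOn_const ht hTm
  have hdist : ∀ s ∈ Icc t T, ‖x + (s - t) • v - x‖ ≤ T * R := fun s hs => by
    rw [add_sub_cancel_left, norm_smul, Real.norm_eq_abs, abs_of_nonneg (by linarith [hs.1])]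
    have : s - t ≤ T := by linarith [hs.2, ht.1]
    gcongr
  have hrun : (∫ s in t..T, L₀ (x + (s - t) • v) v (m s)) ≤ ∫ s in t..T,
      (L₀ x 0 (m s) + (M₀ * (1 + R ^ 2) * (T * R) + M₀ * (1 + R) * R)) := by
    refine intervalIntegral.integral_mono_on ht.2 hiL (hiL0.add (by simp)) fun s hs => ?_
    have h1 := (abs_le.1 (hL.abs_sub_le hM₀ x (x + (s - t) • v) 0 v (m s))).2
    have h2 : M₀ * (1 + ‖v‖ ^ 2) * ‖x + (s - t) • v - x‖ ≤ M₀ * (1 + R ^ 2) * (T * R) := by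
      gcongr; exact hdist s hs
    have h3 : M₀ * (1 + ‖(0 : E d)‖ + ‖v‖) * ‖v - 0‖ ≤ M₀ * (1 + R) * R := by
      rw [norm_zero, add_zero, sub_zero]; gcongr
    linarith
  rw [intervalIntegral.integral_add hiL0 (by simp), intervalIntegral.integral_const,
    smul_eq_mul] at hrun
  have hterm := (abs_le.1 (hg.abs_sub_le x (x + (T - t) • v) (m T))).2
  have h2 : 2 * M₀ * ‖x + (T - t) • v - x‖ ≤ 2 * M₀ * (T * R) := by
    gcongr; exact hdist T ⟨ht.2, le_rfl⟩
  have h4 : (T - t) * (M₀ * (1 + R ^ 2) * (T * R) + M₀ * (1 + R) * R)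
      ≤ T * (M₀ * (1 + R ^ 2) * (T * R) + M₀ * (1 + R) * R) := by
    gcongr; linarith [ht.1]
  simp only [curveCost]
  linarith

end Energy

/-! ### Curves of class `H²` and the value functions -/

/-- `γ` is a curve in `H²(0,T)` with velocity `w` and acceleration `a`. -/
structure IsH2Curve {d : ℕ} (T : ℝ) (γ w a : ℝ → E d) : Prop extends IsC1Curve T γ w where
  memLp : MemLp a 2 (volume.restrict (Icc 0 T))
  vel_eq : ∀ s ∈ Icc 0 T, w s = w 0 + ∫ r in (0 : ℝ)..s, a r

namespace IsH2Curve

variable {d : ℕ} {T : ℝ} {γ w a γ' w' a' : ℝ → E d}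

theorem intervalIntegrable_acc (h : IsH2Curve T γ w a) {s t : ℝ} (hs : s ∈ Icc 0 T)
    (ht : t ∈ Icc 0 T) : IntervalIntegrable a volume s t := by
  rw [intervalIntegrable_iff]
  have : IntegrableOn a (Icc 0 T) := h.memLp.integrable (by norm_num)
  exact this.mono_set (uIoc_subset_uIcc.trans (uIcc_subset_Icc hs ht))

theorem intervalIntegrable_sq (h : IsH2Curve T γ w a) {s t : ℝ} (hs : s ∈ Icc 0 T)
    (ht : t ∈ Icc 0 T) : IntervalIntegrable (fun r => ‖a r‖ ^ 2) volume s t := by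
  rw [intervalIntegrable_iff]
  have : IntegrableOn (fun r => ‖a r‖ ^ 2) (Icc 0 T) := by
    exact h.memLp.integrable_norm_pow (p := 2) two_ne_zero
  exact this.mono_set (uIoc_subset_uIcc.trans (uIcc_subset_Icc hs ht))

theorem vel_sub_eq (h : IsH2Curve T γ w a) {s t : ℝ} (hs : s ∈ Icc 0 T) (ht : t ∈ Icc 0 T) :
    w t - w s = ∫ r in s..t, a r := by
  have h0 : (0 : ℝ) ∈ Icc 0 T := ⟨le_rfl, hs.1.trans hs.2⟩
  rw [h.vel_eq t ht, h.vel_eq s hs, add_sub_add_left_eq_sub,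
    intervalIntegral.integral_interval_sub_left (h.intervalIntegrable_acc h0 ht)
      (h.intervalIntegrable_acc h0 hs)]

theorem add (h : IsH2Curve T γ w a) (h' : IsH2Curve T γ' w' a') :
    IsH2Curve T (fun s => γ s + γ' s) (fun s => w s + w' s) (fun s => a s + a' s) where
  toIsC1Curve := h.toIsC1Curve.add h'.toIsC1Curve
  memLp := h.memLp.add h'.memLp
  vel_eq s hs := by
    have h0 : (0 : ℝ) ∈ Icc 0 T := ⟨le_rfl, hs.1.trans hs.2⟩
    rw [h.vel_eq s hs, h'.vel_eq s hs, intervalIntegral.integral_add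
      (h.intervalIntegrable_acc h0 hs) (h'.intervalIntegrable_acc h0 hs)]
    abel

theorem add_const (h : IsH2Curve T γ w a) (c : E d) : IsH2Curve T (fun s => γ s + c) w a where
  toIsC1Curve := h.toIsC1Curve.add_const c
  memLp := h.memLp
  vel_eq := h.vel_eq

theorem line (x v : E d) (t : ℝ) :
    IsH2Curve T (fun s => x + (s - t) • v) (fun _ => v) (fun _ => 0) where
  continuousOn_vel := continuousOn_const
  hasDeriv s _ := by
    have := (((hasDerivAt_id s).sub_const t).smul_const v).const_add x
    simpa using this.hasDerivWithinAt
  memLp := by simp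
  vel_eq s _ := by simp

/-- The curve with prescribed acceleration. -/
theorem of_acceleration (ha : Measurable a) {C : ℝ} (hC : ∀ s, ‖a s‖ ≤ C) (x v : E d) (t : ℝ) :
    IsH2Curve T (fun s => x + ∫ r in t..s, (v + ∫ q in t..r, a q)) (fun s => v + ∫ r in t..s, a r)
      a := by
  have hint : ∀ s r : ℝ, IntervalIntegrable a volume s r := fun s r => by
    rw [intervalIntegrable_iff]
    exact Measure.integrableOn_of_bounded (by simp) ha.aestronglyMeasurable
      (Eventually.of_forall hC)
  refine ⟨IsC1Curve.primitive ?_ x t, ?_, fun s _ => ?_⟩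
  · exact continuous_const.add (intervalIntegral.continuous_primitive hint t)
  · exact MemLp.of_bound ha.aestronglyMeasurable C (Eventually.of_forall hC)
  · rw [add_assoc, intervalIntegral.integral_add_adjacent_intervals (hint _ _) (hint _ _)]

end IsH2Curve

section Values

variable {d : ℕ} {T M₀ ε : ℝ} {L₀ : E d → E d → P1 (E d) → ℝ} {g : E d → P1 (E d) → ℝ}
  {m : ℝ → P1 (E d)} {t : ℝ} {x v : E d}

theorem curveCost_congr {γ w w' : ℝ → E d} (ht : t ∈ Icc 0 T) (h : ∀ s ∈ Icc 0 T, w s = w' s) :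
    curveCost T L₀ g m t γ w = curveCost T L₀ g m t γ w' := by
  have : ∫ s in t..T, L₀ (γ s) (w s) (m s) = ∫ s in t..T, L₀ (γ s) (w' s) (m s) := by
    refine intervalIntegral.integral_congr fun s hs => ?_
    have := h s (uIcc_subset_Icc ht ⟨ht.1.trans ht.2, le_rfl⟩ hs)
    simp only [this]
  simp only [curveCost, this]

theorem mem_limitCosts (hT : 0 < T) (ht : t ∈ Icc 0 T) {J : ℝ} :
    J ∈ limitCosts T L₀ g m t x ↔
      ∃ γ w : ℝ → E d, IsC1Curve T γ w ∧ γ t = x ∧ J = curveCost T L₀ g m t γ w := by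
  constructor
  · rintro ⟨γ, hγ, hx, rfl⟩
    exact ⟨γ, _, IsC1Curve.of_contDiffOn hT hγ, hx, rfl⟩
  · rintro ⟨γ, w, hγ, hx, rfl⟩
    exact ⟨γ, hγ.contDiffOn hT, hx, curveCost_congr ht fun s hs => (hγ.velocity_eq hT hs).symm⟩

theorem mem_accelerationCosts (hT : 0 < T) (hL : LagrangianAssumptions d M₀ L₀)
    (hm : IsContinuousFlow T m) (ht : t ∈ Icc 0 T) {J : ℝ} :
    J ∈ accelerationCosts T L₀ g ε m t x v ↔
      ∃ γ w a : ℝ → E d, IsH2Curve T γ w a ∧ γ t = x ∧ w t = v ∧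
        J = ε / 2 * (∫ s in t..T, ‖a s‖ ^ 2) + curveCost T L₀ g m t γ w := by
  have hTm : T ∈ Icc 0 T := ⟨hT.le, le_rfl⟩
  have h0 : (0 : ℝ) ∈ Icc 0 T := ⟨le_rfl, hT.le⟩
  have key : ∀ γ w a : ℝ → E d, IsH2Curve T γ w a →
      (∫ s in t..T, (ε / 2 * ‖a s‖ ^ 2 + L₀ (γ s) (w s) (m s))) + g (γ T) (m T)
        = ε / 2 * (∫ s in t..T, ‖a s‖ ^ 2) + curveCost T L₀ g m t γ w := fun γ w a h => by
    rw [intervalIntegral.integral_add ((h.intervalIntegrable_sq ht hTm).const_mul _)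
      (hL.intervalIntegrable_comp hm h.continuousOn h.continuousOn_vel ht hTm),
      intervalIntegral.integral_const_mul, curveCost, add_assoc]
  constructor
  · rintro ⟨γ, a, hγ, ha, hx, hv, rfl⟩
    have h : IsH2Curve T γ (velocity T γ) a :=
      ⟨IsC1Curve.of_contDiffOn hT hγ, ha.memLp, ha.velocity_eq⟩
    exact ⟨γ, _, a, h, hx, hv, key _ _ _ h⟩
  · rintro ⟨γ, w, a, h, hx, hv, rfl⟩
    refine ⟨γ, a, h.contDiffOn hT, ⟨h.memLp, fun s hs => ?_⟩, hx, ?_, ?_⟩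
    · rw [h.velocity_eq hT hs, h.velocity_eq hT h0, h.vel_eq s hs]
    · rw [h.velocity_eq hT ht, hv]
    · have h' : IsH2Curve T γ (velocity T γ) a :=
        ⟨IsC1Curve.of_contDiffOn hT (h.contDiffOn hT), h.memLp, fun s hs => by
          rw [h.velocity_eq hT hs, h.velocity_eq hT h0, h.vel_eq s hs]⟩
      rw [key _ _ _ h', curveCost_congr ht fun s hs => h.velocity_eq hT hs]

theorem value_le (hT : 0 < T) (hL : LagrangianAssumptions d M₀ L₀) (hm : IsContinuousFlow T m)
    (ht : t ∈ Icc 0 T) {U : ℝ} (hU : IsGLB (accelerationCosts T L₀ g ε m t x v) U)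
    {γ w a : ℝ → E d} (h : IsH2Curve T γ w a) (hx : γ t = x) (hv : w t = v) :
    U ≤ ε / 2 * (∫ s in t..T, ‖a s‖ ^ 2) + curveCost T L₀ g m t γ w :=
  hU.1 ((mem_accelerationCosts hT hL hm ht).2 ⟨γ, w, a, h, hx, hv, rfl⟩)

theorem exists_near_optimal (hT : 0 < T) (hL : LagrangianAssumptions d M₀ L₀)
    (hm : IsContinuousFlow T m) (ht : t ∈ Icc 0 T) {U : ℝ}
    (hU : IsGLB (accelerationCosts T L₀ g ε m t x v) U) {η : ℝ} (hη : 0 < η) :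
    ∃ γ w a : ℝ → E d, IsH2Curve T γ w a ∧ γ t = x ∧ w t = v ∧
      ε / 2 * (∫ s in t..T, ‖a s‖ ^ 2) + curveCost T L₀ g m t γ w < U + η := by
  obtain ⟨J, hJ, -, hJU⟩ := hU.exists_between (lt_add_of_pos_right U hη)
  obtain ⟨γ, w, a, h, hx, hv, rfl⟩ := (mem_accelerationCosts hT hL hm ht).1 hJ
  exact ⟨γ, w, a, h, hx, hv, hJU⟩

/-- A bound on the acceleration cost plus `1 / (4 M₀)` times the energy, for near optimal curves of
either problem with initial velocity of norm at most `R`. -/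
def energyConst (T M₀ R : ℝ) : ℝ :=
  T * (M₀ * (1 + R ^ 2) * (T * R) + M₀ * (1 + R) * R) + 2 * M₀ * (T * R)
    + T * (M₀ ^ 3 * (T + 3) ^ 2) + 1

theorem energyConst_pos (hT : 0 < T) (hM₀ : 0 < M₀) {R : ℝ} (hR : 0 ≤ R) :
    0 < energyConst T M₀ R := by
  unfold energyConst; positivity

/-- The energy bound for near optimal curves of the problem with control of acceleration. It does
not depend on `m` and depends on `ε` only through the acceleration term. -/
theorem near_optimal_energy (hT : 0 < T) (hM₀ : 0 < M₀) (hL : LagrangianAssumptions d M₀ L₀)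
    (hg : TerminalAssumptions d M₀ g) (hm : IsContinuousFlow T m) (ht : t ∈ Icc 0 T) {U : ℝ}
    (hU : IsGLB (accelerationCosts T L₀ g ε m t x v) U) {R : ℝ} (hv : ‖v‖ ≤ R)
    {γ w : ℝ → E d} {A : ℝ} (h : IsC1Curve T γ w) (hx : γ t = x)
    (hcost : A + curveCost T L₀ g m t γ w ≤ U + 1) :
    A + 1 / (4 * M₀) * (∫ s in t..T, ‖w s‖ ^ 2) ≤ energyConst T M₀ R := by
  have h1 := value_le hT hL hm ht hU (IsH2Curve.line x v t) (by simp) rfl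
  simp only [norm_zero, ne_eq, OfNat.ofNat_ne_zero, not_false_eq_true, zero_pow,
    intervalIntegral.integral_zero, mul_zero, zero_add] at h1
  have h2 := line_cost_le hM₀ hL hg hm ht x v hv
  have h3 := energy_le hM₀ hL hg hm h ht
  rw [hx] at h3
  unfold energyConst
  linarith

theorem curveCost_split (hL : LagrangianAssumptions d M₀ L₀) (hm : IsContinuousFlow T m)
    {γ w : ℝ → E d} (h : IsC1Curve T γ w) {s : ℝ} (ht : t ∈ Icc 0 T) (hs : s ∈ Icc 0 T) :
    curveCost T L₀ g m t γ w
      = (∫ r in t..s, L₀ (γ r) (w r) (m r)) + curveCost T L₀ g m s γ w := by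
  have hTm : T ∈ Icc 0 T := ⟨ht.1.trans ht.2, le_rfl⟩
  rw [curveCost, curveCost, ← add_assoc, intervalIntegral.integral_add_adjacent_intervals
    (hL.intervalIntegrable_comp hm h.continuousOn h.continuousOn_vel ht hs)
    (hL.intervalIntegrable_comp hm h.continuousOn h.continuousOn_vel hs hTm)]

/-- The change of the cost under a perturbation `β` of a curve of bounded velocity. -/
theorem curveCost_add_le (hM₀ : 0 < M₀) (hL : LagrangianAssumptions d M₀ L₀)
    (hg : TerminalAssumptions d M₀ g) (hm : IsContinuousFlow T m) (ht : t ∈ Icc 0 T)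
    {γ w β q : ℝ → E d} (hγ : IsC1Curve T γ w) (hβ : IsC1Curve T β q) {W B : ℝ}
    (hw : ∀ s ∈ Icc t T, ‖w s‖ ≤ W) (hq : ∀ s ∈ Icc t T, ‖q s‖ ≤ B) :
    curveCost T L₀ g m t (fun s => γ s + β s) (fun s => w s + q s) ≤ curveCost T L₀ g m t γ w
      + (T * (M₀ * (1 + (W + B) ^ 2)) + M₀ * (1 + 2 * W + B) + 2 * M₀)
        * (‖β t‖ + ∫ s in t..T, ‖q s‖) := by
  have hT0 : 0 ≤ T := ht.1.trans ht.2
  have hTm : T ∈ Icc 0 T := ⟨hT0, le_rfl⟩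
  have hsub : uIcc t T ⊆ Icc 0 T := uIcc_subset_Icc ht hTm
  have hW : 0 ≤ W := (norm_nonneg _).trans (hw t ⟨le_rfl, ht.2⟩)
  have hB : 0 ≤ B := (norm_nonneg _).trans (hq t ⟨le_rfl, ht.2⟩)
  have hi1 : IntervalIntegrable (fun r => ‖q r‖) volume t T :=
    (hβ.continuousOn_vel.norm.mono hsub).intervalIntegrable
  have hsum := hγ.add hβ
  have hiL := hL.intervalIntegrable_comp hm hγ.continuousOn hγ.continuousOn_vel ht hTm
  have hiL' := hL.intervalIntegrable_comp hm hsum.continuousOn hsum.continuousOn_vel ht hTm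
  set I := ∫ s in t..T, ‖q s‖ with hI
  have hI0 : 0 ≤ I := intervalIntegral.integral_nonneg ht.2 fun _ _ => norm_nonneg _
  have hdisp : ∀ s ∈ Icc t T, ‖β s‖ ≤ ‖β t‖ + I := fun s hs => by
    have h1 : ‖β s - β t‖ ≤ I := by
      refine (hβ.norm_sub_le ht ⟨ht.1.trans hs.1, hs.2⟩ hs.1).trans ?_
      exact intervalIntegral.integral_mono_interval le_rfl hs.1 hs.2
        (Eventually.of_forall fun r => norm_nonneg _) hi1
    have h2 := norm_add_le (β t) (β s - β t)
    rw [add_sub_cancel] at h2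
    linarith
  have hrun : (∫ s in t..T, L₀ (γ s + β s) (w s + q s) (m s)) ≤ ∫ s in t..T,
      ((L₀ (γ s) (w s) (m s) + M₀ * (1 + (W + B) ^ 2) * (‖β t‖ + I))
        + M₀ * (1 + 2 * W + B) * ‖q s‖) := by
    refine intervalIntegral.integral_mono_on ht.2 hiL' ((hiL.add (by simp)).add
      (hi1.const_mul _)) fun s hs => ?_
    have h1 := (abs_le.1 (hL.abs_sub_le hM₀ (γ s) (γ s + β s) (w s) (w s + q s) (m s))).2
    rw [add_sub_cancel_left, add_sub_cancel_left] at h1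
    have hn : ‖w s + q s‖ ≤ W + B :=
      (norm_add_le _ _).trans (add_le_add (hw s hs) (hq s hs))
    have h2 : M₀ * (1 + ‖w s + q s‖ ^ 2) * ‖β s‖
        ≤ M₀ * (1 + (W + B) ^ 2) * (‖β t‖ + I) := by
      gcongr; exact hdisp s hs
    have h3 : M₀ * (1 + ‖w s‖ + ‖w s + q s‖) * ‖q s‖ ≤ M₀ * (1 + 2 * W + B) * ‖q s‖ := by
      refine mul_le_mul_of_nonneg_right (mul_le_mul_of_nonneg_left ?_ hM₀.le) (norm_nonneg _)
      linarith [hw s hs]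
    linarith
  rw [intervalIntegral.integral_add (hiL.add (by simp)) (hi1.const_mul _),
    intervalIntegral.integral_add hiL (by simp), intervalIntegral.integral_const,
    intervalIntegral.integral_const_mul, ← hI, smul_eq_mul] at hrun
  have hterm := (abs_le.1 (hg.abs_sub_le (γ T) (γ T + β T) (m T))).2
  rw [add_sub_cancel_left] at hterm
  have h2 : 2 * M₀ * ‖β T‖ ≤ 2 * M₀ * (‖β t‖ + I) := by
    gcongr; exact hdisp T ⟨ht.2, le_rfl⟩
  have h4 : (T - t) * (M₀ * (1 + (W + B) ^ 2) * (‖β t‖ + I))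
      ≤ T * (M₀ * (1 + (W + B) ^ 2) * (‖β t‖ + I)) := by
    gcongr; linarith [ht.1]
  have h5 : M₀ * (1 + 2 * W + B) * I ≤ M₀ * (1 + 2 * W + B) * (‖β t‖ + I) := by
    gcongr; linarith [norm_nonneg (β t)]
  simp only [curveCost]
  linarith

end Values

/-! ### The feedback flow follows optimal curves -/

section Characteristics

variable {d : ℕ} {T M₀ ε : ℝ} {L₀ : E d → E d → P1 (E d) → ℝ} {g : E d → P1 (E d) → ℝ}
  {m : ℝ → P1 (E d)} {t : ℝ} {x v : E d}

/-- A perturbation that changes the velocity by `q` up to time `t` and not at all after `t + h`. -/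
theorem exists_velocity_perturbation (ht : t ∈ Icc 0 T) {h : ℝ} (hh : 0 < h) (q : E d) :
    ∃ β p : ℝ → E d, IsH2Curve T β p ((Ioc t (t + h)).indicator fun _ => -(1 / h) • q) ∧
      β t = 0 ∧ (∀ s ≤ t, p s = q) ∧ (∀ s ∈ Icc t T, ‖p s‖ ≤ ‖q‖) ∧
        ∫ s in t..T, ‖p s‖ ≤ h * ‖q‖ := by
  set b : ℝ → E d := (Ioc t (t + h)).indicator fun _ => -(1 / h) • q with hb
  have hH : IsH2Curve T _ _ b := IsH2Curve.of_acceleration (a := b) (C := ‖-(1 / h) • q‖)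
    (measurable_const.indicator measurableSet_Ioc) (norm_indicator_le_norm_self _) (0 : E d) q t
  set p : ℝ → E d := fun s => q + ∫ r in t..s, b r with hp
  have hformula : ∀ s, t ≤ s → p s = (1 - (min s (t + h) - t) / h) • q := fun s hs => by
    have hmin : 0 ≤ min s (t + h) - t := by rw [sub_nonneg]; exact le_min hs (by linarith)
    simp only [hp, hb]
    rw [intervalIntegral.integral_of_le hs, setIntegral_indicator measurableSet_Ioc, Ioc_inter_Ioc,
      setIntegral_const, max_self, Measure.real, Real.volume_Ioc, ENNReal.toReal_ofReal hmin,
      smul_smul, sub_smul, one_smul, mul_neg, neg_smul, ← sub_eq_add_neg, mul_one_div]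
  have hbefore : ∀ s ≤ t, p s = q := fun s hs => by
    have : ∫ r in t..s, b r = ∫ r in t..s, (0 : E d) := by
      refine intervalIntegral.integral_congr_ae (Eventually.of_forall fun r hr => ?_)
      rw [uIoc_of_ge hs] at hr
      rw [hb, indicator_of_notMem fun h' => absurd h'.1 (not_lt.2 hr.2)]
    simp only [hp, this, intervalIntegral.integral_zero, add_zero]
  have hcoef : ∀ s, t ≤ s → 0 ≤ 1 - (min s (t + h) - t) / h ∧
      1 - (min s (t + h) - t) / h ≤ 1 := fun s hs => by
    constructor
    · rw [sub_nonneg, div_le_one hh]; linarith [min_le_right s (t + h)]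
    · have : 0 ≤ (min s (t + h) - t) / h :=
        div_nonneg (sub_nonneg.2 (le_min hs (by linarith))) hh.le
      linarith
  have hnorm : ∀ s, t ≤ s → ‖p s‖ ≤ ‖q‖ := fun s hs => by
    rw [hformula s hs, norm_smul, Real.norm_eq_abs, abs_of_nonneg (hcoef s hs).1]
    exact mul_le_of_le_one_left (norm_nonneg _) (hcoef s hs).2
  have hle : ∀ r, t ≤ r → ∫ s in t..r, ‖p s‖ ≤ ‖q‖ * (r - t) := fun r hr => by
    have := intervalIntegral.norm_integral_le_of_norm_le_const (a := t) (b := r)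
      (f := fun s => ‖p s‖) (C := ‖q‖) fun s hs => by
        rw [uIoc_of_le hr] at hs
        rw [norm_norm]; exact hnorm s hs.1.le
    rw [abs_of_nonneg (sub_nonneg.2 hr)] at this
    exact (le_abs_self _).trans this
  refine ⟨_, _, hH, by simp, hbefore, fun s hs => hnorm s hs.1, ?_⟩
  rcases le_total (t + h) T with hhT | hhT
  · have hthT : t + h ∈ Icc 0 T := ⟨by linarith [ht.1], hhT⟩
    have hTm : T ∈ Icc 0 T := ⟨ht.1.trans ht.2, le_rfl⟩
    have hint : ∀ r s, r ∈ Icc 0 T → s ∈ Icc 0 T →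
        IntervalIntegrable (fun s => ‖p s‖) volume r s := fun r s hr hs =>
      (hH.continuousOn_vel.norm.mono (uIcc_subset_Icc hr hs)).intervalIntegrable
    rw [← intervalIntegral.integral_add_adjacent_intervals (hint _ _ ht hthT) (hint _ _ hthT hTm)]
    have h2 : ∫ s in (t + h)..T, ‖p s‖ = 0 := by
      rw [intervalIntegral.integral_congr (g := fun _ => (0 : ℝ)), intervalIntegral.integral_zero]
      intro s hs
      rw [uIcc_of_le hhT] at hs
      change ‖p s‖ = 0
      rw [hformula s (by linarith [hs.1]), min_eq_right hs.1, add_sub_cancel_left, div_self hh.ne']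
      simp
    have h1 := hle (t + h) (by linarith)
    rw [add_sub_cancel_left] at h1
    rw [h2, add_zero, mul_comm]
    exact h1
  · refine (hle T ht.2).trans ?_
    rw [mul_comm]
    gcongr
    linarith

/-- Comparison of the values at `(t, x, v + q)` and `(t, x, v)`, through a curve that is near
optimal for the latter. The mean acceleration of that curve on a short interval `[t, t + h]` enters
as an approximate supergradient of the value function in `v`. -/
theorem value_add_velocity_le (hT : 0 < T) (hM₀ : 0 < M₀) (hL : LagrangianAssumptions d M₀ L₀)
    (hg : TerminalAssumptions d M₀ g) (hm : IsContinuousFlow T m) (ht : t ∈ Icc 0 T)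
    {U : ℝ} {q : E d} (hU : IsGLB (accelerationCosts T L₀ g ε m t x (v + q)) U)
    {γ w a : ℝ → E d} (hγ : IsH2Curve T γ w a) (hx : γ t = x) (hv : w t = v)
    {W : ℝ} (hW : ∀ s ∈ Icc t T, ‖w s‖ ≤ W) (hq : ‖q‖ ≤ 1) {h : ℝ} (hh : 0 < h)
    (hhT : t + h ≤ T) :
    U ≤ ε / 2 * (∫ s in t..T, ‖a s‖ ^ 2) + curveCost T L₀ g m t γ w
      - ε * inner ℝ ((1 / h) • ∫ s in t..(t + h), a s) q + ε / 2 * (‖q‖ ^ 2 / h)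
      + (T * (M₀ * (1 + (W + 1) ^ 2)) + M₀ * (1 + 2 * W + 1) + 2 * M₀) * (h * ‖q‖) := by
  have hTm : T ∈ Icc 0 T := ⟨hT.le, le_rfl⟩
  have hthT : t + h ∈ Icc 0 T := ⟨by linarith [ht.1], hhT⟩
  have hW0 : 0 ≤ W := (norm_nonneg _).trans (hW t ⟨le_rfl, ht.2⟩)
  obtain ⟨β, p, hβ, hβt, hpt, hpn, hpi⟩ := exists_velocity_perturbation ht hh q
  set b : ℝ → E d := (Ioc t (t + h)).indicator fun _ => -(1 / h) • q with hb
  have h1 := value_le hT hL hm ht hU (hγ.add hβ) (by simp [hx, hβt])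
    (by simp [hv, hpt t le_rfl])
  have h2 := curveCost_add_le hM₀ hL hg hm ht hγ.toIsC1Curve hβ.toIsC1Curve hW
    (B := 1) (fun s hs => (hpn s hs).trans hq)
  have h3 : (T * (M₀ * (1 + (W + 1) ^ 2)) + M₀ * (1 + 2 * W + 1) + 2 * M₀)
        * (‖β t‖ + ∫ s in t..T, ‖p s‖)
      ≤ (T * (M₀ * (1 + (W + 1) ^ 2)) + M₀ * (1 + 2 * W + 1) + 2 * M₀) * (h * ‖q‖) := by
    rw [hβt, norm_zero, zero_add]; gcongr
  have h4 : ∫ s in t..T, ‖a s + b s‖ ^ 2 = (∫ s in t..T, ‖a s‖ ^ 2)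
      - 2 * inner ℝ ((1 / h) • ∫ s in t..(t + h), a s) q + ‖q‖ ^ 2 / h := by
    have hsum := fun {r s : ℝ} (hr : r ∈ Icc 0 T) (hs : s ∈ Icc 0 T) =>
      (hγ.add hβ).intervalIntegrable_sq hr hs
    rw [← intervalIntegral.integral_add_adjacent_intervals (hsum ht hthT) (hsum hthT hTm),
      ← intervalIntegral.integral_add_adjacent_intervals (hγ.intervalIntegrable_sq ht hthT)
        (hγ.intervalIntegrable_sq hthT hTm)]
    have e1 : ∫ s in (t + h)..T, ‖a s + b s‖ ^ 2 = ∫ s in (t + h)..T, ‖a s‖ ^ 2 := by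
      refine intervalIntegral.integral_congr_ae (Eventually.of_forall fun s hs => ?_)
      rw [uIoc_of_le hhT] at hs
      rw [hb, indicator_of_notMem (fun h' => absurd h'.2 (not_le.2 hs.1)), add_zero]
    have hia := hγ.intervalIntegrable_acc ht hthT
    have e2 : ∫ s in t..(t + h), ‖a s + b s‖ ^ 2 = ∫ s in t..(t + h),
        ((‖a s‖ ^ 2 - (2 / h) * inner ℝ q (a s)) + ‖q‖ ^ 2 / h ^ 2) := by
      refine intervalIntegral.integral_congr_ae (Eventually.of_forall fun s hs => ?_)
      rw [uIoc_of_le (by linarith)] at hs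
      rw [hb, indicator_of_mem hs, norm_add_sq_real, inner_smul_right, norm_smul, mul_pow,
        Real.norm_eq_abs, sq_abs, real_inner_comm]
      field_simp
      ring
    have hinn : IntervalIntegrable (fun s => (inner ℝ q (a s) : ℝ)) volume t (t + h) :=
      ⟨hia.1.const_inner q, hia.2.const_inner q⟩
    have hcomm : ∫ s in t..(t + h), (inner ℝ q (a s) : ℝ) = inner ℝ q (∫ s in t..(t + h), a s) :=
      (innerSL ℝ q).intervalIntegral_comp_comm hia
    rw [e1, e2, intervalIntegral.integral_add
      ((hγ.intervalIntegrable_sq ht hthT).sub (hinn.const_mul _)) (by simp),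
      intervalIntegral.integral_sub (hγ.intervalIntegrable_sq ht hthT) (hinn.const_mul _),
      intervalIntegral.integral_const_mul, intervalIntegral.integral_const, smul_eq_mul,
      hcomm, real_inner_smul_left, real_inner_comm]
    field_simp
    ring
  rw [h4] at h1
  linarith

/-- Near optimal curves have bounded acceleration in `L²`, hence a Hölder continuous velocity. -/
theorem near_optimal_vel (hT : 0 < T) (hM₀ : 0 < M₀) (hε : 0 < ε)
    (hL : LagrangianAssumptions d M₀ L₀) (hg : TerminalAssumptions d M₀ g)
    (hm : IsContinuousFlow T m) (ht : t ∈ Icc 0 T) {U : ℝ}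
    (hU : IsGLB (accelerationCosts T L₀ g ε m t x v) U) {γ w a : ℝ → E d}
    (hγ : IsH2Curve T γ w a) (hx : γ t = x) (hv : w t = v)
    (hcost : ε / 2 * (∫ s in t..T, ‖a s‖ ^ 2) + curveCost T L₀ g m t γ w ≤ U + 1)
    {s : ℝ} (hs : s ∈ Icc t T) :
    ‖w s - v‖ ≤ √((s - t) * (2 * energyConst T M₀ ‖v‖ / ε)) := by
  have hTm : T ∈ Icc 0 T := ⟨hT.le, le_rfl⟩
  have hsT : s ∈ Icc 0 T := ⟨ht.1.trans hs.1, hs.2⟩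
  have h1 := near_optimal_energy hT hM₀ hL hg hm ht hU le_rfl hγ.toIsC1Curve hx hcost
  have h2 : 0 ≤ 1 / (4 * M₀) * ∫ s in t..T, ‖w s‖ ^ 2 :=
    mul_nonneg (by positivity) (intervalIntegral.integral_nonneg ht.2 fun _ _ => by positivity)
  have h3 : ∫ s in t..T, ‖a s‖ ^ 2 ≤ 2 * energyConst T M₀ ‖v‖ / ε := by
    rw [le_div_iff₀ hε]; linarith
  rw [← hv, hγ.vel_sub_eq ht hsT, hv]
  refine (intervalIntegral.norm_integral_le_integral_norm hs.1).trans (Real.le_sqrt_of_sq_le ?_)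
  refine (integral_norm_sq_le (hγ.intervalIntegrable_acc ht hTm).norm
    (hγ.intervalIntegrable_sq ht hTm) le_rfl hs.1 hs.2).trans ?_
  exact mul_le_mul_of_nonneg_left h3 (by linarith [hs.1])

/-- At a point where `D_v u` exists, the mean acceleration over `[t, t + h]` of a curve which is
optimal up to `h²` is close to `-(1/ε) D_v u`. This replaces the maximum principle, and needs
neither the existence of minimizers nor differentiability in the other variables. -/
theorem mean_acceleration_near_feedback (hT : 0 < T) (hM₀ : 0 < M₀) (hε : 0 < ε)
    (hL : LagrangianAssumptions d M₀ L₀) (hg : TerminalAssumptions d M₀ g)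
    (hm : IsContinuousFlow T m) (ht : t ∈ Ico 0 T) {U : E d → ℝ}
    (hU : ∀ v, IsGLB (accelerationCosts T L₀ g ε m t x v) (U v)) {p : E d}
    (hp : HasGradientAt U p v) {η : ℝ} (hη : 0 < η) :
    ∀ᶠ h in 𝓝[>] (0 : ℝ), ∀ γ w a : ℝ → E d, IsH2Curve T γ w a → γ t = x → w t = v →
      ε / 2 * (∫ s in t..T, ‖a s‖ ^ 2) + curveCost T L₀ g m t γ w ≤ U v + h ^ 2 →
      ‖p + ε • ((1 / h) • ∫ s in t..(t + h), a s)‖ ≤ η := by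
  have htI : t ∈ Icc 0 T := Ico_subset_Icc_self ht
  set W : ℝ := ‖v‖ + √(T * (2 * energyConst T M₀ ‖v‖ / ε)) with hW
  have hW0 : 0 ≤ W := by positivity
  set C : ℝ := T * (M₀ * (1 + (W + 1) ^ 2)) + M₀ * (1 + 2 * W + 1) + 2 * M₀ with hC
  have hC0 : 0 < C := by positivity
  -- the perturbation has size `h θ`, with `θ` small but fixed as `h → 0`
  set θ : ℝ := η / (2 * ε) with hθ
  have hθ0 : 0 < θ := by positivity
  obtain ⟨r, hr, hr'⟩ : ∃ r > 0, ∀ q : E d, ‖q‖ < r →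
      ‖U (v + q) - U v - inner ℝ p q‖ ≤ η / 4 * ‖q‖ := by
    have := (hasGradientAt_iff_isLittleO_nhds_zero.1 hp).def (show 0 < η / 4 by positivity)
    obtain ⟨r, hr, H⟩ := Metric.eventually_nhds_iff.1 this
    exact ⟨r, hr, fun q hq => H (by simpa using hq)⟩
  have small : ∀ c : ℝ, ∀ b : ℝ, 0 < b → ∀ᶠ h in 𝓝[>] (0 : ℝ), c * h < b := fun c b hb => by
    refine Tendsto.eventually_lt_const hb (tendsto_nhdsWithin_of_tendsto_nhds ?_)
    have : Continuous fun h : ℝ => c * h := by fun_prop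
    simpa using this.tendsto 0
  filter_upwards [self_mem_nhdsWithin, small 1 1 one_pos, small 1 (T - t) (by linarith [ht.2]),
    small θ r hr, small θ 1 one_pos, small (1 / θ) (η / 4) (by positivity),
    small C (η / 4) (by positivity)] with h hh h1 h2 h3 h4 h5 h6 γ w a hγ hx hv hcost
  rw [mem_Ioi] at hh
  rw [one_mul] at h1 h2
  set A : E d := (1 / h) • ∫ s in t..(t + h), a s with hA
  set e : E d := p + ε • A with he
  by_cases hez : e = 0
  · rw [hez, norm_zero]; exact hη.le
  have hen : 0 < ‖e‖ := norm_pos_iff.2 hez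
  have hcost1 : ε / 2 * (∫ s in t..T, ‖a s‖ ^ 2) + curveCost T L₀ g m t γ w ≤ U v + 1 :=
    hcost.trans (by nlinarith)
  have hwW : ∀ s ∈ Icc t T, ‖w s‖ ≤ W := fun s hs => by
    have h7 := near_optimal_vel hT hM₀ hε hL hg hm htI (hU v) hγ hx hv hcost1 hs
    have h8 : √((s - t) * (2 * energyConst T M₀ ‖v‖ / ε))
        ≤ √(T * (2 * energyConst T M₀ ‖v‖ / ε)) := by
      have := (energyConst_pos hT hM₀ (norm_nonneg v)).le
      gcongr; linarith [hs.2, ht.1]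
    have h9 := norm_add_le v (w s - v)
    rw [add_sub_cancel] at h9
    linarith
  set q : E d := (h * θ / ‖e‖) • e with hq
  have hqn : ‖q‖ = h * θ := by
    rw [hq, norm_smul, Real.norm_eq_abs, abs_of_pos (by positivity), div_mul_cancel₀ _ hen.ne']
  have h7 := value_add_velocity_le hT hM₀ hL hg hm htI (hU (v + q)) hγ hx hv hwW (q := q)
    (by rw [hqn]; linarith) hh (by linarith)
  have h8 := (abs_le.1 (hr' q (by rw [hqn]; linarith))).1
  have h9 : (inner ℝ p q : ℝ) + ε * inner ℝ A q = h * θ * ‖e‖ := by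
    rw [← real_inner_smul_left, ← inner_add_left, ← he, hq, inner_smul_right,
      real_inner_self_eq_norm_sq]
    field_simp
  rw [← hA, hqn, ← hC] at h7
  rw [hqn] at h8
  have h10 : h * θ * ‖e‖ ≤ h * θ * (1 / θ * h + η / 4 + η / 4 + C * h) := by
    have : h * θ * (1 / θ * h + η / 4 + η / 4 + C * h)
        = h ^ 2 + ε / 2 * ((h * θ) ^ 2 / h) + η / 4 * (h * θ) + C * (h * (h * θ)) := by
      have : ε / 2 * ((h * θ) ^ 2 / h) = h * θ * (η / 4) := by
        rw [hθ]; field_simp; ring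
      rw [this]; field_simp
    rw [this]
    linarith
  have h11 := le_of_mul_le_mul_left h10 (by positivity)
  linarith

/-- Along a solution of the feedback equation the value decreases at least at the rate `L₀`. -/
theorem value_decrease (hT : 0 < T) (hM₀ : 0 < M₀) (hε : 0 < ε)
    (hL : LagrangianAssumptions d M₀ L₀) (hg : TerminalAssumptions d M₀ g)
    (hm : IsContinuousFlow T m) (ht : t ∈ Ico 0 T) {u : ℝ → E d → E d → ℝ}
    (hu : ∀ t ∈ Icc 0 T, ∀ x v, IsGLB (accelerationCosts T L₀ g ε m t x v) (u t x v))
    {K : NNReal} {ρ : ℝ} (hlip : LipschitzOnWith K (fun p : ℝ × E d × E d => u p.1 p.2.1 p.2.2)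
      (Icc 0 T ×ˢ Metric.closedBall 0 ρ)) {X V : ℝ → E d}
    (hXρ : ‖X t‖ < ρ) (hVρ : ‖V t‖ < ρ) {p : E d}
    (hp : HasGradientAt (fun v => u t (X t) v) p (V t)) (hX : HasDerivAt X (V t) t)
    (hV : HasDerivAt V (-(1 / ε) • p) t) {η : ℝ} (hη : 0 < η) :
    ∀ᶠ h in 𝓝[>] (0 : ℝ), u (t + h) (X (t + h)) (V (t + h))
      ≤ u t (X t) (V t) + h * (-L₀ (X t) (V t) (m t) + η) := by
  have htI : t ∈ Icc 0 T := Ico_subset_Icc_self ht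
  set x := X t with hx
  set v := V t with hv
  set Q : ℝ := 2 * energyConst T M₀ ‖v‖ / ε with hQ
  have hQ0 : 0 ≤ Q := by
    have := (energyConst_pos hT hM₀ (norm_nonneg v)).le
    positivity
  set ℓ := L₀ x v (m t) with hℓ
  set η₁ : ℝ := η / (2 + K * (3 + 1 / ε)) with hη₁
  have hη₁0 : 0 < η₁ := by positivity
  obtain ⟨δ, hδ, hLδ⟩ := hL.continuous x v (m t) η₁ hη₁0
  obtain ⟨δ', hδ', hmδ⟩ : ∃ δ' > 0, ∀ s ∈ Icc 0 T, dist s t < δ' → d1 (m s) (m t) < δ := by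
    have := (hm t htI).eventually_lt_const hδ
    rw [eventually_nhdsWithin_iff] at this
    obtain ⟨δ', h1, h2⟩ := Metric.eventually_nhds_iff.1 this
    exact ⟨δ', h1, fun s hs hd => h2 hd hs⟩
  have small : ∀ f : ℝ → ℝ, Continuous f → f 0 = 0 → ∀ b > 0, ∀ᶠ h in 𝓝[>] (0 : ℝ), f h < b :=
    fun f hf hf0 b hb => Tendsto.eventually_lt_const (by rwa [hf0])
      (tendsto_nhdsWithin_of_tendsto_nhds (hf.tendsto 0))
  have hshift : Tendsto (fun h : ℝ => t + h) (𝓝[>] 0) (𝓝 t) := by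
    refine tendsto_nhdsWithin_of_tendsto_nhds ?_
    simpa using (continuous_const_add t).tendsto 0
  have hsq : Continuous fun h : ℝ => √(h * Q) := by fun_prop
  have hlin : Continuous fun h : ℝ => h * (‖v‖ + √(T * Q)) := by fun_prop
  have hXo := ((hasDerivAt_iff_isLittleO_nhds_zero.1 hX).mono
    (nhdsWithin_le_nhds (s := Ioi 0))).def hη₁0
  have hVo := ((hasDerivAt_iff_isLittleO_nhds_zero.1 hV).mono
    (nhdsWithin_le_nhds (s := Ioi 0))).def hη₁0
  filter_upwards [self_mem_nhdsWithin, small id continuous_id rfl 1 one_pos,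
    small id continuous_id rfl (T - t) (by linarith [ht.2]), small id continuous_id rfl η₁ hη₁0,
    small id continuous_id rfl δ' hδ',
    mean_acceleration_near_feedback hT hM₀ hε hL hg hm ht (hu t htI x) hp hη₁0,
    hXo, hVo, small _ hsq (by simp) _ hη₁0, small _ hsq (by simp) _ hδ,
    small _ hsq (by simp) (ρ - ‖v‖) (by linarith), small _ hlin (by simp) _ hδ,
    small _ hlin (by simp) (ρ - ‖x‖) (by linarith),
    hshift.eventually (hX.continuousAt.norm.eventually_lt_const hXρ),
    hshift.eventually (hV.continuousAt.norm.eventually_lt_const hVρ)]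
    with h hh h1 h2 h3 h4 hB hXh hVh h5 h6 h7 h8 h9 h10 h11
  simp only [id, mem_Ioi] at hh h1 h2 h3 h4
  obtain ⟨γ, w, a, hγ, hγt, hwt, hcost⟩ := exists_near_optimal hT hL hm htI (hu t htI x v)
    (show (0 : ℝ) < h ^ 2 by positivity)
  have hcost1 : ε / 2 * (∫ s in t..T, ‖a s‖ ^ 2) + curveCost T L₀ g m t γ w ≤ u t x v + 1 :=
    hcost.le.trans (by nlinarith)
  have hTm : T ∈ Icc 0 T := ⟨hT.le, le_rfl⟩
  have hthT : t + h ∈ Icc 0 T := ⟨by linarith [ht.1], by linarith⟩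
  have hle : t ≤ t + h := by linarith
  -- the near optimal curve stays close to `(x, v)` on `[t, t + h]`
  have hwv : ∀ s ∈ Icc t (t + h), ‖w s - v‖ ≤ √(h * Q) := fun s hs => by
    refine (near_optimal_vel hT hM₀ hε hL hg hm htI (hu t htI x v) hγ hγt hwt hcost1
      ⟨hs.1, hs.2.trans hthT.2⟩).trans ?_
    gcongr; linarith [hs.2]
  have hw_int : ∀ s ∈ Icc t (t + h), ‖γ s - x - (s - t) • v‖ ≤ √(h * Q) * (s - t) := fun s hs => by
    have hsI : s ∈ Icc 0 T := ⟨ht.1.trans hs.1, hs.2.trans hthT.2⟩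
    rw [← hγt, hγ.toIsC1Curve.sub_eq_integral htI hsI, ← intervalIntegral.integral_const,
      ← intervalIntegral.integral_sub
        (hγ.continuousOn_vel.mono (uIcc_subset_Icc htI hsI)).intervalIntegrable (by simp)]
    have := intervalIntegral.norm_integral_le_of_norm_le_const (a := t) (b := s)
      (f := fun r => w r - v) (C := √(h * Q)) fun r hr => by
        rw [uIoc_of_le hs.1] at hr
        exact hwv r ⟨hr.1.le, hr.2.trans hs.2⟩
    rwa [abs_of_nonneg (by linarith [hs.1])] at this
  have hγx : ∀ s ∈ Icc t (t + h), ‖γ s - x‖ ≤ h * (‖v‖ + √(T * Q)) := fun s hs => by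
    have e1 := hw_int s hs
    have e2 := norm_add_le (γ s - x - (s - t) • v) ((s - t) • v)
    rw [sub_add_cancel, norm_smul, Real.norm_eq_abs, abs_of_nonneg (by linarith [hs.1])] at e2
    have e3 : √(h * Q) * (s - t) ≤ √(T * Q) * h := by
      have e5 : 0 ≤ s - t := by linarith [hs.1]
      gcongr
      · linarith [ht.1]
      · linarith [hs.2]
    have e4 : (s - t) * ‖v‖ ≤ h * ‖v‖ := by gcongr; linarith [hs.2]
    linarith
  have hrun : h * (ℓ - η₁) ≤ ∫ s in t..(t + h), L₀ (γ s) (w s) (m s) := by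
    have : ∫ s in t..(t + h), (ℓ - η₁) ≤ ∫ s in t..(t + h), L₀ (γ s) (w s) (m s) := by
      refine intervalIntegral.integral_mono_on hle (by simp)
        (hL.intervalIntegrable_comp hm hγ.continuousOn hγ.continuousOn_vel htI hthT) fun s hs => ?_
      have e1 := hLδ (γ s) (w s) (m s) (by rw [dist_eq_norm]; exact (hγx s hs).trans_lt h8)
        (by rw [dist_eq_norm]; exact (hwv s hs).trans_lt h6)
        (hmδ s ⟨ht.1.trans hs.1, hs.2.trans hthT.2⟩ (by
          rw [Real.dist_eq, abs_of_nonneg (by linarith [hs.1])]; linarith [hs.2]))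
      linarith [(abs_lt.1 e1).1]
    rwa [intervalIntegral.integral_const, smul_eq_mul, add_sub_cancel_left] at this
  have htail := value_le hT hL hm hthT (hu _ hthT (γ (t + h)) (w (t + h))) hγ rfl rfl
  have hacc : ε / 2 * ∫ s in (t + h)..T, ‖a s‖ ^ 2 ≤ ε / 2 * ∫ s in t..T, ‖a s‖ ^ 2 := by
    refine mul_le_mul_of_nonneg_left ?_ (by positivity)
    exact intervalIntegral.integral_mono_interval hle hthT.2 le_rfl
      (Eventually.of_forall fun r => by positivity) (hγ.intervalIntegrable_sq htI hTm)
  have hsplit := curveCost_split (g := g) hL hm hγ.toIsC1Curve htI hthT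
  -- comparison of the end points
  have hend1 : ‖X (t + h) - γ (t + h)‖ ≤ 2 * η₁ * h := by
    have e1 := hw_int (t + h) ⟨hle, le_rfl⟩
    rw [add_sub_cancel_left] at e1
    have e2 := norm_sub_le (X (t + h) - x - h • v) (γ (t + h) - x - h • v)
    rw [show X (t + h) - x - h • v - (γ (t + h) - x - h • v) = X (t + h) - γ (t + h) by abel] at e2
    rw [Real.norm_eq_abs, abs_of_pos hh] at hXh
    have e3 : √(h * Q) * h ≤ η₁ * h := by gcongr
    linarith
  have hend2 : ‖V (t + h) - w (t + h)‖ ≤ (1 + 1 / ε) * η₁ * h := by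
    have e1 : w (t + h) - v = h • ((1 / h) • ∫ s in t..(t + h), a s) := by
      rw [smul_smul, mul_one_div_cancel hh.ne', one_smul, ← hγ.vel_sub_eq htI hthT, hwt]
    have e2 := hB γ w a hγ hγt hwt hcost.le
    generalize (1 / h) • ∫ s in t..(t + h), a s = A at e1 e2
    have e3 : V (t + h) - w (t + h)
        = (V (t + h) - V t - h • (-(1 / ε) • p)) - (h / ε) • (p + ε • A) := by
      have : w (t + h) = v + h • A := by rw [← e1]; abel
      rw [this, smul_add, smul_smul (h / ε), div_mul_cancel₀ _ hε.ne', smul_smul,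
        show h * -(1 / ε) = -(h / ε) by ring, neg_smul]
      abel
    rw [Real.norm_eq_abs, abs_of_pos hh] at hVh
    rw [e3]
    refine (norm_sub_le _ _).trans ?_
    rw [norm_smul, Real.norm_eq_abs, abs_of_pos (by positivity)]
    have e4 : h / ε * ‖p + ε • A‖ ≤ h / ε * η₁ := by gcongr
    calc _ ≤ η₁ * h + h / ε * η₁ := add_le_add hVh e4
      _ = _ := by ring
  have hmem1 : ((t + h, X (t + h), V (t + h)) : ℝ × E d × E d) ∈ Icc 0 T ×ˢ Metric.closedBall 0 ρ :=
    ⟨hthT, mem_closedBall_zero_iff.2 (by rw [Prod.norm_def]; exact (max_lt h10 h11).le)⟩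
  have hmem2 : ((t + h, γ (t + h), w (t + h)) : ℝ × E d × E d) ∈
      Icc 0 T ×ˢ Metric.closedBall 0 ρ := by
    refine ⟨hthT, mem_closedBall_zero_iff.2 ?_⟩
    rw [Prod.norm_def]
    refine max_le ?_ ?_
    · have e2 := norm_add_le (γ (t + h) - x) x
      rw [sub_add_cancel] at e2
      exact e2.trans (by linarith [hγx (t + h) ⟨hle, le_rfl⟩])
    · have e2 := norm_add_le (w (t + h) - v) v
      rw [sub_add_cancel] at e2
      exact e2.trans (by linarith [hwv (t + h) ⟨hle, le_rfl⟩])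
  have hK := hlip.dist_le_mul _ hmem1 _ hmem2
  rw [Real.dist_eq] at hK
  have hdist : dist ((t + h, X (t + h), V (t + h)) : ℝ × E d × E d)
      (t + h, γ (t + h), w (t + h)) ≤ (3 + 1 / ε) * η₁ * h := by
    rw [Prod.dist_eq, Prod.dist_eq, dist_self, dist_eq_norm, dist_eq_norm]
    have e0 : 0 ≤ 1 / ε * (η₁ * h) := by positivity
    have e1 : 0 ≤ η₁ * h := by positivity
    refine max_le (by positivity) (max_le ?_ ?_)
    · linarith
    · linarith
  have hK2 : (K : ℝ) * dist ((t + h, X (t + h), V (t + h)) : ℝ × E d × E d)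
      (t + h, γ (t + h), w (t + h)) ≤ K * ((3 + 1 / ε) * η₁ * h) := by gcongr
  have hK3 := (abs_le.1 hK).2
  simp only at hK3
  have hfin : h ^ 2 + h * η₁ + K * ((3 + 1 / ε) * η₁ * h) ≤ h * η := by
    have e1 : η = η₁ * (2 + K * (3 + 1 / ε)) := by
      rw [hη₁, div_mul_cancel₀]; positivity
    have e2 : h ^ 2 ≤ h * η₁ := by rw [sq]; gcongr
    calc _ ≤ h * η₁ + h * η₁ + K * ((3 + 1 / ε) * η₁ * h) := by linarith
      _ = h * (η₁ * (2 + K * (3 + 1 / ε))) := by ring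
      _ = h * η := by rw [← e1]
  linarith

end Characteristics

section CharacteristicEnergy

variable {d : ℕ} {T M₀ ε : ℝ} {L₀ : E d → E d → P1 (E d) → ℝ} {g : E d → P1 (E d) → ℝ}
  {m : ℝ → P1 (E d)} {u : ℝ → E d → E d → ℝ} {γ v : ℝ → E d}

theorem IsCharacteristic.isC1Curve (hT : 0 < T) (h : IsCharacteristic T ε u γ v) :
    IsC1Curve T γ v := by
  set v' : ℝ → E d := IccExtend hT.le ((Icc 0 T).domRestrict v) with hv'
  have hc : Continuous v' := h.continuousOn_vel.domRestrict.Icc_extend'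
  have heq : ∀ s ∈ Icc 0 T, v' s = v s := fun s hs => by
    rw [hv', IccExtend_of_mem _ _ hs]; rfl
  have hprim := IsC1Curve.primitive (T := T) hc (γ 0) 0
  have hγ : ∀ s ∈ Icc 0 T, γ s = γ 0 + ∫ r in (0 : ℝ)..s, v' r := fun s hs => by
    rw [h.pos_eq s hs]
    congr 1
    refine intervalIntegral.integral_congr fun r hr => (heq r ?_).symm
    exact uIcc_subset_Icc ⟨le_rfl, hT.le⟩ hs hr
  refine ⟨h.continuousOn_vel, fun s hs => ?_⟩
  rw [← heq s hs]
  exact (hprim.hasDeriv s hs).congr hγ (hγ s hs)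

theorem norm_gradient_le_of_lip {f : E d → ℝ} {x₀ : E d} {C : ℝ} (hC : 0 ≤ C)
    (h : ∀ᶠ x in 𝓝 x₀, ‖f x - f x₀‖ ≤ C * ‖x - x₀‖) : ‖∇ f x₀‖ ≤ C := by
  rw [gradient, LinearIsometryEquiv.norm_map]
  exact norm_fderiv_le_of_lip' ℝ hC h

theorem terminal_le_value (hT : 0 < T) (hL : LagrangianAssumptions d M₀ L₀)
    (hm : IsContinuousFlow T m)
    {x w : E d} {U : ℝ} (hU : IsGLB (accelerationCosts T L₀ g ε m T x w) U) : g x (m T) ≤ U := by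
  refine hU.2 fun J hJ => ?_
  obtain ⟨γ, w, a, -, hx, -, rfl⟩ := (mem_accelerationCosts hT hL hm ⟨hT.le, le_rfl⟩).1 hJ
  simp [curveCost, hx]

/-- The verification argument: a solution of the feedback equation is at least as cheap as the
value function at its initial point predicts. -/
theorem characteristic_cost_le (hT : 0 < T) (hM₀ : 0 < M₀) (hε : 0 < ε)
    (hL : LagrangianAssumptions d M₀ L₀) (hg : TerminalAssumptions d M₀ g)
    (hm : IsContinuousFlow T m)
    (hu : ∀ t ∈ Icc 0 T, ∀ x v, IsGLB (accelerationCosts T L₀ g ε m t x v) (u t x v))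
    (hlip : LocallyLipschitzOn (Icc (0 : ℝ) T ×ˢ (univ : Set (E d × E d)))
      fun p : ℝ × E d × E d => u p.1 p.2.1 p.2.2) (h : IsCharacteristic T ε u γ v) :
    curveCost T L₀ g m 0 γ v ≤ u 0 (γ 0) (v 0) := by
  have h0 : (0 : ℝ) ∈ Icc 0 T := ⟨le_rfl, hT.le⟩
  have hTm : T ∈ Icc 0 T := ⟨hT.le, le_rfl⟩
  have hγ := h.isC1Curve hT
  obtain ⟨ρ, hρ0, hρ⟩ : ∃ ρ > 0, ∀ s ∈ Icc 0 T, ‖γ s‖ < ρ ∧ ‖v s‖ < ρ := by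
    obtain ⟨C1, h1⟩ := isCompact_Icc.exists_bound_of_continuousOn hγ.continuousOn
    obtain ⟨C2, h2⟩ := isCompact_Icc.exists_bound_of_continuousOn h.continuousOn_vel
    refine ⟨|C1| + |C2| + 1, by positivity, fun s hs => ⟨?_, ?_⟩⟩
    · linarith [h1 s hs, le_abs_self C1, abs_nonneg C2]
    · linarith [h2 s hs, le_abs_self C2, abs_nonneg C1]
  obtain ⟨K, hK⟩ := (hlip.mono (prod_mono_right (subset_univ
    (Metric.closedBall (0 : E d × E d) ρ)))).exists_lipschitzOnWith_of_compact
      (isCompact_Icc.prod (isCompact_closedBall 0 ρ))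
  have hmem : ∀ s ∈ Icc 0 T, ∀ w : E d, ‖w‖ < ρ →
      ((s, γ s, w) : ℝ × E d × E d) ∈ Icc 0 T ×ˢ Metric.closedBall (0 : E d × E d) ρ :=
    fun s hs w hw => ⟨hs, mem_closedBall_zero_iff.2 (by
      rw [Prod.norm_def]; exact (max_lt (hρ s hs).1 hw).le)⟩
  set f : ℝ → E d := fun s => ∇ (fun w => u s (γ s) w) (v s) with hf
  have hfK : ∀ s ∈ Icc 0 T, ‖f s‖ ≤ K := fun s hs => by
    refine norm_gradient_le_of_lip K.2 ?_
    have : ∀ᶠ w in 𝓝 (v s), ‖w‖ < ρ := continuous_norm.continuousAt.eventually_lt_const (hρ s hs).2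
    filter_upwards [this] with w hw
    have := hK.dist_le_mul _ (hmem s hs w hw) _ (hmem s hs _ (hρ s hs).2)
    rw [Prod.dist_eq, Prod.dist_eq, dist_self, dist_self, max_eq_right dist_nonneg,
      max_eq_right dist_nonneg, dist_eq_norm, dist_eq_norm] at this
    exact this
  have hfint : ∀ s t, s ∈ Icc 0 T → t ∈ Icc 0 T → IntervalIntegrable f volume s t :=
    fun s t hs ht => h.integrable.mono_set (by
      rw [uIcc_of_le hT.le]; exact uIcc_subset_Icc hs ht)
  have hγlip : ∀ s ∈ Icc 0 T, ∀ t ∈ Icc 0 T, ‖γ t - γ s‖ ≤ ρ * |t - s| := fun s hs t ht => by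
    rw [hγ.sub_eq_integral hs ht]
    refine intervalIntegral.norm_integral_le_of_norm_le_const fun r hr => ?_
    exact (hρ r (uIcc_subset_Icc hs ht (uIoc_subset_uIcc hr))).2.le
  have hvlip : ∀ s ∈ Icc 0 T, ∀ t ∈ Icc 0 T, ‖v t - v s‖ ≤ K / ε * |t - s| := fun s hs t ht => by
    have : v t - v s = -((1 / ε) • ∫ r in s..t, f r) := by
      rw [h.vel_eq t ht, h.vel_eq s hs, sub_sub_sub_cancel_left, ← smul_sub,
        intervalIntegral.integral_interval_sub_left (hfint _ _ h0 hs) (hfint _ _ h0 ht),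
        intervalIntegral.integral_symm, smul_neg]
    rw [this, norm_neg, norm_smul, Real.norm_eq_abs, abs_of_pos (by positivity)]
    have h1 : ‖∫ r in s..t, f r‖ ≤ K * |t - s| :=
      intervalIntegral.norm_integral_le_of_norm_le_const fun r hr =>
        hfK r (uIcc_subset_Icc hs ht (uIoc_subset_uIcc hr))
    calc 1 / ε * ‖∫ r in s..t, f r‖ ≤ 1 / ε * (K * |t - s|) := by gcongr
      _ = _ := by ring
  set φ : ℝ → ℝ := fun s => u s (γ s) (v s) with hφ
  have hφlip : LipschitzOnWith (K * (Real.toNNReal (1 + ρ + K / ε))) φ (uIcc 0 T) := by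
    rw [uIcc_of_le hT.le]
    refine LipschitzOnWith.of_dist_le_mul fun s hs t ht => ?_
    refine (hK.dist_le_mul _ (hmem s hs _ (hρ s hs).2) _ (hmem t ht _ (hρ t ht).2)).trans ?_
    rw [NNReal.coe_mul, Real.coe_toNNReal _ (by positivity), mul_assoc]
    refine mul_le_mul_of_nonneg_left ?_ K.2
    have e1 := hγlip t ht s hs
    have e2 := hvlip t ht s hs
    rw [Prod.dist_eq, Prod.dist_eq, dist_eq_norm (γ s), dist_eq_norm (v s), Real.dist_eq]
    have e3 : 0 ≤ ρ * |s - t| := by positivity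
    have e4 : 0 ≤ K / ε * |s - t| := by positivity
    have e5 := abs_nonneg (s - t)
    refine max_le ?_ (max_le ?_ ?_)
    · linarith
    · simp only; linarith
    · simp only; linarith
  have hac := hφlip.absolutelyContinuousOnInterval
  have hderiv : ∀ᵐ s ∂volume.restrict (Icc 0 T), deriv φ s ≤ -L₀ (γ s) (v s) (m s) := by
    rw [← Measure.restrict_congr_set Ioo_ae_eq_Icc]
    have hdiff : ∀ᵐ s ∂volume.restrict (Ioo 0 T),
        DifferentiableAt ℝ (fun w => u s (γ s) w) (v s) := by
      rw [Measure.restrict_congr_set Ioo_ae_eq_Icc]; exact h.differentiable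
    have hdφ := hac.ae_differentiableAt
    have hdv := h.integrable.ae_hasDerivAt_integral
    rw [ae_restrict_iff' measurableSet_Ioo] at hdiff ⊢
    filter_upwards [hdiff, hdφ, hdv] with s h1 h2 h3 hs
    have hsI : s ∈ Icc 0 T := Ioo_subset_Icc_self hs
    have hsu : s ∈ uIcc 0 T := by rw [uIcc_of_le hT.le]; exact hsI
    have hnhds : Icc 0 T ∈ 𝓝 s := Icc_mem_nhds hs.1 hs.2
    have hγ' : HasDerivAt γ (v s) s := (hγ.hasDeriv s hsI).hasDerivAt hnhds
    have hv' : HasDerivAt v (-(1 / ε) • f s) s := by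
      have e1 := ((h3 hsu 0 (by simp)).const_smul (1 / ε)).const_sub (v 0)
      rw [neg_smul]
      exact e1.congr_of_eventuallyEq (by
        filter_upwards [hnhds] with r hr
        exact h.vel_eq r hr)
    refine le_of_forall_pos_le_add fun η hη => ?_
    have hdec := value_decrease hT hM₀ hε hL hg hm ⟨hsI.1, hs.2⟩ hu hK (hρ s hsI).1 (hρ s hsI).2
      (h1 hs).hasGradientAt hγ' hv' hη
    have hslope := (hasDerivAt_iff_tendsto_slope_zero.1 (h2 hsu).hasDerivAt).mono_left
      (nhdsWithin_mono 0 (show Ioi (0 : ℝ) ⊆ {0}ᶜ from fun x hx => ne_of_gt hx))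
    refine le_of_tendsto hslope ?_
    filter_upwards [hdec, self_mem_nhdsWithin] with r hr hr0
    rw [mem_Ioi] at hr0
    rw [smul_eq_mul, inv_mul_le_iff₀ hr0]
    simp only [hφ]
    linarith
  have hint : (∫ s in (0 : ℝ)..T, deriv φ s) ≤ ∫ s in (0 : ℝ)..T, -L₀ (γ s) (v s) (m s) :=
    intervalIntegral.integral_mono_ae_restrict hT.le hac.intervalIntegrable_deriv
      (hL.intervalIntegrable_comp hm hγ.continuousOn hγ.continuousOn_vel h0 hTm).neg hderiv
  rw [hac.integral_deriv_eq_sub, intervalIntegral.integral_neg] at hint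
  have hterm := terminal_le_value hT hL hm (hu T hTm (γ T) (v T))
  simp only [curveCost, hφ] at *
  linarith

/-- The energy bound along the feedback flow, uniform in `ε`. -/
theorem characteristic_energy_le (hT : 0 < T) (hM₀ : 0 < M₀) (hε : 0 < ε)
    (hL : LagrangianAssumptions d M₀ L₀) (hg : TerminalAssumptions d M₀ g)
    (hm : IsContinuousFlow T m)
    (hu : ∀ t ∈ Icc 0 T, ∀ x v, IsGLB (accelerationCosts T L₀ g ε m t x v) (u t x v))
    (hlip : LocallyLipschitzOn (Icc (0 : ℝ) T ×ˢ (univ : Set (E d × E d)))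
      fun p : ℝ × E d × E d => u p.1 p.2.1 p.2.2) (h : IsCharacteristic T ε u γ v) {R : ℝ}
    (hR : ‖v 0‖ ≤ R) :
    ∫ s in (0 : ℝ)..T, ‖v s‖ ^ 2 ≤ 4 * M₀ * energyConst T M₀ R := by
  have h0 : (0 : ℝ) ∈ Icc 0 T := ⟨le_rfl, hT.le⟩
  have h1 := characteristic_cost_le hT hM₀ hε hL hg hm hu hlip h
  have h2 := near_optimal_energy hT hM₀ hL hg hm h0 (hu 0 h0 (γ 0) (v 0)) hR (h.isC1Curve hT)
    rfl (A := 0) (by linarith)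
  rw [zero_add, one_div, inv_mul_le_iff₀ (by positivity)] at h2
  exact h2

/-- A `C¹` curve whose energy is at most `Λ` is Hölder continuous of exponent `1/2`. -/
theorem IsC1Curve.holder (h : IsC1Curve T γ v) {t Λ : ℝ} (ht : t ∈ Icc 0 T)
    (hΛ : ∫ s in t..T, ‖v s‖ ^ 2 ≤ Λ) {r s : ℝ} (hr : r ∈ Icc t T) (hs : s ∈ Icc t T) :
    ‖γ s - γ r‖ ≤ √(Λ * |s - r|) := by
  wlog hrs : r ≤ s generalizing r s
  · rw [norm_sub_rev, abs_sub_comm]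
    exact this hs hr (le_of_not_ge hrs)
  have hTm : T ∈ Icc 0 T := ⟨ht.1.trans ht.2, le_rfl⟩
  have hc : ContinuousOn v (uIcc t T) := h.continuousOn_vel.mono (uIcc_subset_Icc ht hTm)
  have hrI : r ∈ Icc 0 T := ⟨ht.1.trans hr.1, hr.2⟩
  have hsI : s ∈ Icc 0 T := ⟨ht.1.trans hs.1, hs.2⟩
  refine (h.norm_sub_le hrI hsI hrs).trans (Real.le_sqrt_of_sq_le ?_)
  refine (integral_norm_sq_le hc.norm.intervalIntegrable (hc.norm.pow 2).intervalIntegrable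
    hr.1 hrs hs.2).trans ?_
  rw [abs_of_nonneg (sub_nonneg.2 hrs), mul_comm]
  exact mul_le_mul_of_nonneg_right hΛ (sub_nonneg.2 hrs)

end CharacteristicEnergy

/-! ### The limit value function -/

theorem d1_nonneg {X : Type} [MetricSpace X] [MeasurableSpace X] (m m' : P1 X) : 0 ≤ d1 m m' :=
  ENNReal.toReal_nonneg

theorem IsModulus.exists_lt {ω : ℝ → ℝ} (h : IsModulus ω) {η : ℝ} (hη : 0 < η) :
    ∃ δ > 0, ∀ r, 0 ≤ r → r < δ → ω r < η := by
  have := h.tendsto.eventually_lt_const hη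
  rw [eventually_nhdsWithin_iff] at this
  obtain ⟨δ, hδ, H⟩ := Metric.eventually_nhds_iff.1 this
  exact ⟨δ, hδ, fun r hr hrδ => H (by rwa [Real.dist_eq, sub_zero, abs_of_nonneg hr]) hr⟩

section Limit

variable {d : ℕ} {T M₀ : ℝ} {L₀ : E d → E d → P1 (E d) → ℝ} {g : E d → P1 (E d) → ℝ}
  {m : ℝ → P1 (E d)} {t : ℝ} {x : E d}

theorem isGLB_limitCosts (hT : 0 < T) (hM₀ : 0 < M₀) (hL : LagrangianAssumptions d M₀ L₀)
    (hg : TerminalAssumptions d M₀ g) (hm : IsContinuousFlow T m) (ht : t ∈ Icc 0 T) (x : E d) :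
    IsGLB (limitCosts T L₀ g m t x) (sInf (limitCosts T L₀ g m t x)) := by
  refine isGLB_csInf ⟨_, (mem_limitCosts hT ht).2 ⟨_, _, IsC1Curve.const x, rfl, rfl⟩⟩
    ⟨curveCost T L₀ g m t (fun _ => x) (fun _ => 0) - T * (M₀ ^ 3 * (T + 3) ^ 2), ?_⟩
  intro J hJ
  obtain ⟨γ, w, hγ, hx, rfl⟩ := (mem_limitCosts hT ht).1 hJ
  have h1 := energy_le hM₀ hL hg hm hγ ht
  have h2 : 0 ≤ 1 / (4 * M₀) * ∫ s in t..T, ‖w s‖ ^ 2 :=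
    mul_nonneg (by positivity) (intervalIntegral.integral_nonneg ht.2 fun _ _ => by positivity)
  rw [hx] at h1
  linarith

theorem limit_le (hT : 0 < T) (ht : t ∈ Icc 0 T) {U : ℝ}
    (hU : IsGLB (limitCosts T L₀ g m t x) U) {γ w : ℝ → E d} (h : IsC1Curve T γ w)
    (hx : γ t = x) : U ≤ curveCost T L₀ g m t γ w :=
  hU.1 ((mem_limitCosts hT ht).2 ⟨γ, w, h, hx, rfl⟩)

/-- Near optimal curves of the limit problem exist, and their energy is bounded by a constant that
does not depend on the initial point. -/
theorem exists_near_optimal_limit (hT : 0 < T) (hM₀ : 0 < M₀) (hL : LagrangianAssumptions d M₀ L₀)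
    (hg : TerminalAssumptions d M₀ g) (hm : IsContinuousFlow T m) (ht : t ∈ Icc 0 T) {U : ℝ}
    (hU : IsGLB (limitCosts T L₀ g m t x) U) {η : ℝ} (hη : 0 < η) :
    ∃ γ w : ℝ → E d, IsC1Curve T γ w ∧ γ t = x ∧ curveCost T L₀ g m t γ w < U + η ∧
      ∫ s in t..T, ‖w s‖ ^ 2 ≤ 4 * M₀ * energyConst T M₀ 0 := by
  obtain ⟨J, hJ, -, hJU⟩ := hU.exists_between
    (lt_add_of_pos_right U (lt_min hη one_pos))
  obtain ⟨γ, w, h, hx, rfl⟩ := (mem_limitCosts hT ht).1 hJ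
  refine ⟨γ, w, h, hx, hJU.trans_le (by gcongr; exact min_le_left _ _), ?_⟩
  have h1 := limit_le hT ht hU (IsC1Curve.const x) rfl
  have h2 := energy_le hM₀ hL hg hm h ht
  rw [hx] at h2
  have h3 := min_le_right η 1
  have h4 : 1 / (4 * M₀) * (∫ s in t..T, ‖w s‖ ^ 2) ≤ energyConst T M₀ 0 := by
    simp only [energyConst]
    simp only [mul_zero, add_zero, zero_add]
    linarith
  rwa [one_div, inv_mul_le_iff₀ (by positivity)] at h4

/-- A two-sided bound for `L₀(0, 0, m_s)`, from which bounds on bounded sets follow. -/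
theorem exists_bound_rest (hL : LagrangianAssumptions d M₀ L₀) (hm : IsContinuousFlow T m) :
    ∃ B, 0 ≤ B ∧ ∀ s ∈ Icc 0 T, |L₀ 0 0 (m s)| ≤ B := by
  obtain ⟨C, hC⟩ := isCompact_Icc.exists_bound_of_continuousOn
    (hL.continuousOn_comp hm (γ := fun _ => 0) (w := fun _ => 0) continuousOn_const
      continuousOn_const)
  exact ⟨|C|, abs_nonneg C, fun s hs => (hC s hs).trans (le_abs_self C)⟩

/-- The limit value function does not jump up forward in time: its value at `(t₀, x₀)` is at most
its value at an earlier nearby point, up to a small error. -/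
theorem limit_value_forward (hT : 0 < T) (hM₀ : 0 < M₀) (hL : LagrangianAssumptions d M₀ L₀)
    (hg : TerminalAssumptions d M₀ g) (hm : IsContinuousFlow T m) {u₀ : ℝ → E d → ℝ}
    (hu₀ : IsLimitValue T L₀ g m u₀) (R : ℝ) {η : ℝ} (hη : 0 < η) :
    ∃ Δ > 0, ∀ t ∈ Icc 0 T, ∀ t₀ ∈ Icc 0 T, t ≤ t₀ → t₀ ≤ t + Δ → ∀ x x₀ : E d, ‖x‖ ≤ R →
      ‖x₀ - x‖ ≤ Δ → u₀ t₀ x₀ ≤ u₀ t x + η := by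
  obtain ⟨B₀, hB₀, hB₀'⟩ := exists_bound_rest hL hm
  set Λ := 4 * M₀ * energyConst T M₀ 0 with hΛ
  have hΛ0 : 0 ≤ Λ := by
    have := (energyConst_pos hT hM₀ le_rfl).le
    positivity
  set B := B₀ + M₀ * (|R| + √(Λ * T)) + M₀ ^ 3 / 2 with hB
  have hBpos : 0 ≤ B := by positivity
  set C := M₀ * (T + Λ) + 2 * M₀ with hC
  have hcont : Tendsto (fun Δ : ℝ => B * Δ + C * (Δ + √(Λ * Δ))) (𝓝[>] 0) (𝓝 0) := by
    refine tendsto_nhdsWithin_of_tendsto_nhds ?_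
    have : Continuous fun Δ : ℝ => B * Δ + C * (Δ + √(Λ * Δ)) := by fun_prop
    simpa using this.tendsto 0
  obtain ⟨Δ, hΔη, hΔ⟩ := ((hcont.eventually_lt_const (half_pos hη)).and self_mem_nhdsWithin).exists
  refine ⟨Δ, hΔ, fun t ht t₀ ht₀ htt htΔ x x₀ hx hxx => ?_⟩
  obtain ⟨γ, w, hγ, hγt, hcost, hen⟩ := exists_near_optimal_limit hT hM₀ hL hg hm ht (hu₀ t ht x)
    (half_pos hη)
  have hTm : T ∈ Icc 0 T := ⟨hT.le, le_rfl⟩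
  have ht₀T : t₀ ∈ Icc t T := ⟨htt, ht₀.2⟩
  set c := x₀ - γ t₀ with hc
  have hcn : ‖c‖ ≤ Δ + √(Λ * Δ) := by
    have h1 := hγ.holder ht hen ⟨le_rfl, ht.2⟩ ht₀T
    rw [hγt] at h1
    have h2 : √(Λ * |t₀ - t|) ≤ √(Λ * Δ) := by
      rw [abs_of_nonneg (sub_nonneg.2 htt)]; gcongr; linarith
    calc ‖c‖ = ‖(x₀ - x) - (γ t₀ - x)‖ := by rw [hc]; congr 1; abel
      _ ≤ ‖x₀ - x‖ + ‖γ t₀ - x‖ := norm_sub_le _ _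
      _ ≤ _ := by linarith
  -- the part of the cost before `t₀` is bounded from below
  have hpast : -(B * Δ) ≤ ∫ s in t..t₀, L₀ (γ s) (w s) (m s) := by
    have h1 : ∫ s in t..t₀, (-B) ≤ ∫ s in t..t₀, L₀ (γ s) (w s) (m s) := by
      refine intervalIntegral.integral_mono_on htt (by simp) (hL.intervalIntegrable_comp hm
        hγ.continuousOn hγ.continuousOn_vel ht ht₀) fun s hs => ?_
      have hsT : s ∈ Icc t T := ⟨hs.1, hs.2.trans ht₀.2⟩
      have h2 := hL.lower_bound 0 (γ s) (w s) (m s)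
      have h3 := (abs_le.1 (hB₀' s ⟨ht.1.trans hs.1, hsT.2⟩)).1
      have h4 : ‖γ s - 0‖ ≤ |R| + √(Λ * T) := by
        have h5 := hγ.holder ht hen ⟨le_rfl, ht.2⟩ hsT
        rw [hγt] at h5
        have h6 : √(Λ * |s - t|) ≤ √(Λ * T) := by
          rw [abs_of_nonneg (sub_nonneg.2 hs.1)]; gcongr; linarith [hsT.2, ht.1]
        have h7 := norm_add_le (γ s - x) x
        rw [sub_add_cancel] at h7
        rw [sub_zero]
        linarith [le_abs_self R]
      have h5 : M₀ * ‖γ s - 0‖ ≤ M₀ * (|R| + √(Λ * T)) := by gcongr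
      have h6 : 0 ≤ M₀ ^ 3 / 2 - M₀ * ‖w s‖ + 1 / (2 * M₀) * ‖w s‖ ^ 2 := by
        have : M₀ ^ 3 / 2 - M₀ * ‖w s‖ + 1 / (2 * M₀) * ‖w s‖ ^ 2
            = 1 / (2 * M₀) * (‖w s‖ - M₀ ^ 2) ^ 2 := by field_simp; ring
        rw [this]; positivity
      linarith
    rw [intervalIntegral.integral_const, smul_eq_mul] at h1
    have h2 : (t₀ - t) * B ≤ Δ * B := by gcongr; linarith
    linarith
  have hsplit := curveCost_split (g := g) hL hm hγ ht ht₀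
  have hnew := limit_le hT ht₀ (hu₀ t₀ ht₀ x₀) (hγ.add_const c) (by simp [hc])
  have hshift : curveCost T L₀ g m t₀ (fun s => γ s + c) w ≤
      curveCost T L₀ g m t₀ γ w + C * ‖c‖ := by
    have hsub : uIcc t₀ T ⊆ Icc 0 T := uIcc_subset_Icc ht₀ hTm
    have hi2 : IntervalIntegrable (fun r => ‖w r‖ ^ 2) volume t₀ T :=
      ((hγ.continuousOn_vel.norm.pow 2).mono hsub).intervalIntegrable
    have hi2' : IntervalIntegrable (fun r => ‖w r‖ ^ 2) volume t T :=
      ((hγ.continuousOn_vel.norm.pow 2).mono (uIcc_subset_Icc ht hTm)).intervalIntegrable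
    have hiL := hL.intervalIntegrable_comp hm hγ.continuousOn hγ.continuousOn_vel ht₀ hTm
    have hiL' := hL.intervalIntegrable_comp hm (hγ.add_const c).continuousOn
      (hγ.add_const c).continuousOn_vel ht₀ hTm
    have h1 : ∫ s in t₀..T, L₀ (γ s + c) (w s) (m s) ≤ ∫ s in t₀..T,
        (L₀ (γ s) (w s) (m s) + M₀ * ‖c‖ * (1 + ‖w s‖ ^ 2)) := by
      refine intervalIntegral.integral_mono_on ht₀.2 hiL'
        (hiL.add (((by simp : IntervalIntegrable (fun _ : ℝ => (1 : ℝ)) volume t₀ T).add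
          hi2).const_mul _)) fun s _ => ?_
      have := (abs_le.1 (hL.abs_sub_pos_le (γ s) (γ s + c) (w s) (m s))).2
      rw [add_sub_cancel_left] at this
      linarith
    rw [intervalIntegral.integral_add hiL ((IntervalIntegrable.add (by simp) hi2).const_mul _),
      intervalIntegral.integral_const_mul, intervalIntegral.integral_add (by simp) hi2,
      intervalIntegral.integral_const, smul_eq_mul, mul_one] at h1
    have h2 : ∫ s in t₀..T, ‖w s‖ ^ 2 ≤ Λ := (intervalIntegral.integral_mono_interval htt ht₀.2
      le_rfl (Eventually.of_forall fun r => by positivity) hi2').trans hen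
    have h3 := (abs_le.1 (hg.abs_sub_le (γ T) (γ T + c) (m T))).2
    rw [add_sub_cancel_left] at h3
    have h4 : M₀ * ‖c‖ * (T - t₀ + ∫ s in t₀..T, ‖w s‖ ^ 2) ≤ M₀ * ‖c‖ * (T + Λ) := by
      gcongr; linarith [ht₀.1]
    simp only [curveCost]
    rw [hC]
    linarith
  have h5 : C * ‖c‖ ≤ C * (Δ + √(Λ * Δ)) := by gcongr
  linarith

end Limit

/-! ### Convergence of the value functions -/

section Convergence

variable {d : ℕ} {T M₀ : ℝ} {L₀ : E d → E d → P1 (E d) → ℝ} {g : E d → P1 (E d) → ℝ}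
  {mk : ℕ → ℝ → P1 (E d)} {m : ℝ → P1 (E d)}

/-- The terminal costs converge uniformly on bounded sets. -/
theorem terminal_tendsto (hT : 0 < T) (hM₀ : 0 < M₀) (hg : TerminalAssumptions d M₀ g)
    (hmk : FlowTendsto T mk m) (R : ℝ) {η : ℝ} (hη : 0 < η) :
    ∀ᶠ k in atTop, ∀ x : E d, ‖x‖ ≤ R → |g x (mk k T) - g x (m T)| < η := by
  have key : ∀ᶠ k in atTop, ∀ x ∈ Metric.closedBall (0 : E d) R,
      |g x (mk k T) - g x (m T)| < η := by
    refine (isCompact_closedBall (0 : E d) R).induction_on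
      (p := fun S => ∀ᶠ k in atTop, ∀ x ∈ S, |g x (mk k T) - g x (m T)| < η) (by simp)
      (fun s t hst h => h.mono fun k hk x hx => hk x (hst hx))
      (fun s t hs ht => (hs.and ht).mono fun k hk x hx => hx.elim (hk.1 x) (hk.2 x))
      fun x _ => ?_
    obtain ⟨δ, hδ, H⟩ := hg.uniformContinuous x (η / 3) (by positivity)
    refine ⟨Metric.ball x (η / (6 * M₀)),
      mem_nhdsWithin_of_mem_nhds (Metric.ball_mem_nhds _ (by positivity)), ?_⟩
    filter_upwards [hmk δ hδ] with k hk y hy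
    have h1 := H _ _ (hk T ⟨hT.le, le_rfl⟩)
    rw [Metric.mem_ball, dist_eq_norm] at hy
    have h2 : 2 * M₀ * ‖y - x‖ < η / 3 := by
      have := mul_lt_mul_of_pos_left hy (show 0 < 2 * M₀ by positivity)
      rwa [show 2 * M₀ * (η / (6 * M₀)) = η / 3 by field_simp; ring] at this
    have h3 := abs_le.1 (hg.abs_sub_le x y (mk k T))
    have h4 := abs_le.1 (hg.abs_sub_le x y (m T))
    rw [abs_lt] at h1 ⊢
    constructor <;> linarith [h1.1, h1.2, h3.1, h3.2, h4.1, h4.2]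
  exact key.mono fun k hk x hx => hk x (mem_closedBall_zero_iff.2 hx)

/-- The costs for `m^k` and for `m` are close, uniformly on the curves in a bounded set, whatever
their velocity. -/
theorem curveCost_tendsto (hT : 0 < T) (hM₀ : 0 < M₀) (hL : LagrangianAssumptions d M₀ L₀)
    (hg : TerminalAssumptions d M₀ g) (hmkc : ∀ k, IsContinuousFlow T (mk k))
    (hm : IsContinuousFlow T m) (hmk : FlowTendsto T mk m) {R : ℝ} (hR : 0 ≤ R) {η : ℝ}
    (hη : 0 < η) :
    ∀ᶠ k in atTop, ∀ t ∈ Icc 0 T, ∀ γ w : ℝ → E d, IsC1Curve T γ w →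
      (∀ s ∈ Icc t T, ‖γ s‖ ≤ R) →
      |curveCost T L₀ g (mk k) t γ w - curveCost T L₀ g m t γ w| ≤ η := by
  obtain ⟨θ, ω, hθ, hθm, hω, hLω⟩ := hL.measure_modulus
  have hθR := hθ R hR
  set η' := η / (2 * T * (θ R + 1)) with hη'
  have hη'0 : 0 < η' := by positivity
  obtain ⟨δ, hδ, hωδ⟩ := hω.exists_lt hη'0
  filter_upwards [hmk δ hδ, terminal_tendsto hT hM₀ hg hmk R (half_pos hη)] with k hk hk'
    t ht γ w hγ hγR
  have hTm : T ∈ Icc 0 T := ⟨hT.le, le_rfl⟩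
  have h1 := hk' (γ T) (hγR T ⟨ht.2, le_rfl⟩)
  have h2 : |(∫ s in t..T, L₀ (γ s) (w s) (mk k s)) - ∫ s in t..T, L₀ (γ s) (w s) (m s)|
      ≤ η / 2 := by
    rw [← intervalIntegral.integral_sub
      (hL.intervalIntegrable_comp (hmkc k) hγ.continuousOn hγ.continuousOn_vel ht hTm)
      (hL.intervalIntegrable_comp hm hγ.continuousOn hγ.continuousOn_vel ht hTm)]
    have h3 := intervalIntegral.norm_integral_le_of_norm_le_const (a := t) (b := T)
      (f := fun s => L₀ (γ s) (w s) (mk k s) - L₀ (γ s) (w s) (m s)) (C := (θ R + 1) * η')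
      fun s hs => by
        rw [uIoc_of_le ht.2] at hs
        have hsT : s ∈ Icc t T := ⟨hs.1.le, hs.2⟩
        refine (hLω _ _ _ _).trans ?_
        have e1 : θ ‖γ s‖ ≤ θ R + 1 :=
          (hθm (norm_nonneg _) hR (hγR s hsT)).trans (by linarith)
        have e2 := hωδ _ (d1_nonneg (mk k s) (m s)) (hk s ⟨ht.1.trans hsT.1, hsT.2⟩)
        exact mul_le_mul e1 e2.le (hω.nonneg _ (d1_nonneg _ _)) (by positivity)
    rw [Real.norm_eq_abs, abs_of_nonneg (sub_nonneg.2 ht.2)] at h3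
    refine h3.trans ?_
    have h4 : (θ R + 1) * η' * (T - t) ≤ (θ R + 1) * η' * T := by
      gcongr; linarith [ht.1]
    refine h4.trans (le_of_eq ?_)
    rw [hη']; field_simp
  have h3 := abs_add_le
    ((∫ s in t..T, L₀ (γ s) (w s) (mk k s)) - ∫ s in t..T, L₀ (γ s) (w s) (m s))
    (g (γ T) (mk k T) - g (γ T) (m T))
  rw [← add_sub_add_comm] at h3
  exact h3.trans (by linarith)

/-- The lower bound in the limit `ε → 0`: the acceleration term is dropped, and the energy bound
confines the near optimal curves to a fixed bounded set. -/
theorem limit_le_value (hT : 0 < T) (hM₀ : 0 < M₀) (hL : LagrangianAssumptions d M₀ L₀)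
    (hg : TerminalAssumptions d M₀ g) (hmkc : ∀ k, IsContinuousFlow T (mk k))
    (hm : IsContinuousFlow T m) (hmk : FlowTendsto T mk m) {ε : ℕ → ℝ} (hε : ∀ k, 0 < ε k)
    {u : ℕ → ℝ → E d → E d → ℝ} (hu : ∀ k, ∀ t ∈ Icc 0 T, ∀ x v,
      IsGLB (accelerationCosts T L₀ g (ε k) (mk k) t x v) (u k t x v)) {u₀ : ℝ → E d → ℝ}
    (hu₀ : IsLimitValue T L₀ g m u₀) {R : ℝ} (hR : 0 ≤ R) {η : ℝ} (hη : 0 < η) :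
    ∀ᶠ k in atTop, ∀ t ∈ Icc 0 T, ∀ x v : E d, ‖x‖ ≤ R → ‖v‖ ≤ R →
      u₀ t x ≤ u k t x v + η := by
  set Λ := 4 * M₀ * energyConst T M₀ R with hΛ
  have hΛ0 : 0 ≤ Λ := by
    have := (energyConst_pos hT hM₀ hR).le
    positivity
  filter_upwards [curveCost_tendsto hT hM₀ hL hg hmkc hm hmk
    (show 0 ≤ R + √(Λ * T) by positivity) (half_pos hη)] with k hk t ht x v hx hv
  obtain ⟨γ, w, a, hγ, hγt, hwt, hcost⟩ := exists_near_optimal hT hL (hmkc k) ht (hu k t ht x v)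
    (lt_min (half_pos hη) one_pos)
  have hA : 0 ≤ ε k / 2 * ∫ s in t..T, ‖a s‖ ^ 2 := by
    have := hε k
    exact mul_nonneg (by positivity)
      (intervalIntegral.integral_nonneg ht.2 fun _ _ => by positivity)
  have hm1 := min_le_left (η / 2) 1
  have hm2 := min_le_right (η / 2) 1
  have hen := near_optimal_energy hT hM₀ hL hg (hmkc k) ht (hu k t ht x v) hv hγ.toIsC1Curve hγt
    (hcost.le.trans (by linarith))
  have hen' : 1 / (4 * M₀) * (∫ s in t..T, ‖w s‖ ^ 2) ≤ energyConst T M₀ R := by linarith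
  rw [one_div, inv_mul_le_iff₀ (by positivity)] at hen'
  have hbd : ∀ s ∈ Icc t T, ‖γ s‖ ≤ R + √(Λ * T) := fun s hs => by
    have h5 := hγ.holder ht hen' ⟨le_rfl, ht.2⟩ hs
    rw [hγt] at h5
    have h6 : √(Λ * |s - t|) ≤ √(Λ * T) := by
      rw [abs_of_nonneg (sub_nonneg.2 hs.1)]; gcongr; linarith [hs.2, ht.1]
    have h7 := norm_add_le (γ s - x) x
    rw [sub_add_cancel] at h7
    linarith
  have h1 := (abs_le.1 (hk t ht γ w hγ.toIsC1Curve hbd)).1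
  have h2 := limit_le hT ht (hu₀ t ht x) hγ.toIsC1Curve hγt
  linarith

/-- Competitors with a prescribed initial velocity. Starting from `(x, v)` at time `t`, the curve
brakes within a time of order `δ`, rests until `t₀`, and then accelerates within a time of order
`δ` to the velocity `w` of a given smooth curve. Its acceleration is of order `1 / δ`. -/
theorem exists_competitor {t t₀ : ℝ} (ht : t ∈ Icc 0 T) (ht₀ : t₀ ∈ Icc 0 T)
    (htt : t ≤ t₀) {w : ℝ → E d} (hw : ContDiff ℝ 1 w) {A : ℝ}
    (hA : ∀ s ∈ Icc 0 T, ‖deriv w s‖ ≤ A) (x v : E d) {δ : ℝ} (hδ : 0 < δ) :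
    ∃ γ p a : ℝ → E d, IsH2Curve T γ p a ∧ γ t = x ∧ p t = v ∧
      (∀ s ∈ Icc 0 T, ‖a s‖ ≤ A + (‖w t₀‖ + ‖v‖) / δ) ∧
      (∀ s ∈ Icc t t₀, ‖p s‖ ≤ ‖v‖) ∧ ∫ s in t..t₀, ‖p s‖ ≤ δ * ‖v‖ ∧
      (∀ s ∈ Icc t₀ T, ‖p s - w s‖ ≤ ‖w t₀‖ + ‖v‖) ∧
      ∫ s in t₀..T, ‖p s - w s‖ ≤ δ * (‖w t₀‖ + ‖v‖) := by
  have hT0 : 0 ≤ T := ht.1.trans ht.2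
  have hTm : T ∈ Icc 0 T := ⟨hT0, le_rfl⟩
  have h0 : (0 : ℝ) ∈ Icc 0 T := ⟨le_rfl, hT0⟩
  have hA0 : 0 ≤ A := (norm_nonneg _).trans (hA 0 h0)
  obtain ⟨β₁, p₁, hβ₁, -, hp₁b, hp₁n, hp₁i⟩ := exists_velocity_perturbation ht hδ v
  obtain ⟨β₂, p₂, hβ₂, -, hp₂b, hp₂n, hp₂i⟩ := exists_velocity_perturbation ht₀ hδ (-w t₀)
  rw [norm_neg] at hp₂n hp₂i
  -- the curve with velocity `w (max s t₀)`
  have hdw : Continuous (deriv w) := hw.continuous_deriv le_rfl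
  set b : ℝ → E d := (Ioc t₀ T).indicator (deriv w) with hb
  have hbA : ∀ s, ‖b s‖ ≤ A := fun s => by
    by_cases hs : s ∈ Ioc t₀ T
    · rw [hb, indicator_of_mem hs]; exact hA s ⟨ht₀.1.trans hs.1.le, hs.2⟩
    · rw [hb, indicator_of_notMem hs, norm_zero]; exact hA0
  have hH := IsH2Curve.of_acceleration (T := T) (hdw.measurable.indicator measurableSet_Ioc) hbA
    (0 : E d) (w t₀) t₀
  set q : ℝ → E d := fun s => w t₀ + ∫ r in t₀..s, b r with hq
  have hqb : ∀ s ≤ t₀, q s = w t₀ := fun s hs => by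
    have : ∫ r in t₀..s, b r = ∫ r in t₀..s, (0 : E d) := by
      refine intervalIntegral.integral_congr_ae (Eventually.of_forall fun r hr => ?_)
      rw [uIoc_of_ge hs] at hr
      rw [hb, indicator_of_notMem fun h' => absurd h'.1 (not_lt.2 hr.2)]
    simp only [hq, this, intervalIntegral.integral_zero, add_zero]
  have hqa : ∀ s ∈ Icc t₀ T, q s = w s := fun s hs => by
    have : ∫ r in t₀..s, b r = ∫ r in t₀..s, deriv w r := by
      refine intervalIntegral.integral_congr_ae (Eventually.of_forall fun r hr => ?_)
      rw [uIoc_of_le hs.1] at hr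
      rw [hb, indicator_of_mem (show r ∈ Ioc t₀ T from ⟨hr.1, hr.2.trans hs.2⟩)]
    simp only [hq, this]
    rw [intervalIntegral.integral_deriv_eq_sub
      (fun r _ => (hw.differentiable one_ne_zero) r) (hdw.intervalIntegrable _ _)]
    abel
  have hS := (hH.add hβ₂).add hβ₁
  set p : ℝ → E d := fun s => q s + p₂ s + p₁ s with hp
  set S : ℝ → E d := fun s => (0 + ∫ r in t₀..s, q r) + β₂ s + β₁ s with hSdef
  have hpb : ∀ s ≤ t₀, p s = p₁ s := fun s hs => by
    simp only [hp]
    rw [hqb s hs, hp₂b s hs, add_neg_cancel, zero_add]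
  have hpa : ∀ s ∈ Icc t₀ T, p s - w s = p₂ s + p₁ s := fun s hs => by
    simp only [hp]
    rw [hqa s hs]; abel
  have hint : ∀ f : ℝ → E d, ContinuousOn f (Icc 0 T) → ∀ r s, r ∈ Icc 0 T → s ∈ Icc 0 T →
      IntervalIntegrable (fun s => ‖f s‖) volume r s := fun f hf r s hr hs =>
    (hf.norm.mono (uIcc_subset_Icc hr hs)).intervalIntegrable
  refine ⟨fun s => S s + (x - S t), p, _, hS.add_const _, by simp, ?_, fun s hs => ?_,
    fun s hs => ?_, ?_, fun s hs => ?_, ?_⟩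
  · rw [hpb t htt, hp₁b t le_rfl]
  · have hn : ∀ (r : ℝ) (y : E d), ‖(Ioc r (r + δ)).indicator (fun _ => -(1 / δ) • y) s‖
        ≤ ‖y‖ / δ := fun r y => by
      refine (norm_indicator_le_norm_self _ _).trans (le_of_eq ?_)
      rw [norm_smul, Real.norm_eq_abs, abs_neg, abs_of_pos (by positivity)]
      ring
    refine (norm_add_le _ _).trans ((add_le_add ((norm_add_le _ _).trans
      (add_le_add (hbA s) (hn _ _))) (hn _ _)).trans (le_of_eq ?_))
    rw [norm_neg]; ring
  · rw [hpb s hs.2]; exact hp₁n s ⟨hs.1, hs.2.trans ht₀.2⟩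
  · rw [intervalIntegral.integral_congr (g := fun s => ‖p₁ s‖) fun s hs => by
      rw [uIcc_of_le htt] at hs
      simp only [hpb s hs.2]]
    exact (intervalIntegral.integral_mono_interval le_rfl htt ht₀.2
      (Eventually.of_forall fun r => norm_nonneg _)
      (hint _ hβ₁.continuousOn_vel t T ht hTm)).trans hp₁i
  · rw [hpa s hs]
    exact (norm_add_le _ _).trans (add_le_add (hp₂n s hs) (hp₁n s ⟨htt.trans hs.1, hs.2⟩))
  · have h1 : ∫ s in t₀..T, ‖p s - w s‖ ≤ ∫ s in t₀..T, (‖p₂ s‖ + ‖p₁ s‖) := by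
      refine intervalIntegral.integral_mono_on ht₀.2
        (hint (fun s => p s - w s) (hS.continuousOn_vel.sub hw.continuous.continuousOn) _ _ ht₀ hTm)
        ((hint _ hβ₂.continuousOn_vel _ _ ht₀ hTm).add (hint _ hβ₁.continuousOn_vel _ _ ht₀ hTm))
        fun s hs => ?_
      rw [hpa s hs]; exact norm_add_le _ _
    rw [intervalIntegral.integral_add (hint _ hβ₂.continuousOn_vel _ _ ht₀ hTm)
      (hint _ hβ₁.continuousOn_vel _ _ ht₀ hTm)] at h1
    have h2 := intervalIntegral.integral_mono_interval htt ht₀.2 le_rfl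
      (Eventually.of_forall fun r => norm_nonneg (p₁ r)) (hint _ hβ₁.continuousOn_vel t T ht hTm)
    linarith

/-- Near optimal curves of the limit problem can be taken with a smooth velocity. -/
theorem exists_smooth_near_optimal (hT : 0 < T) (hM₀ : 0 < M₀)
    (hL : LagrangianAssumptions d M₀ L₀) (hg : TerminalAssumptions d M₀ g)
    (hm : IsContinuousFlow T m) {t : ℝ} (ht : t ∈ Icc 0 T) {x : E d} {U : ℝ}
    (hU : IsGLB (limitCosts T L₀ g m t x) U) {η : ℝ} (hη : 0 < η) :
    ∃ γ w : ℝ → E d, ContDiff ℝ 1 w ∧ IsC1Curve T γ w ∧ γ t = x ∧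
      curveCost T L₀ g m t γ w < U + η := by
  obtain ⟨γ, w, hγ, hγt, hcost, -⟩ :=
    exists_near_optimal_limit hT hM₀ hL hg hm ht hU (half_pos hη)
  have hTm : T ∈ Icc 0 T := ⟨hT.le, le_rfl⟩
  obtain ⟨W, hW⟩ := isCompact_Icc.exists_bound_of_continuousOn hγ.continuousOn_vel
  have hW0 : 0 ≤ W := (norm_nonneg _).trans (hW T hTm)
  set w' : ℝ → E d := IccExtend hT.le ((Icc 0 T).domRestrict w) with hw'
  have hunif : UniformContinuous w' := by
    have h1 : Continuous ((Icc 0 T).domRestrict w) := hγ.continuousOn_vel.domRestrict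
    exact (CompactSpace.uniformContinuous_of_continuous h1).comp
      (LipschitzWith.projIcc hT.le).uniformContinuous
  have heq : ∀ s ∈ Icc 0 T, w' s = w s := fun s hs => by
    rw [hw', IccExtend_of_mem _ _ hs]; rfl
  set C := T * (M₀ * (1 + (W + 1) ^ 2)) + M₀ * (1 + 2 * W + 1) + 2 * M₀ with hC
  set r := min 1 (η / (4 * C * T)) with hr
  have hr0 : 0 < r := lt_min one_pos (by positivity)
  obtain ⟨w₁, hw₁, hd⟩ := hunif.exists_contDiff_dist_le hr0
  have hclose : ∀ s ∈ Icc 0 T, ‖w₁ s - w s‖ ≤ r := fun s hs => by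
    rw [← heq s hs, ← dist_eq_norm]; exact (hd s).le
  have hγ₁ := IsC1Curve.primitive (T := T) hw₁.continuous x t
  set γ₁ : ℝ → E d := fun s => x + ∫ q in t..s, w₁ q with hγ₁def
  refine ⟨γ₁, w₁, hw₁.of_le (by exact_mod_cast le_top), hγ₁, by simp [hγ₁def], ?_⟩
  have hβ : IsC1Curve T (fun s => γ₁ s - γ s) (fun s => w₁ s - w s) :=
    ⟨hγ₁.continuousOn_vel.sub hγ.continuousOn_vel,
      fun s hs => (hγ₁.hasDeriv s hs).sub (hγ.hasDeriv s hs)⟩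
  have h1 := curveCost_add_le hM₀ hL hg hm ht hγ hβ (W := W) (B := 1)
    (fun s hs => hW s ⟨ht.1.trans hs.1, hs.2⟩)
    (fun s hs => (hclose s ⟨ht.1.trans hs.1, hs.2⟩).trans (min_le_left _ _))
  simp only [add_sub_cancel] at h1
  have h2 : ∫ s in t..T, ‖w₁ s - w s‖ ≤ r * T := by
    have := intervalIntegral.norm_integral_le_of_norm_le_const (a := t) (b := T)
      (f := fun s => ‖w₁ s - w s‖) (C := r) fun s hs => by
        rw [uIoc_of_le ht.2] at hs
        rw [norm_norm]; exact hclose s ⟨ht.1.trans hs.1.le, hs.2⟩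
    rw [abs_of_nonneg (sub_nonneg.2 ht.2)] at this
    refine (le_abs_self _).trans (this.trans ?_)
    gcongr; linarith [ht.1]
  have h3 : C * (‖γ₁ t - γ t‖ + ∫ s in t..T, ‖w₁ s - w s‖) ≤ η / 4 := by
    have e1 : γ₁ t - γ t = 0 := by simp [hγ₁def, hγt]
    have e2 : r ≤ η / (4 * C * T) := min_le_right _ _
    rw [e1, norm_zero, zero_add]
    have hC0 : 0 < C := by positivity
    calc C * ∫ s in t..T, ‖w₁ s - w s‖ ≤ C * (η / (4 * C * T) * T) := by
          gcongr; exact h2.trans (by gcongr)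
      _ = η / 4 := by field_simp
  linarith

/-- The upper bound in the limit `ε → 0`, near a point `(t₁, x₁)`. The near optimal curve for the
limit problem starts slightly later than the points at which the values are compared, and it is
joined to them by `exists_competitor`. -/
theorem value_le_limit (hT : 0 < T) (hM₀ : 0 < M₀) (hL : LagrangianAssumptions d M₀ L₀)
    (hg : TerminalAssumptions d M₀ g) (hmkc : ∀ k, IsContinuousFlow T (mk k))
    (hm : IsContinuousFlow T m) (hmk : FlowTendsto T mk m) {ε : ℕ → ℝ} (hε : ∀ k, 0 < ε k)
    (hε0 : Tendsto ε atTop (𝓝 0))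
    {u : ℕ → ℝ → E d → E d → ℝ} (hu : ∀ k, ∀ t ∈ Icc 0 T, ∀ x v,
      IsGLB (accelerationCosts T L₀ g (ε k) (mk k) t x v) (u k t x v)) {u₀ : ℝ → E d → ℝ}
    (hu₀ : IsLimitValue T L₀ g m u₀) {t₁ : ℝ} (ht₁ : t₁ ∈ Icc 0 T) (x₁ : E d) {R : ℝ}
    (hR : 0 ≤ R) {η : ℝ} (hη : 0 < η) :
    ∃ Δ > 0, ∀ᶠ k in atTop, ∀ t ∈ Icc 0 T, |t - t₁| < Δ → ∀ x v : E d, ‖x - x₁‖ < Δ → ‖v‖ ≤ R →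
      u k t x v ≤ u₀ t x + η := by
  have hTm : T ∈ Icc 0 T := ⟨hT.le, le_rfl⟩
  obtain ⟨B₀, hB₀, hB₀'⟩ := exists_bound_rest hL hm
  obtain ⟨Δ₁, hΔ₁, hfwd⟩ := limit_value_forward hT hM₀ hL hg hm hu₀ (‖x₁‖ + 1)
    (show 0 < η / 6 by positivity)
  -- `B` bounds the running cost of the competitor before `t₀`
  set B := B₀ + M₀ * (1 + R ^ 2) * (‖x₁‖ + 1 + R) + M₀ * (1 + R) * R with hB
  have hB0 : 0 ≤ B := by positivity
  set Δ₂ := min (Δ₁ / 2) (η / (12 * (B + 1))) with hΔ₂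
  have hΔ₂0 : 0 < Δ₂ := lt_min (by positivity) (by positivity)
  have hΔ₂1 : Δ₂ ≤ Δ₁ / 2 := min_le_left _ _
  have hΔ₂B : 2 * Δ₂ * B ≤ η / 6 := by
    have h1 : Δ₂ ≤ η / (12 * (B + 1)) := min_le_right _ _
    rw [le_div_iff₀ (by positivity)] at h1
    nlinarith
  set t₀ := min (t₁ + Δ₂) T with ht₀def
  have ht₀ : t₀ ∈ Icc 0 T := ⟨le_min (by linarith [ht₁.1]) hT.le, min_le_right _ _⟩
  obtain ⟨γ₁, w₁, hw₁, hγ₁, hγ₁t, hcost₁⟩ := exists_smooth_near_optimal hT hM₀ hL hg hm ht₀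
    (hu₀ t₀ ht₀ x₁) (show 0 < η / 6 by positivity)
  obtain ⟨W, hW⟩ := isCompact_Icc.exists_bound_of_continuousOn hγ₁.continuousOn_vel
  have hW0 : 0 ≤ W := (norm_nonneg _).trans (hW T hTm)
  obtain ⟨A, hA⟩ := isCompact_Icc.exists_bound_of_continuousOn
    (hw₁.continuous_deriv le_rfl).continuousOn (s := Icc 0 T)
  have hA0 : 0 ≤ A := (norm_nonneg _).trans (hA T hTm)
  set C := T * (M₀ * (1 + (W + (W + R)) ^ 2)) + M₀ * (1 + 2 * W + (W + R)) + 2 * M₀ with hC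
  have hC0 : 0 < C := by positivity
  set δ := min 1 (η / (12 * C * (W + 2 * R + 1))) with hδ
  have hδ0 : 0 < δ := lt_min one_pos (by positivity)
  have hδ1 : δ ≤ 1 := min_le_left _ _
  have hδC : C * (δ * (W + 2 * R)) ≤ η / 12 := by
    have h1 : δ ≤ η / (12 * C * (W + 2 * R + 1)) := min_le_right _ _
    rw [le_div_iff₀ (by positivity)] at h1
    have : 0 ≤ C * δ := by positivity
    linarith
  set Δ := min Δ₂ (min 1 (η / (12 * C))) with hΔ
  have hΔ0 : 0 < Δ := lt_min hΔ₂0 (lt_min one_pos (by positivity))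
  have hΔΔ₂ : Δ ≤ Δ₂ := min_le_left _ _
  have hΔ1 : Δ ≤ 1 := (min_le_right _ _).trans (min_le_left _ _)
  have hΔC : C * Δ ≤ η / 12 := by
    have h1 : Δ ≤ η / (12 * C) := (min_le_right _ _).trans (min_le_right _ _)
    rw [le_div_iff₀ (by positivity)] at h1
    linarith
  set P := 2 * W + R with hP
  set D := A + (W + R) / δ with hD
  have hε' : ∀ᶠ k in atTop, ε k * (T * D ^ 2 / 2) < η / 6 := by
    have : Tendsto (fun k => ε k * (T * D ^ 2 / 2)) atTop (𝓝 0) := by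
      simpa using hε0.mul_const (T * D ^ 2 / 2)
    exact this.eventually_lt_const (by positivity)
  refine ⟨Δ, hΔ0, ?_⟩
  filter_upwards [hε', curveCost_tendsto hT hM₀ hL hg hmkc hm hmk
    (show 0 ≤ ‖x₁‖ + 1 + P * T by positivity) (show 0 < η / 6 by positivity)] with k hkε hk
    t ht htt x v hx hv
  have htt' := abs_lt.1 htt
  have htt₀ : t ≤ t₀ := le_min (by linarith) ht.2
  have ht₀t : t₀ ≤ t + 2 * Δ₂ := (min_le_left _ _).trans (by linarith)
  have hxn : ‖x‖ ≤ ‖x₁‖ + 1 := by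
    have := norm_add_le (x - x₁) x₁
    rw [sub_add_cancel] at this
    linarith
  obtain ⟨γ, p, a, hγ, hγt, hpt, haD, hp1, hp1i, hp2, hp2i⟩ :=
    exists_competitor ht ht₀ htt₀ hw₁ hA x v hδ0
  have hw₁t₀ := hW t₀ ht₀
  have hval := value_le hT hL (hmkc k) ht (hu k t ht x v) hγ hγt hpt
  -- the acceleration term
  have hacc : ε k / 2 * ∫ s in t..T, ‖a s‖ ^ 2 ≤ η / 6 := by
    have h1 : ∫ s in t..T, ‖a s‖ ^ 2 ≤ ∫ s in t..T, D ^ 2 := by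
      refine intervalIntegral.integral_mono_on ht.2 (hγ.intervalIntegrable_sq ht hTm) (by simp)
        fun s hs => ?_
      have h2 : A + (‖w₁ t₀‖ + ‖v‖) / δ ≤ D := by rw [hD]; gcongr
      have h3 := (haD s ⟨ht.1.trans hs.1, hs.2⟩).trans h2
      gcongr
    rw [intervalIntegral.integral_const, smul_eq_mul] at h1
    have h2 : (T - t) * D ^ 2 ≤ T * D ^ 2 := by gcongr; linarith [ht.1]
    have h3 : ε k / 2 * ∫ s in t..T, ‖a s‖ ^ 2 ≤ ε k / 2 * (T * D ^ 2) := by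
      have := hε k
      gcongr; exact h1.trans h2
    linarith
  -- the competitor stays in a fixed bounded set
  have hpP : ∀ s ∈ Icc t T, ‖p s‖ ≤ P := fun s hs => by
    rcases le_total s t₀ with h | h
    · exact (hp1 s ⟨hs.1, h⟩).trans (by linarith)
    · have h1 := norm_add_le (p s - w₁ s) (w₁ s)
      rw [sub_add_cancel] at h1
      have h2 := hp2 s ⟨h, hs.2⟩
      have h3 := hW s ⟨ht.1.trans hs.1, hs.2⟩
      linarith
  have hbd : ∀ s ∈ Icc t T, ‖γ s‖ ≤ ‖x₁‖ + 1 + P * T := fun s hs => by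
    have hsI : s ∈ Icc 0 T := ⟨ht.1.trans hs.1, hs.2⟩
    have h1 : ‖γ s - γ t‖ ≤ P * |s - t| := by
      rw [hγ.toIsC1Curve.sub_eq_integral ht hsI]
      refine intervalIntegral.norm_integral_le_of_norm_le_const fun r hr => ?_
      rw [uIoc_of_le hs.1] at hr
      exact hpP r ⟨hr.1.le, hr.2.trans hs.2⟩
    have h2 : P * |s - t| ≤ P * T := by
      rw [abs_of_nonneg (sub_nonneg.2 hs.1)]; gcongr; linarith [hs.2, ht.1]
    have h3 := norm_add_le (γ s - γ t) (γ t)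
    rw [sub_add_cancel, hγt] at h3
    rw [hγt] at h1
    linarith
  have hmeas := (abs_le.1 (hk t ht γ p hγ.toIsC1Curve hbd)).2
  have hsplit := curveCost_split (g := g) hL hm hγ.toIsC1Curve ht ht₀
  have hstay : ∀ s ∈ Icc t t₀, ‖γ s - x‖ ≤ δ * R := fun s hs => by
    rw [← hγt]
    refine (hγ.toIsC1Curve.norm_sub_le ht ⟨ht.1.trans hs.1, hs.2.trans ht₀.2⟩ hs.1).trans ?_
    refine (intervalIntegral.integral_mono_interval le_rfl hs.1 hs.2
      (Eventually.of_forall fun r => norm_nonneg _)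
      (hγ.continuousOn_vel.norm.mono (uIcc_subset_Icc ht ht₀)).intervalIntegrable).trans ?_
    exact hp1i.trans (by gcongr)
  -- the running cost before `t₀`
  have hbefore : ∫ s in t..t₀, L₀ (γ s) (p s) (m s) ≤ η / 6 := by
    have h1 : ∫ s in t..t₀, L₀ (γ s) (p s) (m s) ≤ ∫ s in t..t₀, B := by
      refine intervalIntegral.integral_mono_on htt₀ (hL.intervalIntegrable_comp hm
        hγ.continuousOn hγ.continuousOn_vel ht ht₀) (by simp) fun s hs => ?_
      have h2 := (abs_le.1 (hL.abs_sub_le hM₀ 0 (γ s) 0 (p s) (m s))).2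
      have h3 := (abs_le.1 (hB₀' s ⟨ht.1.trans hs.1, hs.2.trans ht₀.2⟩)).2
      have h4 : ‖p s‖ ≤ R := (hp1 s hs).trans hv
      have h5 : ‖γ s - 0‖ ≤ ‖x₁‖ + 1 + R := by
        have h6 := norm_add_le (γ s - x) x
        rw [sub_add_cancel] at h6
        have h7 : δ * R ≤ R := mul_le_of_le_one_left hR hδ1
        rw [sub_zero]
        linarith [hstay s hs]
      have h6 : M₀ * (1 + ‖p s‖ ^ 2) * ‖γ s - 0‖ ≤ M₀ * (1 + R ^ 2) * (‖x₁‖ + 1 + R) := by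
        gcongr
      have h7 : M₀ * (1 + ‖(0 : E d)‖ + ‖p s‖) * ‖p s - 0‖ ≤ M₀ * (1 + R) * R := by
        rw [norm_zero, add_zero, sub_zero]; gcongr
      linarith
    rw [intervalIntegral.integral_const, smul_eq_mul] at h1
    have h2 : (t₀ - t) * B ≤ 2 * Δ₂ * B := by gcongr; linarith
    linarith
  -- the cost after `t₀`
  have hafter : curveCost T L₀ g m t₀ γ p ≤ curveCost T L₀ g m t₀ γ₁ w₁ + η / 6 := by
    have hβ : IsC1Curve T (fun s => γ s - γ₁ s) (fun s => p s - w₁ s) :=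
      ⟨hγ.continuousOn_vel.sub hγ₁.continuousOn_vel,
        fun s hs => (hγ.hasDeriv s hs).sub (hγ₁.hasDeriv s hs)⟩
    have h1 := curveCost_add_le hM₀ hL hg hm ht₀ hγ₁ hβ (W := W) (B := W + R)
      (fun s hs => hW s ⟨ht₀.1.trans hs.1, hs.2⟩)
      (fun s hs => (hp2 s hs).trans (by linarith))
    simp only [add_sub_cancel] at h1
    have h2 : ‖γ t₀ - γ₁ t₀‖ ≤ δ * R + Δ := by
      rw [hγ₁t]
      have h3 := norm_add_le (γ t₀ - x) (x - x₁)
      rw [sub_add_sub_cancel] at h3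
      linarith [hstay t₀ ⟨htt₀, le_rfl⟩]
    have h3 : δ * (‖w₁ t₀‖ + ‖v‖) ≤ δ * (W + R) := by gcongr
    have h4 : C * (‖γ t₀ - γ₁ t₀‖ + ∫ s in t₀..T, ‖p s - w₁ s‖)
        ≤ C * (δ * (W + 2 * R) + Δ) :=
      mul_le_mul_of_nonneg_left (by linarith) hC0.le
    linarith
  have hlast := hfwd t ht t₀ ht₀ htt₀ (by linarith) x x₁ hxn (by
    rw [norm_sub_rev]; linarith)
  linarith

/-- If the measures converge in `C([0,T]; P_1)`, then the value functions converge locally uniformly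
to the value function of the limit problem. -/
theorem values_tendsto (hT : 0 < T) (hM₀ : 0 < M₀) (hL : LagrangianAssumptions d M₀ L₀)
    (hg : TerminalAssumptions d M₀ g) (hmkc : ∀ k, IsContinuousFlow T (mk k))
    (hm : IsContinuousFlow T m) (hmk : FlowTendsto T mk m) {ε : ℕ → ℝ} (hε : ∀ k, 0 < ε k)
    (hε0 : Tendsto ε atTop (𝓝 0))
    {u : ℕ → ℝ → E d → E d → ℝ} (hu : ∀ k, ∀ t ∈ Icc 0 T, ∀ x v,
      IsGLB (accelerationCosts T L₀ g (ε k) (mk k) t x v) (u k t x v)) :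
    ∃ u₀ : ℝ → E d → ℝ, IsLimitValue T L₀ g m u₀ ∧ ValuesTendsto T u u₀ := by
  have hu₀ : IsLimitValue T L₀ g m fun t x => sInf (limitCosts T L₀ g m t x) :=
    fun t ht x => isGLB_limitCosts hT hM₀ hL hg hm ht x
  refine ⟨_, hu₀, ?_⟩
  rw [ValuesTendsto, Metric.tendstoLocallyUniformlyOn_iff]
  rintro η hη ⟨t₁, x₁, v₁⟩ ⟨ht₁, -⟩
  obtain ⟨Δ, hΔ, hup⟩ := value_le_limit hT hM₀ hL hg hmkc hm hmk hε hε0 hu hu₀ ht₁ x₁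
    (show 0 ≤ ‖v₁‖ + 1 by positivity) (half_pos hη)
  have hlow := limit_le_value hT hM₀ hL hg hmkc hm hmk hε hu hu₀
    (show 0 ≤ ‖x₁‖ + ‖v₁‖ + 1 by positivity) (half_pos hη)
  refine ⟨Icc 0 T ×ˢ univ ∩ Metric.ball (t₁, x₁, v₁) (min Δ 1), ?_, ?_⟩
  · exact inter_mem_nhdsWithin _ (Metric.ball_mem_nhds _ (lt_min hΔ one_pos))
  filter_upwards [hup, hlow] with k hk1 hk2
  rintro ⟨t, x, v⟩ ⟨⟨ht, -⟩, hball⟩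
  rw [Metric.mem_ball, Prod.dist_eq, Prod.dist_eq, max_lt_iff, max_lt_iff, Real.dist_eq,
    dist_eq_norm, dist_eq_norm] at hball
  obtain ⟨h1, h2, h3⟩ := hball
  simp only at h1 h2 h3
  have hx : ‖x‖ ≤ ‖x₁‖ + 1 := by
    have := norm_add_le (x - x₁) x₁
    rw [sub_add_cancel] at this
    linarith [h2.trans_le (min_le_right Δ 1)]
  have hv : ‖v‖ ≤ ‖v₁‖ + 1 := by
    have := norm_add_le (v - v₁) v₁
    rw [sub_add_cancel] at this
    linarith [h3.trans_le (min_le_right Δ 1)]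
  have e1 := hk1 t ht (h1.trans_le (min_le_left _ _)) x v (h2.trans_le (min_le_left _ _)) hv
  have e2 := hk2 t ht x v (by linarith [norm_nonneg v₁]) (by linarith [norm_nonneg x₁])
  rw [Real.dist_eq, abs_lt]
  constructor <;> linarith

end Convergence

/-! ### Couplings and the Wasserstein distance -/

section Wasserstein

theorem d1_le_of_coupling {X : Type} [MetricSpace X] [MeasurableSpace X] {m m' : P1 X}
    {π : Measure (X × X)} (hπ : π ∈ couplings m m') {c : ℝ} (hc : 0 ≤ c)
    (h : ∫⁻ p, edist p.1 p.2 ∂π ≤ ENNReal.ofReal c) : d1 m m' ≤ c :=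
  ENNReal.toReal_le_of_le_ofReal hc ((iInf₂_le π hπ).trans h)

/-- The distance `d1` is a finite infimum: the product coupling has finite cost. -/
theorem iInf_couplings_ne_top {X : Type} [MetricSpace X] [SecondCountableTopology X]
    [MeasurableSpace X] [BorelSpace X] (m m' : P1 X) :
    (⨅ π ∈ couplings m m', ∫⁻ p, edist p.1 p.2 ∂π) ≠ ⊤ := by
  have := m.isProbabilityMeasure
  have := m'.isProbabilityMeasure
  obtain ⟨x, hx⟩ := m.finite_moment
  obtain ⟨y, hy⟩ := m'.finite_moment
  set π := m.toMeasure.prod m'.toMeasure with hπdef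
  have h1 : π.map Prod.fst = m.toMeasure := by simp [hπdef, Measure.map_fst_prod]
  have h2 : π.map Prod.snd = m'.toMeasure := by simp [hπdef, Measure.map_snd_prod]
  refine ne_top_of_le_ne_top ?_ (iInf₂_le π ⟨h1, h2⟩)
  have h3 : ∫⁻ p, edist p.1 p.2 ∂π
      ≤ ∫⁻ p, (edist x p.1 + (edist x y + edist y p.2)) ∂π := by
    refine lintegral_mono fun p => ?_
    calc edist p.1 p.2 ≤ edist p.1 x + edist x p.2 := edist_triangle _ _ _
      _ ≤ edist x p.1 + (edist x y + edist y p.2) := by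
        rw [edist_comm p.1 x]; gcongr; exact edist_triangle _ _ _
  refine ne_top_of_le_ne_top ?_ h3
  have h4 : ∫⁻ p, edist x p.1 ∂π = ∫⁻ a, edist x a ∂m.toMeasure := by
    rw [← h1, lintegral_map (by fun_prop) measurable_fst]
  have h5 : ∫⁻ p, edist y p.2 ∂π = ∫⁻ a, edist y a ∂m'.toMeasure := by
    rw [← h2, lintegral_map (by fun_prop) measurable_snd]
  rw [lintegral_add_left (by fun_prop), lintegral_add_left (by fun_prop), h4, h5, lintegral_const]
  have h6 : π univ = 1 := by simp [hπdef]
  rw [h6, mul_one]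
  exact ENNReal.add_ne_top.2 ⟨hx.ne, ENNReal.add_ne_top.2 ⟨edist_ne_top _ _, hy.ne⟩⟩

theorem d1_spaceMarginal_le {d : ℕ} (μ μ' : P1 (E d × E d)) :
    d1 μ.spaceMarginal μ'.spaceMarginal ≤ d1 μ μ' := by
  refine ENNReal.toReal_mono (iInf_couplings_ne_top μ μ') (le_iInf₂ fun π hπ => ?_)
  have hmap : Measurable (Prod.map Prod.fst Prod.fst : (E d × E d) × (E d × E d) → E d × E d) :=
    measurable_fst.prodMap measurable_fst
  have h1 : (π.map (Prod.map Prod.fst Prod.fst)).map Prod.fst = μ.spaceMarginal.toMeasure := by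
    rw [Measure.map_map measurable_fst hmap]
    change π.map (Prod.fst ∘ Prod.fst) = μ.toMeasure.map Prod.fst
    rw [← Measure.map_map measurable_fst measurable_fst, hπ.1]
  have h2 : (π.map (Prod.map Prod.fst Prod.fst)).map Prod.snd = μ'.spaceMarginal.toMeasure := by
    rw [Measure.map_map measurable_snd hmap]
    change π.map (Prod.fst ∘ Prod.snd) = μ'.toMeasure.map Prod.fst
    rw [← Measure.map_map measurable_fst measurable_snd, hπ.2]
  refine (iInf₂_le (π.map (Prod.map Prod.fst Prod.fst)) ⟨h1, h2⟩).trans ?_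
  rw [lintegral_map (by fun_prop) hmap]
  refine lintegral_mono fun p => ?_
  rw [Prod.edist_eq p.1 p.2]
  exact le_max_left _ _

theorem IsContinuousFlow.spaceMarginal {d : ℕ} {T : ℝ} {μ : ℝ → P1 (E d × E d)}
    (h : IsContinuousFlow T μ) : IsContinuousFlow T fun s => (μ s).spaceMarginal :=
  fun t ht => squeeze_zero (fun _ => d1_nonneg _ _) (fun _ => d1_spaceMarginal_le _ _) (h t ht)

/-- The normalized product is a coupling of two finite measures of the same mass. This includes the
mass zero, where `∞ • 0 = 0`. -/
theorem map_normalized_prod {S : Type*} [MeasurableSpace S] (a b : Measure S)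
    [IsFiniteMeasure a] [IsFiniteMeasure b] (hab : a univ = b univ) :
    ((a univ)⁻¹ • a.prod b).map Prod.fst = a ∧ ((a univ)⁻¹ • a.prod b).map Prod.snd = b := by
  have key : ∀ c : Measure S, c univ = a univ → IsFiniteMeasure c →
      (a univ)⁻¹ • (a univ) • c = c := by
    intro c hc _
    by_cases h0 : c = 0
    · simp [h0]
    · rw [smul_smul, ← hc, ENNReal.inv_mul_cancel (by simpa using h0) (measure_ne_top c _),
        one_smul]
  constructor
  · rw [Measure.map_smul, Measure.map_fst_prod, ← hab]
    exact key a rfl inferInstance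
  · rw [Measure.map_smul, Measure.map_snd_prod]
    exact key b hab.symm inferInstance

/-- A coupling of two probability measures, built from a finite partition of unity `χ`: within the
support of each `χ i` as much mass as possible is kept, and the rest is coupled arbitrarily. -/
theorem exists_coupling_of_partition {S ι : Type*} [MeasurableSpace S] [PseudoEMetricSpace S]
    [Fintype ι] (μ ν : Measure S) [IsProbabilityMeasure μ] [IsProbabilityMeasure ν]
    {χ : ι → S → ℝ≥0∞} (hχ : ∀ i, Measurable (χ i)) (hsum : ∀ x, ∑ i, χ i x = 1) {r D : ℝ≥0∞}
    (hr : ∀ i x y, χ i x ≠ 0 → χ i y ≠ 0 → edist x y ≤ r) (hD : ∀ x y : S, edist x y ≤ D) :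
    ∃ π : Measure (S × S), π.map Prod.fst = μ ∧ π.map Prod.snd = ν ∧
      ∫⁻ p, edist p.1 p.2 ∂π ≤ r + D * ∑ i, (∫⁻ x, χ i x ∂μ - ∫⁻ x, χ i x ∂ν) := by
  have hle : ∀ i x, χ i x ≤ 1 := fun i x => by
    rw [← hsum x]; exact Finset.single_le_sum (f := fun i => χ i x) (fun _ _ => zero_le)
      (Finset.mem_univ i)
  -- `c i` is the mass which is kept in the `i`-th part
  set P : Measure S → ι → ℝ≥0∞ := fun κ i => ∫⁻ x, χ i x ∂κ with hP
  set c : ι → ℝ≥0∞ := fun i => min (P μ i) (P ν i) with hc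
  have hPle : ∀ (κ : Measure S) [IsProbabilityMeasure κ] i, P κ i ≤ 1 := fun κ _ i => by
    calc P κ i ≤ ∫⁻ _, 1 ∂κ := lintegral_mono (hle i)
      _ = 1 := by simp
  have hwd : ∀ (κ : Measure S) i, κ.withDensity (χ i) univ = P κ i := fun κ i => by
    rw [withDensity_apply _ MeasurableSet.univ, Measure.restrict_univ]
  have hPsum : ∀ (κ : Measure S) [IsProbabilityMeasure κ], ∑ i, P κ i = 1 := fun κ _ => by
    rw [hP, ← lintegral_finsetSum _ fun i _ => hχ i]
    simp [hsum]
  -- the part of `κ` which is kept, and the rest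
  set K : Measure S → ι → Measure S := fun κ i => (c i / P κ i) • κ.withDensity (χ i) with hK
  set Q : Measure S → Measure S := fun κ => ∑ i, (1 - c i / P κ i) • κ.withDensity (χ i) with hQ
  have facts : ∀ (κ : Measure S) [IsProbabilityMeasure κ], (∀ i, c i ≤ P κ i) →
      (∀ i, K κ i univ = c i) ∧ (∑ i, K κ i) + Q κ = κ ∧ Q κ univ = ∑ i, (P κ i - c i) ∧
        ∀ i, K κ i {x | χ i x = 0} = 0 := by
    intro κ _ hcκ
    have htop : ∀ i, P κ i ≠ ⊤ := fun i => ((hPle κ i).trans_lt ENNReal.one_lt_top).ne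
    have hdiv : ∀ i, c i / P κ i * P κ i = c i := fun i => by
      by_cases h0 : P κ i = 0
      · rw [h0, mul_zero]; exact (le_zero_iff.1 (h0 ▸ hcκ i)).symm
      · exact ENNReal.div_mul_cancel h0 (htop i)
    have hdiv1 : ∀ i, c i / P κ i ≤ 1 := fun i =>
      ENNReal.div_le_of_le_mul (by rw [one_mul]; exact hcκ i)
    refine ⟨fun i => ?_, ?_, ?_, fun i => ?_⟩
    · rw [hK, Measure.smul_apply, hwd, smul_eq_mul, hdiv]
    · rw [hK, hQ, ← Finset.sum_add_distrib]
      simp_rw [← add_smul, add_tsub_cancel_of_le (hdiv1 _), one_smul]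
      ext s hs
      rw [Measure.finsetSum_apply]
      simp_rw [withDensity_apply _ hs]
      rw [← lintegral_finsetSum _ fun i _ => hχ i]
      simp [hsum]
    · rw [hQ, Measure.finsetSum_apply]
      refine Finset.sum_congr rfl fun i _ => ?_
      rw [Measure.smul_apply, hwd, smul_eq_mul, ENNReal.sub_mul fun _ _ => htop i, one_mul, hdiv]
    · have hms : MeasurableSet {x | χ i x = 0} := hχ i (measurableSet_singleton 0)
      rw [hK, Measure.smul_apply, withDensity_apply _ hms,
        setLIntegral_congr_fun (g := fun _ => 0) hms (fun x hx => hx)]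
      simp
  obtain ⟨hμ1, hμ2, hμ3, hμ4⟩ := facts μ fun i => min_le_left _ _
  obtain ⟨hν1, hν2, hν3, hν4⟩ := facts ν fun i => min_le_right _ _
  have hcfin : ∀ i, c i ≠ ⊤ := fun i =>
    (((min_le_left _ _).trans (hPle μ i)).trans_lt ENNReal.one_lt_top).ne
  have hfK : ∀ i, IsFiniteMeasure (K μ i) ∧ IsFiniteMeasure (K ν i) := fun i =>
    ⟨⟨by rw [hμ1]; exact (hcfin i).lt_top⟩, ⟨by rw [hν1]; exact (hcfin i).lt_top⟩⟩
  have hQle : ∀ κ : Measure S, (∑ i, K κ i) + Q κ = κ → Q κ ≤ κ := fun κ h => by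
    conv_rhs => rw [← h]
    exact Measure.le_add_left le_rfl
  have : IsFiniteMeasure (Q μ) := isFiniteMeasure_of_le μ (hQle μ hμ2)
  have : IsFiniteMeasure (Q ν) := isFiniteMeasure_of_le ν (hQle ν hν2)
  have hcsum : ∑ i, c i ≤ 1 := (Finset.sum_le_sum fun i _ => min_le_left _ _).trans (hPsum μ).le
  have hmass : ∀ (κ : Measure S) [IsProbabilityMeasure κ], (∀ i, K κ i univ = c i) →
      (∑ i, K κ i) + Q κ = κ → Q κ univ = 1 - ∑ i, c i := fun κ _ h1 h2 => by
    have h3 := congrArg (fun ρ : Measure S => ρ univ) h2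
    simp only [Measure.add_apply, Measure.finsetSum_apply, h1, measure_univ] at h3
    exact ENNReal.eq_sub_of_add_eq' ENNReal.one_ne_top (by rw [add_comm]; exact h3)
  have hQQ : Q μ univ = Q ν univ := by rw [hmass μ hμ1 hμ2, hmass ν hν1 hν2]
  -- the coupling
  set π₁ : ι → Measure (S × S) := fun i => (K μ i univ)⁻¹ • (K μ i).prod (K ν i) with hπ₁
  set π₂ : Measure (S × S) := (Q μ univ)⁻¹ • (Q μ).prod (Q ν) with hπ₂
  have hm1 : ∀ i, (π₁ i).map Prod.fst = K μ i ∧ (π₁ i).map Prod.snd = K ν i := fun i => by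
    have := (hfK i).1
    have := (hfK i).2
    exact map_normalized_prod _ _ (by rw [hμ1, hν1])
  have hm2 : π₂.map Prod.fst = Q μ ∧ π₂.map Prod.snd = Q ν := map_normalized_prod _ _ hQQ
  have hmapsum : ∀ f : S × S → S, Measurable f →
      ((∑ i, π₁ i) + π₂).map f = (∑ i, (π₁ i).map f) + π₂.map f := fun f hf => by
    ext s hs
    rw [Measure.map_apply hf hs, Measure.add_apply, Measure.add_apply, Measure.finsetSum_apply,
      Measure.finsetSum_apply, Measure.map_apply hf hs]
    simp_rw [Measure.map_apply hf hs]
  refine ⟨(∑ i, π₁ i) + π₂, ?_, ?_, ?_⟩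
  · rw [hmapsum _ measurable_fst, hm2.1]
    simp_rw [(hm1 _).1]; exact hμ2
  · rw [hmapsum _ measurable_snd, hm2.2]
    simp_rw [(hm1 _).2]; exact hν2
  have hcost1 : ∀ i, ∫⁻ p, edist p.1 p.2 ∂π₁ i ≤ r * c i := fun i => by
    have hms : MeasurableSet {x | χ i x = 0} := hχ i (measurableSet_singleton 0)
    have h1 : ∀ᵐ p ∂π₁ i, χ i p.1 ≠ 0 := by
      rw [ae_iff]
      simp only [not_not]
      have := hμ4 i
      rwa [← (hm1 i).1, Measure.map_apply measurable_fst hms] at this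
    have h2 : ∀ᵐ p ∂π₁ i, χ i p.2 ≠ 0 := by
      rw [ae_iff]
      simp only [not_not]
      have := hν4 i
      rwa [← (hm1 i).2, Measure.map_apply measurable_snd hms] at this
    have h3 : π₁ i univ = c i := by
      rw [← hμ1 i, ← (hm1 i).1, Measure.map_apply measurable_fst MeasurableSet.univ, preimage_univ]
    calc ∫⁻ p, edist p.1 p.2 ∂π₁ i ≤ ∫⁻ _, r ∂π₁ i := by
          refine lintegral_mono_ae ?_
          filter_upwards [h1, h2] with p hp1 hp2 using hr i _ _ hp1 hp2
      _ = r * c i := by rw [lintegral_const, h3]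
  have hcost2 : ∫⁻ p, edist p.1 p.2 ∂π₂ ≤ D * ∑ i, (P μ i - P ν i) := by
    have h3 : π₂ univ = ∑ i, (P μ i - P ν i) := by
      rw [← preimage_univ (f := Prod.fst), ← Measure.map_apply measurable_fst MeasurableSet.univ,
        hm2.1, hμ3]
      refine Finset.sum_congr rfl fun i _ => ?_
      change P μ i - min (P μ i) (P ν i) = _
      rcases le_total (P μ i) (P ν i) with h | h
      · rw [min_eq_left h, tsub_self, tsub_eq_zero_of_le h]
      · rw [min_eq_right h]
    calc ∫⁻ p, edist p.1 p.2 ∂π₂ ≤ ∫⁻ _, D ∂π₂ := lintegral_mono fun p => hD _ _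
      _ = _ := by rw [lintegral_const, h3]
  rw [lintegral_add_measure, lintegral_finsetSum_measure]
  refine add_le_add ?_ hcost2
  calc ∑ i, ∫⁻ p, edist p.1 p.2 ∂π₁ i ≤ ∑ i, r * c i := Finset.sum_le_sum fun i _ => hcost1 i
    _ = r * ∑ i, c i := by rw [Finset.mul_sum]
    _ ≤ r * 1 := by gcongr
    _ = r := mul_one r

/-- On a compact metric space weak convergence implies convergence of the transport cost. -/
theorem exists_coupling_of_tendsto {S : Type*} [MetricSpace S] [CompactSpace S]
    [MeasurableSpace S] [BorelSpace S] {νk : ℕ → ProbabilityMeasure S} {ν : ProbabilityMeasure S}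
    (h : Tendsto νk atTop (𝓝 ν)) {η : ℝ≥0∞} (hη : 0 < η) :
    ∀ᶠ k in atTop, ∃ π : Measure (S × S), π.map Prod.fst = (νk k : Measure S) ∧
      π.map Prod.snd = (ν : Measure S) ∧ ∫⁻ p, edist p.1 p.2 ∂π ≤ η := by
  obtain ⟨r, hr0, hrη⟩ : ∃ r : ℝ, 0 < r ∧ ENNReal.ofReal (2 * r) < η := by
    obtain ⟨q, hq0, hqη⟩ := ENNReal.lt_iff_exists_nnreal_btwn.1 hη
    refine ⟨q / 2, by have : (0 : NNReal) < q := by exact_mod_cast hq0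
                      positivity, ?_⟩
    rwa [mul_div_cancel₀ _ two_ne_zero, ENNReal.ofReal_coe_nnreal]
  -- a finite partition of unity, subordinate to balls of radius `r`
  obtain ⟨F, -, hF⟩ := isCompact_univ.elim_nhds_subcover (fun x : S => Metric.ball x r)
    fun x _ => Metric.ball_mem_nhds x hr0
  set f : F → S → NNReal := fun i x => Real.toNNReal (r - dist x i) with hf
  have hfc : ∀ i, Continuous (f i) := fun i => by
    refine continuous_real_toNNReal.comp ?_
    fun_prop
  have hfpos : ∀ x, ∑ i, f i x ≠ 0 := fun x => by
    obtain ⟨y, hy, hxy⟩ := mem_iUnion₂.1 (hF (mem_univ x))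
    refine (Finset.sum_pos' (fun _ _ => zero_le) ⟨⟨y, hy⟩, Finset.mem_univ _, ?_⟩).ne'
    simp only [hf, Real.toNNReal_pos, sub_pos]
    exact hxy
  set χ : F → BoundedContinuousFunction S NNReal := fun i =>
    BoundedContinuousFunction.mkOfCompact ⟨fun x => f i x / ∑ j, f j x,
      (hfc i).div (continuous_finsetSum _ fun j _ => hfc j) hfpos⟩ with hχ
  have hχa : ∀ i x, χ i x = f i x / ∑ j, f j x := fun i x => rfl
  have hχsum : ∀ x, ∑ i, (χ i x : ℝ≥0∞) = 1 := fun x => by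
    rw [← ENNReal.ofNNReal_finsetSum]
    simp_rw [hχa]
    rw [← Finset.sum_div, div_self (hfpos x), ENNReal.coe_one]
  have hχsupp : ∀ i x y, (χ i x : ℝ≥0∞) ≠ 0 → (χ i y : ℝ≥0∞) ≠ 0 →
      edist x y ≤ ENNReal.ofReal (2 * r) := fun i x y hx hy => by
    have key : ∀ z, (χ i z : ℝ≥0∞) ≠ 0 → dist z i < r := fun z hz => by
      by_contra! hcon
      apply hz
      rw [hχa, hf]
      simp [Real.toNNReal_of_nonpos (sub_nonpos.2 hcon)]
    rw [edist_dist]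
    refine ENNReal.ofReal_le_ofReal ((dist_triangle_right x y i).trans ?_)
    linarith [key x hx, key y hy]
  set D : ℝ≥0∞ := Metric.ediam (univ : Set S) with hD
  have hDtop : D ≠ ⊤ := isCompact_univ.isBounded.ediam_ne_top
  have hlim : Tendsto (fun k => ENNReal.ofReal (2 * r) + D * ∑ i, (∫⁻ x, χ i x ∂(νk k : Measure S)
      - ∫⁻ x, χ i x ∂(ν : Measure S))) atTop (𝓝 (ENNReal.ofReal (2 * r) + D * ∑ i : F, 0)) := by
    refine tendsto_const_nhds.add (ENNReal.Tendsto.const_mul (tendsto_finsetSum _ fun i _ => ?_)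
      (Or.inr hDtop))
    have h1 := ProbabilityMeasure.tendsto_iff_forall_lintegral_tendsto.1 h (χ i)
    have hne : ∫⁻ x, χ i x ∂(ν : Measure S) ≠ ⊤ := by
      refine ne_top_of_le_ne_top ENNReal.one_ne_top ?_
      calc ∫⁻ x, χ i x ∂(ν : Measure S) ≤ ∫⁻ _, 1 ∂(ν : Measure S) := by
            refine lintegral_mono fun x => ?_
            rw [← hχsum x]
            exact Finset.single_le_sum (f := fun i => (χ i x : ℝ≥0∞)) (fun _ _ => zero_le)
              (Finset.mem_univ i)
        _ = 1 := by simp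
    have h2 := ENNReal.Tendsto.sub h1 (tendsto_const_nhds (x := ∫⁻ x, χ i x ∂(ν : Measure S)))
      (Or.inl hne)
    rwa [tsub_self] at h2
  rw [Finset.sum_const_zero, mul_zero, add_zero] at hlim
  filter_upwards [hlim.eventually_lt_const hrη] with k hk
  obtain ⟨π, h1, h2, h3⟩ := exists_coupling_of_partition (νk k : Measure S) (ν : Measure S)
    (χ := fun i x => (χ i x : ℝ≥0∞)) (fun i => (χ i).continuous.measurable.coe_nnreal_ennreal)
    hχsum hχsupp fun x y => Metric.edist_le_ediam_of_mem (mem_univ x) (mem_univ y)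
  exact ⟨π, h1, h2, h3.trans hk.le⟩

end Wasserstein

/-! ### Compactness of laws on path space -/

section PathSpace

/-- A continuously parametrized family of maps `e t` from a compact metric space transports a weakly
convergent sequence of laws into a convergent sequence of flows. -/
theorem exists_subseq_flowTendsto {d : ℕ} {S : Type*} [MetricSpace S] [CompactSpace S]
    [MeasurableSpace S] [BorelSpace S] {T R Λ : ℝ} (hT : 0 < T) {e : ℝ → S → E d}
    (hbd : ∀ t ∈ Icc 0 T, ∀ f, ‖e t f‖ ≤ R)
    (hholder : ∀ s ∈ Icc 0 T, ∀ t ∈ Icc 0 T, ∀ f, ‖e s f - e t f‖ ≤ √(Λ * |s - t|))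
    (hlip : ∀ t, LipschitzWith 1 (e t)) {νk : ℕ → ProbabilityMeasure S} {mk : ℕ → ℝ → P1 (E d)}
    (hmk : ∀ k, ∀ t ∈ Icc 0 T, (mk k t).toMeasure = (νk k : Measure S).map (e t)) :
    ∃ φ : ℕ → ℕ, StrictMono φ ∧ ∃ m : ℝ → P1 (E d), IsContinuousFlow T m ∧
      FlowTendsto T (fun k => mk (φ k)) m := by
  have hmeas : ∀ t, Measurable (e t) := fun t => (hlip t).continuous.measurable
  obtain ⟨ν, φ, hφ, hν⟩ := CompactSpace.tendsto_subseq νk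
  have hproj : ∀ t, (projIcc 0 T hT.le t : ℝ) ∈ Icc 0 T := fun t => (projIcc 0 T hT.le t).2
  -- only the times in `[0, T]` matter, so time is clamped to this interval
  set m : ℝ → P1 (E d) := fun t =>
    { toMeasure := (ν : Measure S).map (e (projIcc 0 T hT.le t))
      isProbabilityMeasure := Measure.isProbabilityMeasure_map (hmeas _).aemeasurable
      finite_moment := by
        refine ⟨0, ?_⟩
        rw [lintegral_map (by fun_prop) (hmeas _)]
        refine lt_of_le_of_lt (lintegral_mono fun f => ?_)
          (b := ∫⁻ _, ENNReal.ofReal R ∂(ν : Measure S))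
          (by simp)
        rw [edist_dist, dist_zero_left]
        exact ENNReal.ofReal_le_ofReal (hbd _ (hproj t) f) } with hmdef
  have hm : ∀ t ∈ Icc 0 T, (m t).toMeasure = (ν : Measure S).map (e t) := fun t ht => by
    simp only [hmdef, projIcc_of_mem hT.le ht]
  refine ⟨φ, hφ, m, fun t ht => ?_, fun η hη => ?_⟩
  · have hle : ∀ s ∈ Icc 0 T, d1 (m s) (m t) ≤ √(Λ * |s - t|) := fun s hs => by
      have hpm : Measurable fun f => (e s f, e t f) := (hmeas s).prodMk (hmeas t)
      refine d1_le_of_coupling (π := (ν : Measure S).map fun f => (e s f, e t f)) ⟨?_, ?_⟩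
        (Real.sqrt_nonneg _) ?_
      · rw [Measure.map_map measurable_fst hpm, hm s hs]; rfl
      · rw [Measure.map_map measurable_snd hpm, hm t ht]; rfl
      · rw [lintegral_map (by fun_prop) hpm]
        calc ∫⁻ f, edist (e s f) (e t f) ∂(ν : Measure S)
            ≤ ∫⁻ _, ENNReal.ofReal √(Λ * |s - t|) ∂(ν : Measure S) := by
              refine lintegral_mono fun f => ?_
              rw [edist_dist, dist_eq_norm]
              exact ENNReal.ofReal_le_ofReal (hholder s hs t ht f)
          _ = _ := by simp
    have hlim : Tendsto (fun s => √(Λ * |s - t|)) (𝓝[Icc 0 T] t) (𝓝 0) := by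
      have : Continuous fun s => √(Λ * |s - t|) := by fun_prop
      have h := (this.tendsto t).mono_left (nhdsWithin_le_nhds (s := Icc 0 T))
      simpa using h
    exact squeeze_zero' (Eventually.of_forall fun _ => d1_nonneg _ _)
      (eventually_mem_nhdsWithin.mono fun s hs => hle s hs) hlim
  · filter_upwards [exists_coupling_of_tendsto hν
      (ENNReal.ofReal_pos.2 (half_pos hη))] with k ⟨π, h1, h2, h3⟩ t ht
    have hpm : Measurable (Prod.map (e t) (e t)) := (hmeas t).prodMap (hmeas t)
    refine lt_of_le_of_lt ?_ (half_lt_self hη)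
    refine d1_le_of_coupling (π := π.map (Prod.map (e t) (e t))) ⟨?_, ?_⟩ (half_pos hη).le ?_
    · rw [Measure.map_map measurable_fst hpm, hmk _ t ht]
      change π.map (e t ∘ Prod.fst) = _
      rw [← Measure.map_map (hmeas t) measurable_fst, h1]; rfl
    · rw [Measure.map_map measurable_snd hpm, hm t ht]
      change π.map (e t ∘ Prod.snd) = _
      rw [← Measure.map_map (hmeas t) measurable_snd, h2]
    · rw [lintegral_map (by fun_prop) hpm]
      refine (lintegral_mono fun p => ?_).trans h3
      simpa using (hlip t) p.1 p.2

/-- The paths on `[0, T]` that are bounded by `R` and Hölder continuous of exponent `1 / 2`, with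
constant `√Λ`. -/
def holderPaths (d : ℕ) (T R Λ : ℝ) : Set (BoundedContinuousFunction (Icc (0 : ℝ) T) (E d)) :=
  {f | (∀ s, ‖f s‖ ≤ R) ∧ ∀ s r : Icc (0 : ℝ) T, ‖f s - f r‖ ≤ √(Λ * |(s : ℝ) - r|)}

theorem isCompact_holderPaths (d : ℕ) (T R Λ : ℝ) : IsCompact (holderPaths d T R Λ) := by
  have hev : ∀ s : Icc (0 : ℝ) T,
      Continuous fun f : BoundedContinuousFunction (Icc (0 : ℝ) T) (E d) => f s :=
    fun s => continuous_eval_const s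
  refine BoundedContinuousFunction.arzela_ascoli₂ (Metric.closedBall 0 R)
    (isCompact_closedBall 0 R) _ ?_ (fun f s hf => ?_) ?_
  · have hA : holderPaths d T R Λ = (⋂ s, {f | ‖f s‖ ≤ R}) ∩
        ⋂ (s : Icc (0 : ℝ) T) (r : Icc (0 : ℝ) T), {f | ‖f s - f r‖ ≤ √(Λ * |(s : ℝ) - r|)} := by
      ext f
      simp only [holderPaths, mem_ofPred_eq, mem_inter_iff, mem_iInter]
    rw [hA]
    exact (isClosed_iInter fun s => isClosed_le (hev s).norm continuous_const).inter
      (isClosed_iInter fun s => isClosed_iInter fun r =>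
        isClosed_le ((hev s).sub (hev r)).norm continuous_const)
  · simpa using hf.1 s
  · refine Metric.equicontinuous_of_continuity_modulus (fun r => √(Λ * r)) ?_ _ fun s r f => ?_
    · have : Continuous fun r => √(Λ * r) := by fun_prop
      simpa using this.tendsto 0
    · rw [dist_eq_norm, Subtype.dist_eq, Real.dist_eq]
      exact f.2.2 s r

/-- A random element of a compact space is measurable when countably many continuous coordinates
that separate points are. -/
theorem aemeasurable_of_separating {Ω S Y : Type*} [MeasurableSpace Ω] [TopologicalSpace S]
    [CompactSpace S] [MeasurableSpace S] [BorelSpace S] [MetricSpace Y]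
    [SecondCountableTopology Y] [MeasurableSpace Y] [BorelSpace Y] {P : Measure Ω}
    {c : ℕ → S → Y} (hc : ∀ n, Continuous (c n)) (hinj : ∀ f f', (∀ n, c n f = c n f') → f = f')
    {Ψ : Ω → S} (hΨ : ∀ n, AEMeasurable (fun z => c n (Ψ z)) P) : AEMeasurable Ψ P := by
  have hemb : IsClosedEmbedding fun f n => c n f :=
    (continuous_pi hc).isClosedEmbedding fun f f' h => hinj f f' fun n => congrFun h n
  exact hemb.measurableEmbedding.aemeasurable_comp_iff.1 (aemeasurable_pi_iff.2 hΨ)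

/-- If almost every trajectory of a process `X` is Hölder continuous, then `X` has a law on path
space. -/
theorem exists_path_law {d : ℕ} {Ω : Type*} [MeasurableSpace Ω] {P : Measure Ω}
    [IsProbabilityMeasure P] {T R Λ : ℝ} (hT : 0 < T) (hR : 0 ≤ R)
    [MeasurableSpace (holderPaths d T R Λ)] [BorelSpace (holderPaths d T R Λ)] {X : ℝ → Ω → E d}
    (hX : ∀ t ∈ Icc 0 T, AEMeasurable (X t) P)
    (hpath : ∀ᵐ z ∂P, (∀ s ∈ Icc 0 T, ‖X s z‖ ≤ R) ∧
      ∀ s ∈ Icc 0 T, ∀ r ∈ Icc 0 T, ‖X s z - X r z‖ ≤ √(Λ * |s - r|)) :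
    ∃ ν : ProbabilityMeasure (holderPaths d T R Λ), ∀ t : Icc (0 : ℝ) T,
      P.map (X t) = (ν : Measure (holderPaths d T R Λ)).map fun f => f.1 t := by
  classical
  have : CompactSpace (holderPaths d T R Λ) :=
    isCompact_iff_compactSpace.1 (isCompact_holderPaths d T R Λ)
  have : Nonempty (Icc (0 : ℝ) T) := ⟨⟨0, le_rfl, hT.le⟩⟩
  have h0 : (0 : BoundedContinuousFunction (Icc (0 : ℝ) T) (E d)) ∈ holderPaths d T R Λ :=
    ⟨fun s => by simpa using hR, fun s r => by
      simp only [BoundedContinuousFunction.coe_zero, Pi.zero_apply, sub_zero, norm_zero]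
      exact Real.sqrt_nonneg _⟩
  have : Nonempty (holderPaths d T R Λ) := ⟨⟨0, h0⟩⟩
  have hex : ∀ z, ((∀ s ∈ Icc 0 T, ‖X s z‖ ≤ R) ∧
      ∀ s ∈ Icc 0 T, ∀ r ∈ Icc 0 T, ‖X s z - X r z‖ ≤ √(Λ * |s - r|)) →
      ∃ f : holderPaths d T R Λ, ∀ t : Icc (0 : ℝ) T, f.1 t = X t z := by
    rintro z ⟨h1, h2⟩
    have hcont : Continuous fun t : Icc (0 : ℝ) T => X t z := by
      refine continuous_iff_continuousAt.2 fun t => ?_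
      rw [ContinuousAt, tendsto_iff_norm_sub_tendsto_zero]
      refine squeeze_zero (fun _ => norm_nonneg _) (fun s => h2 s s.2 t t.2) ?_
      have : Continuous fun s : Icc (0 : ℝ) T => √(Λ * |(s : ℝ) - t|) := by fun_prop
      simpa using this.tendsto t
    exact ⟨⟨BoundedContinuousFunction.mkOfCompact ⟨_, hcont⟩, fun s => h1 s s.2,
      fun s r => h2 s s.2 r r.2⟩, fun t => rfl⟩
  choose! Ψ hΨ using hex
  have hae : ∀ t : Icc (0 : ℝ) T, (fun z => (Ψ z).1 t) =ᵐ[P] X t := fun t =>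
    hpath.mono fun z hz => hΨ z hz t
  have hev : ∀ t : Icc (0 : ℝ) T, Continuous fun f : holderPaths d T R Λ => f.1 t := fun t =>
    (continuous_eval_const t).comp continuous_subtype_val
  have hmeas : AEMeasurable Ψ P := by
    -- a path is determined by its values at the times of a dense sequence
    refine aemeasurable_of_separating
      (c := fun n f => f.1 (TopologicalSpace.denseSeq (Icc (0 : ℝ) T) n))
      (fun n => hev _) (fun f f' h => ?_) fun n => (hX _ (Subtype.prop _)).congr (hae _).symm
    refine Subtype.ext (DFunLike.coe_injective ?_)
    refine f.1.continuous.ext_on (TopologicalSpace.denseRange_denseSeq _) f'.1.continuous ?_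
    rintro _ ⟨n, rfl⟩
    exact h n
  refine ⟨⟨P.map Ψ, Measure.isProbabilityMeasure_map hmeas⟩, fun t => ?_⟩
  rw [ProbabilityMeasure.coe_mk, AEMeasurable.map_map_of_aemeasurable
    (hev t).measurable.aemeasurable hmeas]
  exact Measure.map_congr (hae t).symm

end PathSpace

/-! ### Compactness of the space marginals of the solutions -/

section Marginals

variable {d : ℕ} {T M₀ : ℝ} {L₀ : E d → E d → P1 (E d) → ℝ} {g : E d → P1 (E d) → ℝ}
  {μ₀ : Measure (E d × E d)}

/-- The energy of the characteristics is bounded uniformly in `ε` and in the initial point in the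
support of `μ₀`, so that their positions lie in one compact set of Hölder paths. -/
theorem exists_holder_bound (hT : 0 < T) (hM₀ : 0 < M₀) (hL : LagrangianAssumptions d M₀ L₀)
    (hg : TerminalAssumptions d M₀ g) (hμ₀ : InitialAssumptions d μ₀) :
    ∃ R Λ : ℝ, 0 ≤ R ∧ ∀ {ε : ℝ} {u : ℝ → E d → E d → ℝ} {μ : ℝ → P1 (E d × E d)}
      {Φ : ℝ → E d × E d → E d × E d}, 0 < ε → IsSolution d T L₀ g μ₀ ε u μ →
      (∀ᵐ z ∂μ₀, Φ 0 z = z ∧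
        IsCharacteristic T ε u (fun t => (Φ t z).1) fun t => (Φ t z).2) →
      ∀ᵐ z ∂μ₀, (∀ s ∈ Icc 0 T, ‖(Φ s z).1‖ ≤ R) ∧
        ∀ s ∈ Icc 0 T, ∀ r ∈ Icc 0 T, ‖(Φ s z).1 - (Φ r z).1‖ ≤ √(Λ * |s - r|) := by
  obtain ⟨K, hK, hμK⟩ := hμ₀.compactSupport
  obtain ⟨R₀, hR₀⟩ := hK.isBounded.exists_norm_le
  set Λ : ℝ := 4 * M₀ * energyConst T M₀ R₀ with hΛ
  refine ⟨|R₀| + √(Λ * T), Λ, by positivity, fun {ε u μ Φ} hε hsol hΦ => ?_⟩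
  have hzK : ∀ᵐ z ∂μ₀, z ∈ K := hμK
  filter_upwards [hΦ, hzK] with z ⟨hz0, hz⟩ hzK
  have h0 : (0 : ℝ) ∈ Icc 0 T := ⟨le_rfl, hT.le⟩
  have hzR : ‖z‖ ≤ R₀ := hR₀ z hzK
  have hen := characteristic_energy_le hT hM₀ hε hL hg hsol.continuousFlow.spaceMarginal hsol.value
    hsol.locallyLipschitz hz (R := R₀) (by rw [hz0]; exact (norm_snd_le z).trans hzR)
  have hh : ∀ s ∈ Icc 0 T, ∀ r ∈ Icc 0 T, ‖(Φ s z).1 - (Φ r z).1‖ ≤ √(Λ * |s - r|) :=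
    fun s hs r hr => (hz.isC1Curve hT).holder h0 hen hr hs
  refine ⟨fun s hs => ?_, hh⟩
  have hΛ0 : 0 ≤ Λ := (intervalIntegral.integral_nonneg hT.le fun s _ => by positivity).trans hen
  have h1 : ‖(Φ s z).1 - z.1‖ ≤ √(Λ * T) := by
    have h2 := hh s hs 0 h0
    rw [hz0, sub_zero, abs_of_nonneg hs.1] at h2
    exact h2.trans (Real.sqrt_le_sqrt (mul_le_mul_of_nonneg_left hs.2 hΛ0))
  have h3 : ‖z.1‖ ≤ |R₀| := ((norm_fst_le z).trans hzR).trans (le_abs_self _)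
  calc ‖(Φ s z).1‖ = ‖z.1 + ((Φ s z).1 - z.1)‖ := by rw [add_sub_cancel]
    _ ≤ ‖z.1‖ + ‖(Φ s z).1 - z.1‖ := norm_add_le _ _
    _ ≤ _ := add_le_add h3 h1

/-- The compactness of the space marginals in `C([0,T]; P_1)`: no rate in `ε` is needed, and the
`ε k` are not even supposed to tend to zero. -/
theorem exists_subseq_spaceMarginal (hT : 0 < T) (hM₀ : 0 < M₀)
    (hL : LagrangianAssumptions d M₀ L₀) (hg : TerminalAssumptions d M₀ g)
    (hμ₀ : InitialAssumptions d μ₀) {ε : ℕ → ℝ} (hε : ∀ k, 0 < ε k)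
    {u : ℕ → ℝ → E d → E d → ℝ} {μ : ℕ → ℝ → P1 (E d × E d)}
    (hsol : ∀ k, IsSolution d T L₀ g μ₀ (ε k) (u k) (μ k)) :
    ∃ φ : ℕ → ℕ, StrictMono φ ∧ ∃ m : ℝ → P1 (E d), IsContinuousFlow T m ∧
      FlowTendsto T (fun k t => (μ (φ k) t).spaceMarginal) m := by
  have := hμ₀.isProbabilityMeasure
  obtain ⟨R, Λ, hR, hpath⟩ := exists_holder_bound hT hM₀ hL hg hμ₀
  let : MeasurableSpace (holderPaths d T R Λ) := borel _
  have : BorelSpace (holderPaths d T R Λ) := ⟨rfl⟩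
  have : CompactSpace (holderPaths d T R Λ) :=
    isCompact_iff_compactSpace.1 (isCompact_holderPaths d T R Λ)
  have hlaw : ∀ k, ∃ ν : ProbabilityMeasure (holderPaths d T R Λ), ∀ t : Icc (0 : ℝ) T,
      ((μ k t).spaceMarginal).toMeasure
        = (ν : Measure (holderPaths d T R Λ)).map fun f => f.1 t := fun k => by
    obtain ⟨Φ, hΦ, hmap⟩ := (hsol k).flow
    obtain ⟨ν, hν⟩ := exists_path_law (X := fun t z => (Φ t z).1) hT hR
      (fun t ht => measurable_fst.comp_aemeasurable (hmap t ht).1) (hpath (hε k) (hsol k) hΦ)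
    refine ⟨ν, fun t => ?_⟩
    rw [← hν t]
    change (μ k t).toMeasure.map Prod.fst = _
    rw [(hmap t t.2).2, AEMeasurable.map_map_of_aemeasurable measurable_fst.aemeasurable
      (hmap t t.2).1]
    rfl
  choose ν hν using hlaw
  let e : ℝ → holderPaths d T R Λ → E d := fun t f => f.1 (projIcc 0 T hT.le t)
  have he : ∀ t (ht : t ∈ Icc 0 T), e t = fun f => f.1 ⟨t, ht⟩ := fun t ht => by
    simp only [e, projIcc_of_mem hT.le ht]
  have h1 : ∀ t ∈ Icc 0 T, ∀ f, ‖e t f‖ ≤ R := fun t _ f => f.2.1 _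
  have h2 : ∀ s ∈ Icc 0 T, ∀ t ∈ Icc 0 T, ∀ f, ‖e s f - e t f‖ ≤ √(Λ * |s - t|) :=
    fun s hs t ht f => by
      rw [he s hs, he t ht]
      exact f.2.2 ⟨s, hs⟩ ⟨t, ht⟩
  have h3 : ∀ t, LipschitzWith 1 (e t) := fun t => LipschitzWith.of_dist_le_mul fun f f' => by
    rw [NNReal.coe_one, one_mul]
    exact BoundedContinuousFunction.dist_coe_le_dist _
  have h4 : ∀ k, ∀ t ∈ Icc 0 T, ((μ k t).spaceMarginal).toMeasure
      = (ν k : Measure (holderPaths d T R Λ)).map (e t) := fun k t ht => by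
    rw [he t ht]
    exact hν k ⟨t, ht⟩
  exact exists_subseq_flowTendsto (mk := fun k t => (μ k t).spaceMarginal) hT h1 h2 h3 h4

end Marginals

end AccelMFG

end

theorem theorem4p8 (d : ℕ) (T M₀ : ℝ) (hT : 0 < T) (hM₀ : 0 < M₀)
    (L₀ : AccelMFG.E d → AccelMFG.E d → AccelMFG.P1 (AccelMFG.E d) → ℝ)
    (g : AccelMFG.E d → AccelMFG.P1 (AccelMFG.E d) → ℝ)
    (μ₀ : Measure (AccelMFG.E d × AccelMFG.E d))
    (hL : AccelMFG.LagrangianAssumptions d M₀ L₀)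
    (hg : AccelMFG.TerminalAssumptions d M₀ g)
    (hμ₀ : AccelMFG.InitialAssumptions d μ₀)
    (u : ℝ → ℝ → AccelMFG.E d → AccelMFG.E d → ℝ)
    (μ : ℝ → ℝ → AccelMFG.P1 (AccelMFG.E d × AccelMFG.E d))
    (hsol : ∀ ε : ℝ, 0 < ε → AccelMFG.IsSolution d T L₀ g μ₀ ε (u ε) (μ ε)) :
    -- every sequence `ε_n → 0` has a subsequence along which `m^ε` converges to some `m⁰`
    -- and `u^ε` to the value function of the limit problem driven by `m⁰`
    (∀ ε : ℕ → ℝ, (∀ n, 0 < ε n) → Tendsto ε atTop (𝓝 0) →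
      ∃ φ : ℕ → ℕ, StrictMono φ ∧ ∃ m₀ : ℝ → AccelMFG.P1 (AccelMFG.E d),
        AccelMFG.IsContinuousFlow T m₀ ∧
        AccelMFG.FlowTendsto T (fun k t => (μ (ε (φ k)) t).spaceMarginal) m₀ ∧
        ∃ u₀ : ℝ → AccelMFG.E d → ℝ, AccelMFG.IsLimitValue T L₀ g m₀ u₀ ∧
          AccelMFG.ValuesTendsto T (fun k => u (ε (φ k))) u₀) ∧
    -- whenever `m^{ε_k} → m⁰`, the same sequence `u^{ε_k}` converges
    (∀ ε : ℕ → ℝ, (∀ k, 0 < ε k) → Tendsto ε atTop (𝓝 0) →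
      ∀ m₀ : ℝ → AccelMFG.P1 (AccelMFG.E d), AccelMFG.IsContinuousFlow T m₀ →
        AccelMFG.FlowTendsto T (fun k t => (μ (ε k) t).spaceMarginal) m₀ →
        ∃ u₀ : ℝ → AccelMFG.E d → ℝ, AccelMFG.IsLimitValue T L₀ g m₀ u₀ ∧
          AccelMFG.ValuesTendsto T (fun k => u (ε k)) u₀) := by
  have hc : ∀ ε, 0 < ε → AccelMFG.IsContinuousFlow T fun t => (μ ε t).spaceMarginal :=
    fun ε hε => (hsol ε hε).continuousFlow.spaceMarginal
  have hlim : ∀ ε : ℕ → ℝ, (∀ k, 0 < ε k) → Tendsto ε atTop (𝓝 0) →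
      ∀ m₀ : ℝ → AccelMFG.P1 (AccelMFG.E d), AccelMFG.IsContinuousFlow T m₀ →
        AccelMFG.FlowTendsto T (fun k t => (μ (ε k) t).spaceMarginal) m₀ →
        ∃ u₀ : ℝ → AccelMFG.E d → ℝ, AccelMFG.IsLimitValue T L₀ g m₀ u₀ ∧
          AccelMFG.ValuesTendsto T (fun k => u (ε k)) u₀ :=
    fun ε hε hε0 m₀ hm₀ hmk => AccelMFG.values_tendsto hT hM₀ hL hg (fun k => hc _ (hε k)) hm₀ hmk
      hε hε0 fun k => (hsol _ (hε k)).value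
  refine ⟨fun ε hε hε0 => ?_, hlim⟩
  obtain ⟨φ, hφ, m₀, hm₀, hmk⟩ := AccelMFG.exists_subseq_spaceMarginal hT hM₀ hL hg hμ₀ hε
    fun k => hsol _ (hε k)
  exact ⟨φ, hφ, m₀, hm₀, hmk, hlim (fun k => ε (φ k)) (fun k => hε _)
    (hε0.comp hφ.tendsto_atTop) m₀ hm₀ hmk⟩
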